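/- Let $n\ge 1$ and let $\Sigma\subset\mathbb{R}^n$ be a compact set with $C^2$ boundary (near each point of $\partial\Sigma$, $\Sigma$ is a sublevel set $\{\varphi\le 0\}$ of a $C^2$ function $\varphi$ with nonvanishing gradient). For a two-dimensional affine plane $\mathcal H\subset\mathbb{R}^n$ let $\kappa_{\mathcal H}\in[0,\infty]$ be the supremum of the absolute curvature of $\partial\Sigma\cap\mathcal H$, taken over the points around which $\partial\Sigma\cap\mathcal H$ is an embedded $C^2$ arc ($0$ if there are none), and let $\mathcal R_{\mathcal H}\in[0,\infty]$ be the perimeter (one-dimensional Hausdorff measure) of $\partial\Sigma\cap\mathcal H$. Assume that $\Sigma$ has low curvature, that is, $$\kappa=\sup_{\mathcal H}\kappa_{\mathcal H}\,\mathcal R_{\mathcal H}<\infty ,$$ with $0\cdot\infty=0$ and the supremum of the empty family equal to $0$. For $\varepsilon>0$ let $\Sigma^{\varepsilon}=\{x\in\Sigma : d(x,\partial\Sigma)\ge\varepsilon\}$, and for $v\in\Sigma$ let $\mathrm{view}(v)=\{x\in\Sigma : [v,x]\subseteq\Sigma\}$. For $u\in\Sigma^{\varepsilon}$ let $P_u$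 be the distribution of the point reached by one Hit-and-Run step from $u$: choose a direction $\theta$ uniformly on the unit sphere, and then a point uniformly on the largest segment that contains $u$, is parallel to $\theta$ and is contained in $\Sigma$. If $u,v\in\Sigma^{\varepsilon}$ and $|u-v|\le\varepsilon'\le\varepsilon$, then $$P_u\bigl(\{x : x\notin \mathrm{view}(v)\}\bigr)\le \max\!\left(\frac{4}{\pi},\frac{\kappa}{\sin(\pi/8)}\right)\frac{\varepsilon'}{\varepsilon}.$$ -/

import Mathlib

open MeasureTheory Set Filter Topology
open scoped ENNReal

noncomputable section

/-- `S` is locally, around each of its boundary points, a sublevel set `{φ ≤ 0}` of a `C²`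
function `φ` with nonvanishing differential. -/
def HasC2Boundary {n : ℕ} (S : Set (EuclideanSpace ℝ (Fin n))) : Prop :=
  ∀ p ∈ frontier S, ∃ φ : EuclideanSpace ℝ (Fin n) → ℝ,
    ContDiffAt ℝ 2 φ p ∧ fderiv ℝ φ p ≠ 0 ∧ ∀ᶠ x in 𝓝 p, (x ∈ S ↔ φ x ≤ 0)

/-- Around `p`, the set `C` is an embedded arc of class `C²`, with curvature `k` at `p`:
the arc is parametrised by arc length by `γ`, with `γ 0 = p` and `‖γ'' 0‖ = k`. -/
def HasCurvatureAt {n : ℕ} (C : Set (EuclideanSpace ℝ (Fin n)))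
    (p : EuclideanSpace ℝ (Fin n)) (k : ℝ) : Prop :=
  ∃ (γ : ℝ → EuclideanSpace ℝ (Fin n)) (δ : ℝ), 0 < δ ∧
    ContDiffOn ℝ 2 γ (Icc (-δ) δ) ∧ InjOn γ (Icc (-δ) δ) ∧
    (∀ t ∈ Ioo (-δ) δ, ‖deriv γ t‖ = 1) ∧ γ 0 = p ∧
    (∀ᶠ x in 𝓝 p, (x ∈ C ↔ x ∈ γ '' Icc (-δ) δ)) ∧
    ‖deriv (deriv γ) 0‖ = k

/-- The largest curvature of `C`, over the points of `C` around which `C` is a `C²` arc. -/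
def maxCurvature {n : ℕ} (C : Set (EuclideanSpace ℝ (Fin n))) : ℝ≥0∞ :=
  ⨆ (p : EuclideanSpace ℝ (Fin n)) (k : ℝ) (_ : HasCurvatureAt C p k), ENNReal.ofReal k

/-- The length of `C`, as its one-dimensional Hausdorff measure. -/
def perimeter {n : ℕ} (C : Set (EuclideanSpace ℝ (Fin n))) : ℝ≥0∞ :=
  Measure.hausdorffMeasure 1 C

/-- The supremum, over all two-dimensional affine planes `H`, of the product of the largest
curvature and the perimeter of the section `∂S ∩ H`. -/
def sectionCurvature {n : ℕ} (S : Set (EuclideanSpace ℝ (Fin n))) : ℝ≥0∞ :=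
  ⨆ (H : AffineSubspace ℝ (EuclideanSpace ℝ (Fin n)))
    (_ : Module.finrank ℝ H.direction = 2),
    maxCurvature (frontier S ∩ (H : Set (EuclideanSpace ℝ (Fin n)))) *
      perimeter (frontier S ∩ (H : Set (EuclideanSpace ℝ (Fin n))))

/-- The points of `S` at distance at least `ε` from the boundary of `S`. -/
def innerPart {n : ℕ} (S : Set (EuclideanSpace ℝ (Fin n))) (ε : ℝ) :
    Set (EuclideanSpace ℝ (Fin n)) :=
  {x | x ∈ S ∧ ε ≤ Metric.infDist x (frontier S)}

/-- The points of `S` that are visible from `v`. -/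
def view {n : ℕ} (S : Set (EuclideanSpace ℝ (Fin n))) (v : EuclideanSpace ℝ (Fin n)) :
    Set (EuclideanSpace ℝ (Fin n)) :=
  {x | x ∈ S ∧ segment ℝ v x ⊆ S}

/-- The uniform probability distribution on the unit sphere. -/
def uniformDirection (n : ℕ) :
    Measure (Metric.sphere (0 : EuclideanSpace ℝ (Fin n)) 1) :=
  ProbabilityTheory.cond (volume : Measure (EuclideanSpace ℝ (Fin n))).toSphere univ

/-- The parameters `t` of the points `u + t θ` of the largest interval that contains `u` and is
contained in the intersection of `S` with the line through `u` in direction `θ`. -/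
def chordParams {n : ℕ} (S : Set (EuclideanSpace ℝ (Fin n)))
    (u θ : EuclideanSpace ℝ (Fin n)) : Set ℝ :=
  {t | segment ℝ u (u + t • θ) ⊆ S}

/-- The uniform distribution on the chord of `S` through `u` in direction `θ`. -/
def uniformOnChord {n : ℕ} (S : Set (EuclideanSpace ℝ (Fin n)))
    (u θ : EuclideanSpace ℝ (Fin n)) : Measure (EuclideanSpace ℝ (Fin n)) :=
  (ProbabilityTheory.cond (volume : Measure ℝ) (chordParams S u θ)).map (fun t => u + t • θ)

/-- The distribution of the point reached by one Hit-and-Run step in `S` from `u`: choose a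
uniform direction, then a uniform point on the chord through `u` in that direction. -/
def hitAndRun {n : ℕ} (S : Set (EuclideanSpace ℝ (Fin n)))
    (u : EuclideanSpace ℝ (Fin n)) : Measure (EuclideanSpace ℝ (Fin n)) :=
  (uniformDirection n).bind (fun θ => uniformOnChord S u θ)

end

/-- In a closed set the chord varies measurably with the direction. -/
theorem measurable_uniformOnChord {n : ℕ} {S : Set (EuclideanSpace ℝ (Fin n))}
    (hS : IsClosed S) (u : EuclideanSpace ℝ (Fin n)) :
    Measurable (fun θ : Metric.sphere (0 : EuclideanSpace ℝ (Fin n)) 1 =>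
      uniformOnChord S u θ) := by
  have hG : IsClosed {q : Metric.sphere (0 : EuclideanSpace ℝ (Fin n)) 1 × ℝ |
      q.2 ∈ chordParams S u q.1} := by
    have hE : {q : Metric.sphere (0 : EuclideanSpace ℝ (Fin n)) 1 × ℝ |
        q.2 ∈ chordParams S u q.1} =
        ⋂ r ∈ Icc (0 : ℝ) 1, {q | u + r • (q.2 • (q.1 : EuclideanSpace ℝ (Fin n))) ∈ S} := by
      ext q
      simp only [chordParams, mem_ofPred_eq, mem_iInter, segment_eq_image',
        add_sub_cancel_left, subset_def, forall_mem_image]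
    rw [hE]
    refine isClosed_biInter fun r _ => hS.preimage ?_
    fun_prop
  have hc : ∀ θ : EuclideanSpace ℝ (Fin n), Measurable (fun t : ℝ => u + t • θ) := fun θ =>
    Continuous.measurable (by fun_prop)
  have hmap : Measurable (fun q : Metric.sphere (0 : EuclideanSpace ℝ (Fin n)) 1 × ℝ =>
      u + q.2 • (q.1 : EuclideanSpace ℝ (Fin n))) :=
    Continuous.measurable (by fun_prop)
  have hI : ∀ θ : Metric.sphere (0 : EuclideanSpace ℝ (Fin n)) 1,
      MeasurableSet (chordParams S u θ) := fun θ =>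
    measurable_prodMk_left (x := θ) hG.measurableSet
  refine Measure.measurable_of_measurable_coe _ fun A hA => ?_
  have hval : ∀ θ : Metric.sphere (0 : EuclideanSpace ℝ (Fin n)) 1,
      uniformOnChord S u θ A = (volume (chordParams S u θ))⁻¹ *
        volume (chordParams S u θ ∩
          (fun t : ℝ => u + t • (θ : EuclideanSpace ℝ (Fin n))) ⁻¹' A) := fun θ => by
    rw [uniformOnChord, Measure.map_apply (hc θ) hA, ProbabilityTheory.cond_apply (hI θ)]
  simp only [hval]
  refine Measurable.mul (Measurable.inv ?_) ?_
  · exact measurable_measure_prodMk_left (ν := (volume : Measure ℝ)) hG.measurableSet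
  · exact measurable_measure_prodMk_left (ν := (volume : Measure ℝ))
      (hG.measurableSet.inter (hmap hA))

/-!
Dimension two is the only one in which there is anything to estimate: in every other dimension low
curvature implies `hitAndRun S u {x | x ∉ view S v} = 0`.

Suppose that `u + t θ` is on the chord through `u` but is not visible from `v`. When `x` moves along
the chord away from `u`, the segment `[v, x]` stays in `S` until, for some `x₀ = u + t₀ θ`, it
touches the boundary at an inner point `p`, where it is tangent to the boundary
(`exists_first_contact`).

*Dimension different from two.* Here no line through an interior point of `S` is tangent to the
boundary (`fderiv_ne_zero_of_mem_line`), so everything that is visible from `u` is visible from `v`.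
In dimension at least three let a line through an interior point be tangent at `p`. All plane
sections through the line have perimeter bounded below, hence curvature bounded above. But by
Meusnier's theorem the curvature at `p` of the section tends to infinity as the plane approaches the
tangent space, unless the second fundamental form vanishes on the line
(`second_deriv_eq_zero_of_tangent`). The same holds for all tangents close by. So the boundary
contains a neighbourhood of `p` in the line, then the part of the line that is in the boundary is
open and closed, and the whole line is in the boundary: a contradiction.

*Dimension two.* Let `k` be the largest curvature and `R` the length of the boundary, so that
`k R ≤ κ`. Each boundary point `p` is the centre of an arc that is a graph over a segment of the
tangent of half-length `L = 3 / (5 k)`, with slopes at most `3 / 4` (`exists_long_graph`), since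
the sine of the angle with the tangent grows at most at rate `k`. At most `25 k R / 14` of these
arcs cover the boundary (`exists_arc_cover`); this also gives `2 ≤ k R`, so that `ε' / ε` may be
assumed to be less than `sin (π / 8) / 2`, as the claim is trivial otherwise.

Fix one of the arcs, and use its coordinates. Consider the directions `θ` whose line of sight
touches this arc at a point `p`, to the right of `v`. Let `d θ` be the abscissa of `p` relative to
`u`, and `b θ` that of the end of the chord. The hidden fraction of the half-chord is at most
`1 - d / b`. The slope of `θ` is between the slopes of the lines `v p` and `u p`, which differ by at
most `(5 / 4) ε' / d`; and if `d θ ≤ d θ' < b θ`, then the slope of `θ` is also between those of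
`v p'` and `u p'`, where `p'` is the point of contact of `θ'`, because neither the chord nor the
line of sight crosses the arc (`IsContact.slope_mem_Icc`). So for every `r` the directions with
`d ≤ r < b` fill an angle at most `(5 / 4) ε' / sup d`. Writing `1 - d / b` as the integral of
`d / r²` over `d ≤ r < b` and integrating over `θ` first, one finds that the mean of `1 - d / b` is
at most `(5 / 4) ε' / (2 π d₀)`, where `d₀ = (4 / 5) ε - ε'` is a lower bound of `d`
(`exists_telescoping_majorant`). Multiplying by four (two halves of the chord, contacts to the left
and to the right of `v`) and by the number of arcs gives at most `2.4 κ ε' / ε`, which is less than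
`κ / sin (π / 8) · ε' / ε`.
-/

/-! ### Defining functions and local graphs -/

/-- `φ` is a defining function of `S` near the boundary point `p`: it is of class `C²` with
nonvanishing differential at `p`, and `S` is the sublevel set `{φ ≤ 0}` near `p`. -/
structure IsDefiningAt {n : ℕ} (S : Set (EuclideanSpace ℝ (Fin n)))
    (φ : EuclideanSpace ℝ (Fin n) → ℝ) (p : EuclideanSpace ℝ (Fin n)) : Prop where
  contDiffAt : ContDiffAt ℝ 2 φ p
  fderiv_ne : fderiv ℝ φ p ≠ 0
  mem_iff : ∀ᶠ x in 𝓝 p, (x ∈ S ↔ φ x ≤ 0)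

/-- The affine parametrisation `(x, y) ↦ p + x τ + y ν` of the plane through `p` spanned by `τ`
and `ν`. -/
def chart {n : ℕ} (p τ ν : EuclideanSpace ℝ (Fin n)) (z : ℝ × ℝ) : EuclideanSpace ℝ (Fin n) :=
  p + z.1 • τ + z.2 • ν

/-- `τ`, `ν` is an orthonormal pair. -/
structure IsFrame {n : ℕ} (τ ν : EuclideanSpace ℝ (Fin n)) : Prop where
  norm_left : ‖τ‖ = 1
  norm_right : ‖ν‖ = 1
  inner_eq : inner ℝ τ ν = 0

/-- The orthogonal coordinates, centred at `p`, with respect to `τ` and `ν`. -/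
noncomputable def coords {n : ℕ} (p τ ν q : EuclideanSpace ℝ (Fin n)) : ℝ × ℝ :=
  (inner ℝ τ (q - p), inner ℝ ν (q - p))

/-- In the coordinates of `chart p τ ν`, the set `S` is the hypograph of `h` near the point of
abscissa `x` of the graph of `h`, and `h` is of class `C²` there. -/
def IsHypographAt {n : ℕ} (S : Set (EuclideanSpace ℝ (Fin n)))
    (p τ ν : EuclideanSpace ℝ (Fin n)) (h : ℝ → ℝ) (x : ℝ) : Prop :=
  ContDiffAt ℝ 2 h x ∧ ∀ᶠ z in 𝓝 (x, h x), (chart p τ ν z ∈ S ↔ z.2 ≤ h z.1)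

section Charts

variable {n : ℕ} {S : Set (EuclideanSpace ℝ (Fin n))} {p τ ν q : EuclideanSpace ℝ (Fin n)}
  {φ : EuclideanSpace ℝ (Fin n) → ℝ} {h : ℝ → ℝ}

theorem contDiff_chart : ContDiff ℝ 2 (chart p τ ν) := by
  unfold chart; fun_prop

theorem continuous_chart : Continuous (chart p τ ν) := contDiff_chart.continuous

theorem continuous_coords : Continuous (coords p τ ν) := by
  unfold coords; fun_prop

theorem hasFDerivAt_chart (z : ℝ × ℝ) : HasFDerivAt (chart p τ ν)
    ((ContinuousLinearMap.fst ℝ ℝ ℝ).smulRight τ + (ContinuousLinearMap.snd ℝ ℝ ℝ).smulRight ν)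
    z := by
  have h1 : HasFDerivAt (fun z : ℝ × ℝ => z.1 • τ)
      ((ContinuousLinearMap.fst ℝ ℝ ℝ).smulRight τ) z := hasFDerivAt_fst.smul_const τ
  have h2 : HasFDerivAt (fun z : ℝ × ℝ => z.2 • ν)
      ((ContinuousLinearMap.snd ℝ ℝ ℝ).smulRight ν) z := hasFDerivAt_snd.smul_const ν
  exact (h1.const_add p).add h2

theorem IsFrame.symm (hf : IsFrame τ ν) : IsFrame ν τ :=
  ⟨hf.norm_right, hf.norm_left, by rw [real_inner_comm]; exact hf.inner_eq⟩

theorem IsFrame.inner_left (hf : IsFrame τ ν) (a b : ℝ) : inner ℝ τ (a • τ + b • ν) = a := by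
  rw [inner_add_right, inner_smul_right, inner_smul_right, hf.inner_eq,
    real_inner_self_eq_norm_sq, hf.norm_left]; ring

theorem IsFrame.inner_right (hf : IsFrame τ ν) (a b : ℝ) : inner ℝ ν (a • τ + b • ν) = b := by
  rw [add_comm]; exact hf.symm.inner_left b a

theorem IsFrame.norm_sq (hf : IsFrame τ ν) (a b : ℝ) : ‖a • τ + b • ν‖ ^ 2 = a ^ 2 + b ^ 2 := by
  rw [← real_inner_self_eq_norm_sq, inner_add_left, inner_smul_left, inner_smul_left,
    hf.inner_left, hf.inner_right]
  simp; ring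

theorem IsFrame.neg_left (hf : IsFrame τ ν) : IsFrame (-τ) ν :=
  ⟨by rw [norm_neg, hf.norm_left], hf.norm_right, by rw [inner_neg_left, hf.inner_eq, neg_zero]⟩

theorem coords_chart (hf : IsFrame τ ν) (z : ℝ × ℝ) : coords p τ ν (chart p τ ν z) = z := by
  have : chart p τ ν z - p = z.1 • τ + z.2 • ν := by unfold chart; module
  unfold coords
  rw [this, hf.inner_left, hf.inner_right]

theorem chart_sub_chart (z z' : ℝ × ℝ) : chart p τ ν z - chart p τ ν z' =
    (z.1 - z'.1) • τ + (z.2 - z'.2) • ν := by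
  unfold chart; module

theorem IsDefiningAt.eventually (hφ : IsDefiningAt S φ p) :
    ∀ᶠ q in 𝓝 p, IsDefiningAt S φ q := by
  have h1 := hφ.contDiffAt.eventually (by simp)
  have hc : ContinuousAt (fderiv ℝ φ) p :=
    (hφ.contDiffAt.fderiv_right (m := 1) (by norm_num)).continuousAt
  filter_upwards [h1, hc.eventually_ne hφ.fderiv_ne, hφ.mem_iff.eventually_nhds] with q a b c
  exact ⟨a, b, c⟩

theorem IsDefiningAt.mem_frontier_iff (hφ : IsDefiningAt S φ p) (hS : IsClosed S) :
    p ∈ frontier S ↔ φ p = 0 := by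
  have hp := hφ.mem_iff.self_of_nhds
  have hc := hφ.contDiffAt.continuousAt
  rw [hS.frontier_eq, Set.mem_sdiff, mem_interior_iff_mem_nhds]
  constructor
  · rintro ⟨h1, h2⟩
    refine le_antisymm (hp.1 h1) (not_lt.1 fun h3 => h2 ?_)
    filter_upwards [hφ.mem_iff, hc.eventually_lt_const h3] with x hx hx'
    exact hx.2 hx'.le
  · intro h1
    refine ⟨hp.2 h1.le, fun h2 => hφ.fderiv_ne (IsLocalMax.fderiv_eq_zero ?_)⟩
    filter_upwards [hφ.mem_iff, h2] with x hx hx'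
    rw [h1]; exact hx.1 hx'

theorem IsDefiningAt.eventually_mem_frontier_iff (hφ : IsDefiningAt S φ p) (hS : IsClosed S) :
    ∀ᶠ x in 𝓝 p, (x ∈ frontier S ↔ φ x = 0) :=
  hφ.eventually.mono fun _ hx => hx.mem_frontier_iff hS

theorem HasC2Boundary.exists_isDefiningAt (hS : HasC2Boundary S) (hp : p ∈ frontier S) :
    ∃ φ, IsDefiningAt S φ p :=
  let ⟨φ, h1, h2, h3⟩ := hS p hp
  ⟨φ, h1, h2, h3⟩

/-- The implicit function theorem, in the form needed here: in a plane transversal to the boundary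
the set is locally a hypograph. -/
theorem IsDefiningAt.exists_isHypographAt {z₀ : ℝ × ℝ}
    (hφ : IsDefiningAt S φ (chart p τ ν z₀)) (h0 : φ (chart p τ ν z₀) = 0)
    (hpos : 0 < fderiv ℝ φ (chart p τ ν z₀) ν) :
    ∃ h : ℝ → ℝ, h z₀.1 = z₀.2 ∧ IsHypographAt S p τ ν h z₀.1 ∧
      ∀ᶠ z in 𝓝 z₀, (φ (chart p τ ν z) = 0 ↔ z.2 = h z.1) := by
  set ψ : ℝ × ℝ → ℝ := fun z => φ (chart p τ ν z) with hψ
  have hψc : ContDiffAt ℝ 2 ψ z₀ := hφ.contDiffAt.comp z₀ contDiff_chart.contDiffAt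
  have hder : ∀ᶠ z in 𝓝 z₀, HasFDerivAt ψ ((fderiv ℝ φ (chart p τ ν z)).comp
      ((ContinuousLinearMap.fst ℝ ℝ ℝ).smulRight τ +
        (ContinuousLinearMap.snd ℝ ℝ ℝ).smulRight ν)) z := by
    have h1 := continuous_chart.continuousAt.eventually hφ.eventually
    filter_upwards [h1] with z hz
    exact ((hz.contDiffAt.differentiableAt (by norm_num)).hasFDerivAt).comp z
      (hasFDerivAt_chart z)
  have hinv : (fderiv ℝ ψ z₀ ∘L .inr ℝ ℝ ℝ).IsInvertible := by
    rw [hder.self_of_nhds.fderiv]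
    refine ⟨ContinuousLinearEquiv.unitsEquivAut ℝ (Units.mk0 _ hpos.ne'), ?_⟩
    ext; simp
  set h := hψc.implicitFunction (by norm_num) hinv with hh
  have hh0 : h z₀.1 = z₀.2 := hψc.implicitFunction_apply_self _ _
  have hhc : ContDiffAt ℝ 2 h z₀.1 := hψc.contDiffAt_implicitFunction _ _
  have hz0 : ψ z₀ = 0 := h0
  have hiff := hψc.eventually_apply_eq_iff_implicitFunction (by norm_num) hinv
  have hzero := hψc.eventually_apply_implicitFunction (by norm_num) hinv
  rw [hz0] at hiff hzero
  rw [← hh] at hiff hzero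
  refine ⟨h, hh0, ⟨hhc, ?_⟩, hiff.mono fun z hz => by rw [eq_comm (a := z.2)]; exact hz⟩
  have hpos' : ∀ᶠ z in 𝓝 z₀, 0 < fderiv ℝ φ (chart p τ ν z) ν := by
    have hc : ContinuousAt (fun z => fderiv ℝ φ (chart p τ ν z) ν) z₀ := by
      have := (hφ.contDiffAt.fderiv_right (m := 1) (by norm_num)).continuousAt
      have h2 : ContinuousAt (fun z => fderiv ℝ φ (chart p τ ν z)) z₀ :=
        ContinuousAt.comp (f := chart p τ ν) this continuous_chart.continuousAt
      exact h2.clm_apply continuousAt_const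
    exact hc.eventually_const_lt hpos
  obtain ⟨r, hr, hball⟩ := Metric.eventually_nhds_iff_ball.1 (hder.and hpos')
  have hz0' : (z₀.1, h z₀.1) = z₀ := by rw [hh0]
  rw [hz0']
  have hgr : ∀ᶠ z in 𝓝 z₀, (z.1, h z.1) ∈ Metric.ball z₀ r := by
    have : ContinuousAt (fun z : ℝ × ℝ => (z.1, h z.1)) z₀ :=
      continuousAt_fst.prodMk (ContinuousAt.comp (f := Prod.fst) hhc.continuousAt continuousAt_fst)
    refine this.eventually_mem ?_
    rw [hz0']; exact Metric.ball_mem_nhds _ hr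
  filter_upwards [hgr, Metric.ball_mem_nhds z₀ hr,
    continuous_chart.continuousAt.eventually hφ.mem_iff,
    continuousAt_fst.eventually hzero] with z hz1 hz2 hz3 hz4
  rw [hz3]
  -- on the vertical line through `z` the function is strictly increasing inside the ball
  have hmono : StrictMonoOn (fun y => ψ (z.1, y)) {y | (z.1, y) ∈ Metric.ball z₀ r} := by
    have hconv : Convex ℝ {y | (z.1, y) ∈ Metric.ball z₀ r} := by
      have : {y | (z.1, y) ∈ Metric.ball z₀ r} = Metric.ball z₀.2 r := by
        ext y
        have hz2' : dist z.1 z₀.1 < r := (max_lt_iff.1 hz2).1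
        simp [Prod.dist_eq, hz2']
      rw [this]; exact convex_ball _ _
    have hd : ∀ y ∈ {y | (z.1, y) ∈ Metric.ball z₀ r},
        HasDerivAt (fun y => ψ (z.1, y)) (fderiv ℝ φ (chart p τ ν (z.1, y)) ν) y := by
      intro y hy
      have h1 := (hball _ hy).1
      have h2 : HasDerivAt (fun y : ℝ => (z.1, y)) ((0 : ℝ), (1 : ℝ)) y :=
        (hasDerivAt_const y z.1).prodMk (hasDerivAt_id y)
      have := HasFDerivAt.comp_hasDerivAt (f := fun y : ℝ => (z.1, y)) y h1 h2
      exact HasDerivAt.congr_deriv this (by simp)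
    refine strictMonoOn_of_deriv_pos hconv (fun y hy => (hd y hy).continuousAt.continuousWithinAt)
      fun y hy => ?_
    have hy' : y ∈ {y | (z.1, y) ∈ Metric.ball z₀ r} := interior_subset hy
    rw [(hd y hy').deriv]
    exact (hball _ hy').2
  have := hmono.le_iff_le (a := z.2) (b := h z.1) hz2 hz1
  simp only [hz4] at this
  exact this

/-- The graph of the implicit function is tangent to the boundary. -/
theorem deriv_graph_eq {z₀ : ℝ × ℝ} (hφ : DifferentiableAt ℝ φ (chart p τ ν z₀))
    (hh0 : h z₀.1 = z₀.2) (hh : DifferentiableAt ℝ h z₀.1)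
    (hz : ∀ᶠ z in 𝓝 z₀, (φ (chart p τ ν z) = 0 ↔ z.2 = h z.1)) :
    fderiv ℝ φ (chart p τ ν z₀) (τ + deriv h z₀.1 • ν) = 0 := by
  have h2 : HasDerivAt (fun x : ℝ => (x, h x)) ((1 : ℝ), deriv h z₀.1) z₀.1 :=
    (hasDerivAt_id _).prodMk hh.hasDerivAt
  have e : (z₀.1, h z₀.1) = z₀ := by rw [hh0]
  have h3 : HasDerivAt (fun x => φ (chart p τ ν (x, h x)))
      (fderiv ℝ φ (chart p τ ν z₀) (τ + deriv h z₀.1 • ν)) z₀.1 := by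
    have h4 := HasFDerivAt.comp_hasDerivAt (f := fun x => (x, h x)) _
      (hasFDerivAt_chart (p := p) (τ := τ) (ν := ν) (z₀.1, h z₀.1)) h2
    have h6 : HasFDerivAt φ (fderiv ℝ φ (chart p τ ν z₀)) (chart p τ ν (z₀.1, h z₀.1)) := by
      rw [e]; exact hφ.hasFDerivAt
    have := HasFDerivAt.comp_hasDerivAt (f := fun x => chart p τ ν (x, h x)) _ h6 h4
    exact HasDerivAt.congr_deriv this (by simp)
  have h5 : (fun x => φ (chart p τ ν (x, h x))) =ᶠ[𝓝 z₀.1] fun _ => 0 := by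
    have : Tendsto (fun x => (x, h x)) (𝓝 z₀.1) (𝓝 z₀) := by
      have := h2.continuousAt.tendsto
      simpa only [e] using this
    filter_upwards [this.eventually hz] with x hx
    exact hx.2 rfl
  exact h3.unique ((hasDerivAt_const _ _).congr_of_eventuallyEq h5)

end Charts

/-! ### The curvature of a graph -/

section Curvature

variable {n : ℕ} {C : Set (EuclideanSpace ℝ (Fin n))} {p τ ν : EuclideanSpace ℝ (Fin n)}
  {h : ℝ → ℝ}

/-- Reparametrisation of a graph by arc length: the inverse `X` of the arc length function
satisfies `X' = 1 / √(1 + h'(X)²)`. -/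
theorem exists_arcLength_inverse {x₀ : ℝ} (hh : ContDiffAt ℝ 2 h x₀) :
    ∃ X σ : ℝ → ℝ, X 0 = x₀ ∧ σ x₀ = 0 ∧ ContinuousAt σ x₀ ∧
      (∀ᶠ x in 𝓝 x₀, X (σ x) = x) ∧
      ∀ᶠ s in 𝓝 0, ContDiffAt ℝ 2 X s ∧ σ (X s) = s ∧
        HasDerivAt X (√(1 + deriv h (X s) ^ 2))⁻¹ s := by
  have hev := hh.eventually (by simp)
  obtain ⟨r, hr, hball⟩ := Metric.eventually_nhds_iff_ball.1 hev
  set m : ℝ → ℝ := fun x => √(1 + deriv h x ^ 2) with hm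
  have hmpos : ∀ x, 0 < m x := fun x => Real.sqrt_pos.2 (by positivity)
  have hmc : ∀ x ∈ Metric.ball x₀ r, ContDiffAt ℝ 1 m x := by
    intro x hx
    have h1 : ContDiffAt ℝ 1 (deriv h) x := (hball x hx).derivWithin (m := 1) (by norm_num)
    exact ContDiffAt.sqrt (by fun_prop) (by positivity)
  set σ : ℝ → ℝ := fun x => ∫ t in x₀..x, m t with hσ
  have hcont : ContinuousOn m (Metric.ball x₀ r) :=
    fun x hx => (hmc x hx).continuousAt.continuousWithinAt
  have hσd : ∀ x ∈ Metric.ball x₀ r, HasDerivAt σ (m x) x := by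
    intro x hx
    have hsub : uIcc x₀ x ⊆ Metric.ball x₀ r :=
      (convex_ball x₀ r).ordConnected.uIcc_subset (Metric.mem_ball_self hr) hx
    refine intervalIntegral.integral_hasDerivAt_right
      (hcont.mono hsub).intervalIntegrable ?_ (hmc x hx).continuousAt
    exact hcont.stronglyMeasurableAtFilter Metric.isOpen_ball x hx
  have hσ2 : ∀ x ∈ Metric.ball x₀ r, ContDiffAt ℝ 2 σ x := by
    have : ContDiffOn ℝ (1 + 1) σ (Metric.ball x₀ r) := by
      rw [contDiffOn_succ_iff_deriv_of_isOpen Metric.isOpen_ball]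
      refine ⟨fun x hx => (hσd x hx).differentiableAt.differentiableWithinAt, by simp, ?_⟩
      refine ContDiffOn.congr (f := m) (fun x hx => (hmc x hx).contDiffWithinAt) fun x hx => ?_
      exact (hσd x hx).deriv
    intro x hx
    exact (by simpa [one_add_one_eq_two] using this :
      ContDiffOn ℝ 2 σ (Metric.ball x₀ r)).contDiffAt (Metric.isOpen_ball.mem_nhds hx)
  have hx0 : x₀ ∈ Metric.ball x₀ r := Metric.mem_ball_self hr
  have hσ0 : σ x₀ = 0 := by simp [hσ]
  have hst : HasStrictDerivAt σ (m x₀) x₀ :=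
    (hσ2 x₀ hx0).hasStrictDerivAt' (hσd x₀ hx0) (by norm_num)
  set X : ℝ → ℝ := hst.localInverse σ (m x₀) x₀ (hmpos x₀).ne' with hX
  have hX0 : X 0 = x₀ := by
    rw [← hσ0]; exact HasStrictFDerivAt.localInverse_apply_image _
  have hXl : ∀ᶠ x in 𝓝 x₀, X (σ x) = x := HasStrictFDerivAt.eventually_left_inverse _
  have hXr : ∀ᶠ s in 𝓝 0, σ (X s) = s := by
    rw [← hσ0]; exact HasStrictFDerivAt.eventually_right_inverse _
  have hXs : HasStrictDerivAt X (m x₀)⁻¹ (σ x₀) := hst.to_localInverse (hmpos x₀).ne'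
  have hXc : ContDiffAt ℝ 2 X 0 := by
    rw [← hσ0]
    exact ContDiffAt.to_localInverse (hσ2 x₀ hx0)
      (hst.hasStrictFDerivAt_equiv (hmpos x₀).ne').hasFDerivAt (by norm_num)
  refine ⟨X, σ, hX0, hσ0, (hσd x₀ hx0).continuousAt, hXl, ?_⟩
  have hb : ∀ᶠ s in 𝓝 0, X s ∈ Metric.ball x₀ r :=
    hXc.continuousAt.eventually_mem (by rw [hX0]; exact Metric.ball_mem_nhds _ hr)
  filter_upwards [hXc.eventually (by simp), hXr.eventually_nhds, hb] with s h1 h2 h3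
  refine ⟨h1, h2.self_of_nhds, ?_⟩
  have h4 := (h1.differentiableAt (by norm_num)).hasDerivAt
  have h5 : HasDerivAt (fun s => σ (X s)) (m (X s) * deriv X s) s := (hσd _ h3).comp s h4
  have h6 : m (X s) * deriv X s = 1 :=
    h5.unique ((hasDerivAt_id s).congr_of_eventuallyEq h2)
  rw [eq_inv_of_mul_eq_one_right h6] at h4
  exact h4

/-- A set which is locally the graph of a `C²` function has the curvature `|h''| / √(1 + h'²)³`. -/
theorem hasCurvatureAt_graph (hf : IsFrame τ ν) {x₀ : ℝ} (hh : ContDiffAt ℝ 2 h x₀)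
    (hC : ∀ᶠ q in 𝓝 (chart p τ ν (x₀, h x₀)),
      (q ∈ C ↔ q = chart p τ ν ((coords p τ ν q).1, h (coords p τ ν q).1))) :
    HasCurvatureAt C (chart p τ ν (x₀, h x₀))
      (|deriv (deriv h) x₀| / √(1 + deriv h x₀ ^ 2) ^ 3) := by
  obtain ⟨X, σ, hX0, hσ0, hσc, hXl, hXr⟩ := exists_arcLength_inverse hh
  set m : ℝ → ℝ := fun x => √(1 + deriv h x ^ 2) with hm
  have hmpos : ∀ x, 0 < m x := fun x => Real.sqrt_pos.2 (by positivity)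
  have hmsq : ∀ x, m x ^ 2 = 1 + deriv h x ^ 2 := fun x => Real.sq_sqrt (by positivity)
  set γ : ℝ → EuclideanSpace ℝ (Fin n) := fun s => chart p τ ν (X s, h (X s)) with hγ
  have hγ0 : γ 0 = chart p τ ν (x₀, h x₀) := by rw [hγ]; simp only [hX0]
  have hXc : ContinuousAt X 0 := hXr.self_of_nhds.1.continuousAt
  have hhc : ContinuousAt (fun s => h (X s)) 0 :=
    ContinuousAt.comp (g := h) (by rw [hX0]; exact hh.continuousAt) hXc
  have hγc : ContinuousAt γ 0 :=
    continuous_chart.continuousAt.comp (f := fun s => (X s, h (X s))) (hXc.prodMk hhc)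
  have hh' : ∀ᶠ s in 𝓝 0, ContDiffAt ℝ 2 h (X s) := by
    refine hXc.eventually (p := fun x => ContDiffAt ℝ 2 h x) ?_
    rw [hX0]; exact hh.eventually (by simp)
  have hC' : ∀ᶠ s in 𝓝 0, (γ s ∈ C ↔ γ s =
      chart p τ ν ((coords p τ ν (γ s)).1, h (coords p τ ν (γ s)).1)) := by
    refine hγc.eventually (p := fun q => (q ∈ C ↔ q =
      chart p τ ν ((coords p τ ν q).1, h (coords p τ ν q).1))) ?_
    rw [hγ0]; exact hC
  obtain ⟨r, hr, hball⟩ := Metric.eventually_nhds_iff_ball.1 ((hXr.and hh').and hC')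
  have hder : ∀ s ∈ Metric.ball (0 : ℝ) r,
      HasDerivAt γ ((m (X s))⁻¹ • τ + (deriv h (X s) / m (X s)) • ν) s := by
    intro s hs
    obtain ⟨⟨⟨-, -, h1⟩, h2⟩, -⟩ := hball s hs
    have h3 : HasDerivAt (fun s => h (X s)) (deriv h (X s) * (m (X s))⁻¹) s :=
      (h2.differentiableAt (by norm_num)).hasDerivAt.comp s h1
    exact ((h1.smul_const τ).const_add p).add (h3.smul_const ν)
  have hm2 : 0 < r / 2 := by positivity
  have hIcc : ∀ s ∈ Icc (-(r / 2)) (r / 2), s ∈ Metric.ball (0 : ℝ) r := by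
    intro s hs
    rw [Metric.mem_ball, Real.dist_eq, sub_zero, abs_lt]
    constructor <;> linarith [hs.1, hs.2]
  refine ⟨γ, r / 2, hm2, ?_, ?_, ?_, hγ0, ?_, ?_⟩
  · intro s hs
    obtain ⟨⟨⟨h1, -⟩, h2⟩, -⟩ := hball s (hIcc s hs)
    have h3 : ContDiffAt ℝ 2 (fun s => h (X s)) s := h2.comp s h1
    exact (contDiff_chart.contDiffAt.comp s (h1.prodMk h3)).contDiffWithinAt
  · intro s hs t ht hst
    have h1 := congrArg (fun q => (coords p τ ν q).1) hst
    simp only [hγ, coords_chart hf] at h1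
    rw [← (hball s (hIcc s hs)).1.1.2.1, ← (hball t (hIcc t ht)).1.1.2.1, h1]
  · intro s hs
    rw [(hder s (hIcc s (Ioo_subset_Icc_self hs))).deriv]
    have h1 := hf.norm_sq (m (X s))⁻¹ (deriv h (X s) / m (X s))
    have h2 : (m (X s))⁻¹ ^ 2 + (deriv h (X s) / m (X s)) ^ 2 = 1 := by
      have := (hmpos (X s)).ne'
      field_simp
      linarith [hmsq (X s)]
    rw [h2] at h1
    exact (pow_eq_one_iff_of_nonneg (norm_nonneg _) two_ne_zero).1 h1
  · have hx : ContinuousAt (fun q => (coords p τ ν q).1) (chart p τ ν (x₀, h x₀)) :=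
      (continuous_fst.comp continuous_coords).continuousAt
    have hx0 : (coords p τ ν (chart p τ ν (x₀, h x₀))).1 = x₀ := by rw [coords_chart hf]
    have h1 : ∀ᶠ x in 𝓝 x₀, X (σ x) = x ∧ σ x ∈ Icc (-(r / 2)) (r / 2) := by
      refine hXl.and (hσc.eventually_mem ?_)
      rw [hσ0]; exact Icc_mem_nhds (by linarith) hm2
    have h2 := hx.eventually (p := fun x => X (σ x) = x ∧ σ x ∈ Icc (-(r / 2)) (r / 2))
      (by beta_reduce; rw [hx0]; exact h1)
    filter_upwards [hC, h2] with q hq1 ⟨hq2, hq3⟩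
    constructor
    · intro hq
      refine ⟨σ (coords p τ ν q).1, hq3, ?_⟩
      rw [hq1] at hq
      simp only [hγ, hq2]
      exact hq.symm
    · rintro ⟨s, hs, rfl⟩
      rw [(hball s (hIcc s hs)).2]
      simp only [hγ, coords_chart hf]
  · have h1 : deriv γ =ᶠ[𝓝 0] fun s => (m (X s))⁻¹ • τ + (deriv h (X s) / m (X s)) • ν := by
      filter_upwards [Metric.ball_mem_nhds (0 : ℝ) hr] with s hs
      exact (hder s hs).deriv
    rw [h1.deriv_eq]
    obtain ⟨⟨⟨-, -, h2⟩, h3⟩, -⟩ := hball 0 (Metric.mem_ball_self hr)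
    have hd2 : HasDerivAt (deriv h) (deriv (deriv h) x₀) x₀ :=
      ((hh.derivWithin (m := 1) (by norm_num)).differentiableAt (by norm_num)).hasDerivAt
    have hdm : HasDerivAt m (deriv h x₀ * deriv (deriv h) x₀ / m x₀) x₀ := by
      have h4 : HasDerivAt (fun x => 1 + deriv h x ^ 2)
          (2 * deriv h x₀ * deriv (deriv h) x₀) x₀ := by
        simpa using (hd2.pow 2).const_add 1
      refine (h4.sqrt (by positivity)).congr_deriv ?_
      exact (mul_div_mul_left (deriv h x₀ * deriv (deriv h) x₀) (m x₀) two_ne_zero ▸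
        by rw [mul_assoc])
    have hdX : HasDerivAt X (m x₀)⁻¹ 0 := by rw [hX0] at h2; exact h2
    have e := (hmpos x₀).ne'
    have d1 := (hdm.inv e).congr_deriv (g' := -(deriv h x₀ * deriv (deriv h) x₀) / m x₀ ^ 3)
      (by field_simp)
    have d2 := (hd2.div hdm e).congr_deriv (g' := deriv (deriv h) x₀ / m x₀ ^ 3) (by
      field_simp
      rw [hmsq]; ring)
    rw [← hX0] at d1 d2
    have d3 := (d1.comp (0 : ℝ) hdX).smul_const τ
    have d4 := (d2.comp (0 : ℝ) hdX).smul_const ν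
    have d5 := d3.add d4
    rw [hX0] at d5
    have d6 : HasDerivAt (fun s => (m (X s))⁻¹ • τ + (deriv h (X s) / m (X s)) • ν) _ 0 := d5
    rw [d6.deriv]
    rw [← sq_eq_sq₀ (norm_nonneg _) (by positivity), hf.norm_sq, div_pow, sq_abs]
    have e2 : deriv h x₀ ^ 2 = m x₀ ^ 2 - 1 := by rw [hmsq]; ring
    change _ = deriv (deriv h) x₀ ^ 2 / (m x₀ ^ 3) ^ 2
    field_simp
    rw [e2]; ring

end Curvature

/-! ### Tangency and lines of sight -/

section Visibility

variable {n : ℕ} {S : Set (EuclideanSpace ℝ (Fin n))} {u v p w θ : EuclideanSpace ℝ (Fin n)}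
  {φ : EuclideanSpace ℝ (Fin n) → ℝ}

theorem IsDefiningAt.hasDerivAt_line (hφ : IsDefiningAt S φ p) (w : EuclideanSpace ℝ (Fin n)) :
    HasDerivAt (fun s : ℝ => φ (p + s • w)) (fderiv ℝ φ p w) 0 := by
  have h1 : HasFDerivAt φ (fderiv ℝ φ p) p :=
    (hφ.contDiffAt.differentiableAt (by norm_num)).hasFDerivAt
  exact h1.hasLineDerivAt w

/-- A line that stays in the set near a boundary point is tangent to the boundary. -/
theorem IsDefiningAt.fderiv_eq_zero_of_line (hφ : IsDefiningAt S φ p) (h0 : φ p = 0)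
    (hw : ∀ᶠ s : ℝ in 𝓝 0, p + s • w ∈ S) : fderiv ℝ φ p w = 0 := by
  have hc : ContinuousAt (fun s : ℝ => p + s • w) 0 := by fun_prop
  have hm : ∀ᶠ s : ℝ in 𝓝 0, (p + s • w ∈ S ↔ φ (p + s • w) ≤ 0) :=
    hc.eventually (p := fun x => (x ∈ S ↔ φ x ≤ 0)) (by simpa using hφ.mem_iff)
  refine IsLocalMax.hasDerivAt_eq_zero ?_ (hφ.hasDerivAt_line w)
  filter_upwards [hw, hm] with s h1 h2
  simpa [h0] using h2.1 h1

/-- A half-line that stays in the set near a boundary point does not point outwards. -/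
theorem IsDefiningAt.fderiv_nonpos_of_ray (hφ : IsDefiningAt S φ p) (h0 : φ p = 0)
    (hw : ∀ᶠ s : ℝ in 𝓝[>] 0, p + s • w ∈ S) : fderiv ℝ φ p w ≤ 0 := by
  have hc : ContinuousAt (fun s : ℝ => p + s • w) 0 := by fun_prop
  have hm : ∀ᶠ s : ℝ in 𝓝 0, (p + s • w ∈ S ↔ φ (p + s • w) ≤ 0) :=
    hc.eventually (p := fun x => (x ∈ S ↔ φ x ≤ 0)) (by simpa using hφ.mem_iff)
  have h1 := (hasDerivAt_iff_tendsto_slope_zero.1 (hφ.hasDerivAt_line w)).mono_left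
    (nhdsGT_le_nhdsNE 0)
  refine le_of_tendsto h1 ?_
  filter_upwards [hw, hm.filter_mono nhdsWithin_le_nhds, self_mem_nhdsWithin] with s h2 h3 h4
  have h5 := h3.1 h2
  have h4' : 0 < s := h4
  simp only [zero_add, zero_smul, add_zero, h0, sub_zero, smul_eq_mul]
  exact mul_nonpos_of_nonneg_of_nonpos (by positivity) h5

/-- If `w` points strictly inwards at a boundary point, then short segments starting in the set in
directions close to `w` stay in the set. -/
theorem IsDefiningAt.eventually_mem_of_fderiv_neg (hφ : IsDefiningAt S φ p)
    (hw : fderiv ℝ φ p w < 0) :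
    ∀ᶠ z : EuclideanSpace ℝ (Fin n) × EuclideanSpace ℝ (Fin n) × ℝ in 𝓝 (p, w, (0 : ℝ)),
      z.1 ∈ S → 0 ≤ z.2.2 → z.1 + z.2.2 • z.2.1 ∈ S := by
  have hc : ContinuousAt (fun z : EuclideanSpace ℝ (Fin n) × EuclideanSpace ℝ (Fin n) =>
      fderiv ℝ φ z.1 z.2) (p, w) := by
    have h1 := (hφ.contDiffAt.fderiv_right (m := 1) (by norm_num)).continuousAt
    exact (ContinuousAt.comp (g := fderiv ℝ φ) (f := Prod.fst) h1 continuousAt_fst).clm_apply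
      continuousAt_snd
  have h2 := (hc.eventually_lt_const hw)
  rw [nhds_prod_eq, eventually_prod_iff] at h2
  obtain ⟨P, hP, Q, hQ, hPQ⟩ := h2
  obtain ⟨r, hr, hball⟩ := Metric.eventually_nhds_iff_ball.1 (hP.and hφ.eventually)
  have e1 : ∀ᶠ z : EuclideanSpace ℝ (Fin n) × EuclideanSpace ℝ (Fin n) × ℝ in
      𝓝 (p, w, (0 : ℝ)), z.1 ∈ Metric.ball p r :=
    continuousAt_fst.eventually_mem (Metric.ball_mem_nhds _ hr)
  have e2 : ∀ᶠ z : EuclideanSpace ℝ (Fin n) × EuclideanSpace ℝ (Fin n) × ℝ in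
      𝓝 (p, w, (0 : ℝ)), z.1 + z.2.2 • z.2.1 ∈ Metric.ball p r := by
    have : ContinuousAt (fun z : EuclideanSpace ℝ (Fin n) × EuclideanSpace ℝ (Fin n) × ℝ =>
      z.1 + z.2.2 • z.2.1) (p, w, (0 : ℝ)) := by fun_prop
    refine this.eventually_mem ?_
    simpa using Metric.ball_mem_nhds _ hr
  have e3 : ∀ᶠ z : EuclideanSpace ℝ (Fin n) × EuclideanSpace ℝ (Fin n) × ℝ in
      𝓝 (p, w, (0 : ℝ)), Q z.2.1 := by
    have : ContinuousAt (fun z : EuclideanSpace ℝ (Fin n) × EuclideanSpace ℝ (Fin n) × ℝ =>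
      z.2.1) (p, w, (0 : ℝ)) := by fun_prop
    exact this.eventually hQ
  filter_upwards [e1, e2, e3] with z h1 h2 h3 hz hs
  obtain ⟨x, w', s⟩ := z
  simp only at h1 h2 h3 hz hs ⊢
  have hmem : ∀ y ∈ Icc 0 s, x + y • w' ∈ Metric.ball p r := by
    intro y hy
    have := (convex_ball p r).add_smul_sub_mem h1 h2 (t := y / s)
      ⟨div_nonneg hy.1 hs, div_le_one_of_le₀ hy.2 hs⟩
    rcases hs.eq_or_lt with h | h
    · have : y = 0 := le_antisymm (by rw [h]; exact hy.2) hy.1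
      simpa [this] using h1
    · convert this using 2
      rw [add_sub_cancel_left, smul_smul, div_mul_cancel₀ _ h.ne']
  have hd : ∀ y ∈ Icc 0 s, HasDerivAt (fun y : ℝ => φ (x + y • w'))
      (fderiv ℝ φ (x + y • w') w') y := by
    intro y hy
    have h4 := ((hball _ (hmem y hy)).2.contDiffAt.differentiableAt (by norm_num)).hasFDerivAt
    have h5 : HasDerivAt (fun y : ℝ => x + y • w') w' y := by
      simpa using ((hasDerivAt_id y).smul_const w').const_add x
    exact h4.comp_hasDerivAt y h5
  have hanti : AntitoneOn (fun y : ℝ => φ (x + y • w')) (Icc 0 s) := by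
    refine antitoneOn_of_deriv_nonpos (convex_Icc _ _)
      (fun y hy => (hd y hy).continuousAt.continuousWithinAt)
      (fun y hy => (hd y (interior_subset hy)).differentiableAt.differentiableWithinAt)
      fun y hy => ?_
    rw [(hd y (interior_subset hy)).deriv]
    exact (hPQ (hball _ (hmem y (interior_subset hy))).1 h3).le
  have h6 := hanti (left_mem_Icc.2 hs) (right_mem_Icc.2 hs) hs
  simp only [zero_smul, add_zero] at h6
  exact (hball _ h2).2.mem_iff.self_of_nhds.2
    (h6.trans ((hball _ h1).2.mem_iff.self_of_nhds.1 hz))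

theorem mem_segment_of_mem_Icc {x y : EuclideanSpace ℝ (Fin n)} {c : ℝ} (hc : c ∈ Icc (0 : ℝ) 1) :
    x + c • (y - x) ∈ segment ℝ x y := by
  rw [segment_eq_image']; exact ⟨c, hc, rfl⟩

/-- Sweep the segment `[v, x]` as `x` moves along a chord from `u`. If it leaves the set, then at
the last moment `t₀` before that it touches the boundary, and it does so at an inner point. -/
theorem exists_first_contact (hS : IsClosed S) (hbd : HasC2Boundary S)
    (hv : v ∈ interior S) (huv : segment ℝ v u ⊆ interior S) {t : ℝ} (ht : 0 ≤ t)
    (hut : segment ℝ u (u + t • θ) ⊆ S) (hvt : ¬ segment ℝ v (u + t • θ) ⊆ S)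
    (hind : ∀ r ∈ Ioo 0 t, ∀ φ, IsDefiningAt S φ (u + r • θ) → u + r • θ ∈ frontier S →
      fderiv ℝ φ (u + r • θ) θ = 0 → fderiv ℝ φ (u + r • θ) (v - (u + r • θ)) ≠ 0) :
    ∃ t₀ : ℝ, 0 < t₀ ∧ (∀ r ∈ Icc 0 t₀, segment ℝ v (u + r • θ) ⊆ S) ∧
      ∃ p ∈ frontier S, p ∈ openSegment ℝ v (u + t₀ • θ) := by
  have hchord : ∀ r ∈ Icc 0 t, u + r • θ ∈ S := by
    intro r hr
    refine hut ?_
    rcases hr.1.eq_or_lt with h | h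
    · rw [← h, zero_smul, add_zero]; exact left_mem_segment _ _ _
    · have := mem_segment_of_mem_Icc (x := u) (y := u + t • θ) (c := r / t)
        ⟨div_nonneg hr.1 ht, div_le_one_of_le₀ hr.2 ht⟩
      rwa [add_sub_cancel_left, smul_smul, div_mul_cancel₀ _ (h.trans_le hr.2).ne'] at this
  by_contra hno
  push Not at hno
  set V : ℝ → Prop := fun r => ∀ c ∈ Icc (0 : ℝ) 1, v + c • (u + r • θ - v) ∈ S with hV
  have hVseg : ∀ r, V r ↔ segment ℝ v (u + r • θ) ⊆ S := by
    intro r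
    simp only [hV, segment_eq_image', subset_def, forall_mem_image]
  have hVclosed : IsClosed {r | V r} := by
    have : {r | V r} = ⋂ c ∈ Icc (0 : ℝ) 1, {r : ℝ | v + c • (u + r • θ - v) ∈ S} := by
      ext r; simp [hV]
    rw [this]
    exact isClosed_biInter fun c _ => hS.preimage (by fun_prop)
  set s : Set ℝ := {r | ∀ r', 0 ≤ r' → V (min r' r)} with hs
  have hsclosed : IsClosed s := by
    have : s = ⋂ r' ∈ Ici (0 : ℝ), {r : ℝ | V (min r' r)} := by
      ext r; simp [hs]
    rw [this]
    exact isClosed_biInter fun c _ =>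
      hVclosed.preimage (f := fun r => min c r) (continuous_const.min continuous_id)
  have hV0 : V 0 := by
    rw [hVseg, zero_smul, add_zero]; exact huv.trans interior_subset
  have hsub : Icc 0 t ⊆ s := by
    refine (hsclosed.inter isClosed_Icc).Icc_subset_of_forall_mem_nhdsWithin ?_ ?_
    · intro r hr; rw [min_eq_right hr]; exact hV0
    · rintro t₀ ⟨ht₀s, ht₀⟩
      have hVt₀ : ∀ r ∈ Icc 0 t₀, V r := by
        intro r hr
        have := ht₀s r hr.1
        rwa [min_eq_left hr.2] at this
      have key : ∀ᶠ r in 𝓝 t₀, ∀ c ∈ Icc (0 : ℝ) 1,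
          (r ∈ Icc t₀ t → c ∈ Icc (0 : ℝ) 1 → v + c • (u + r • θ - v) ∈ S) := by
        refine isCompact_Icc.eventually_forall_of_forall_eventually fun c hc => ?_
        have hcont : ContinuousAt (fun z : ℝ × ℝ => v + z.2 • (u + z.1 • θ - v)) (t₀, c) := by
          fun_prop
        by_cases hint : v + c • (u + t₀ • θ - v) ∈ interior S
        · filter_upwards [hcont.eventually_mem (isOpen_interior.mem_nhds hint)] with z hz _ _
          exact interior_subset hz
        have hfr : v + c • (u + t₀ • θ - v) ∈ frontier S := by
          rw [hS.frontier_eq]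
          exact ⟨hVt₀ t₀ ⟨ht₀.1, le_rfl⟩ c hc, hint⟩
        have ht₀pos : 0 < t₀ := by
          refine lt_of_le_of_ne ht₀.1 fun h => hint ?_
          rw [← h, zero_smul, add_zero]
          exact huv (mem_segment_of_mem_Icc hc)
        rcases hc.1.eq_or_lt with h | hc0
        · rw [← h] at hint; simp [hv] at hint
        rcases hc.2.eq_or_lt with hc1 | hc1
        swap
        · refine absurd ?_ (hno t₀ ht₀pos (fun r hr => (hVseg r).1 (hVt₀ r hr)) _ hfr)
          rw [openSegment_eq_image']
          exact ⟨c, ⟨hc0, hc1⟩, rfl⟩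
        -- the endpoint `u + t₀ θ` on the boundary: there the chord is tangent and `v` lies
        -- strictly inside
        subst hc1
        rw [one_smul, add_sub_cancel] at hfr
        obtain ⟨φ, hφ⟩ := hbd.exists_isDefiningAt hfr
        have hφ0 := (hφ.mem_frontier_iff hS).1 hfr
        have hθ : fderiv ℝ φ (u + t₀ • θ) θ = 0 := by
          refine hφ.fderiv_eq_zero_of_line hφ0 ?_
          have hc : ContinuousAt (fun s : ℝ => t₀ + s) 0 := by fun_prop
          have := hc.eventually_mem (s := Icc 0 t)
            (by simpa using Icc_mem_nhds ht₀pos ht₀.2)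
          filter_upwards [this] with s hs
          have := hchord _ hs
          rwa [add_smul, ← add_assoc] at this
        have hle : fderiv ℝ φ (u + t₀ • θ) (v - (u + t₀ • θ)) ≤ 0 := by
          refine hφ.fderiv_nonpos_of_ray hφ0 ?_
          have : Ioo (0 : ℝ) 1 ∈ 𝓝[>] (0 : ℝ) := Ioo_mem_nhdsGT one_pos
          filter_upwards [this] with s hs
          have := hVt₀ t₀ ⟨ht₀.1, le_rfl⟩ (1 - s) ⟨by linarith [hs.2], by linarith [hs.1]⟩
          convert this using 1
          module
        have hlt := lt_of_le_of_ne hle (hind t₀ ⟨ht₀pos, ht₀.2⟩ φ hφ hfr hθ)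
        have h1 := hφ.eventually_mem_of_fderiv_neg hlt
        have h2 : ContinuousAt (fun z : ℝ × ℝ =>
            (u + z.1 • θ, v - (u + z.1 • θ), 1 - z.2)) (t₀, 1) := by fun_prop
        have h3 := h2.eventually (p := fun z => z.1 ∈ S → 0 ≤ z.2.2 → z.1 + z.2.2 • z.2.1 ∈ S)
          (by simpa using h1)
        filter_upwards [h3] with z hz hz1 hz2
        have := hz (hchord _ ⟨ht₀.1.trans hz1.1, hz1.2⟩) (by simpa using hz2.2)
        convert this using 1
        module
      obtain ⟨η, hη, hball⟩ := Metric.eventually_nhds_iff_ball.1 key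
      have : Ioo t₀ (min (t₀ + η) t) ∈ 𝓝[>] t₀ :=
        Ioo_mem_nhdsGT (lt_min (by linarith) ht₀.2)
      filter_upwards [this] with r hr r' hr'
      rcases le_total (min r' r) t₀ with h | h
      · exact hVt₀ _ ⟨le_min hr' (ht₀.1.trans hr.1.le), h⟩
      · intro c hc
        have h1 := lt_min_iff.1 hr.2
        have h2 : min r' r ≤ r := min_le_right _ _
        refine hball (min r' r) ?_ c hc ⟨h, h2.trans h1.2.le⟩ hc
        rw [Metric.mem_ball, Real.dist_eq, abs_of_nonneg (by linarith)]
        linarith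
  have := hsub (right_mem_Icc.2 ht) t ht
  rw [min_self, hVseg] at this
  exact hvt this

end Visibility

/-! ### Perimeter and curvature of plane sections -/

section PlaneSections

variable {n : ℕ} {S : Set (EuclideanSpace ℝ (Fin n))} {u v p τ ν w T : EuclideanSpace ℝ (Fin n)}
  {φ : EuclideanSpace ℝ (Fin n) → ℝ} {h : ℝ → ℝ}

theorem lipschitzWith_inner_left (hτ : ‖τ‖ = 1) (p : EuclideanSpace ℝ (Fin n)) :
    LipschitzWith 1 (fun q : EuclideanSpace ℝ (Fin n) => (inner ℝ τ (q - p) : ℝ)) := by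
  refine LipschitzWith.of_dist_le_mul fun x y => ?_
  rw [Real.dist_eq, ← inner_sub_right, sub_sub_sub_cancel_right, dist_eq_norm, NNReal.coe_one,
    ← hτ]
  exact abs_real_inner_le_norm _ _

/-- A set whose orthogonal projection to a line covers an interval is at least as long as the
interval. -/
theorem ofReal_le_perimeter (hτ : ‖τ‖ = 1) {C : Set (EuclideanSpace ℝ (Fin n))} {a b : ℝ}
    (hC : Ioo a b ⊆ (fun q => (inner ℝ τ (q - p) : ℝ)) '' C) :
    ENNReal.ofReal (b - a) ≤ perimeter C := by
  have h1 := (lipschitzWith_inner_left hτ p).hausdorffMeasure_image_le zero_le_one C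
  simp only [ENNReal.coe_one, ENNReal.one_rpow, one_mul, hausdorffMeasure_real] at h1
  rw [← Real.volume_Ioo]
  exact (measure_mono hC).trans h1

theorem exists_mem_frontier_of_ray (hS : IsCompact S) {x : EuclideanSpace ℝ (Fin n)}
    (hx : x ∈ S) (hw : w ≠ 0) : ∃ t : ℝ, x + t • w ∈ frontier S := by
  obtain ⟨D, hD⟩ := hS.isBounded.exists_norm_le
  set L : Set (EuclideanSpace ℝ (Fin n)) := range fun t : ℝ => x + t • w with hL
  have hpre : IsPreconnected L := isPreconnected_range (by fun_prop)
  have h2 : (L ∩ Sᶜ).Nonempty := by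
    have hw' : 0 < ‖w‖ := norm_pos_iff.2 hw
    refine ⟨_, ⟨(‖x‖ + |D| + 1) / ‖w‖, rfl⟩, fun hmem => ?_⟩
    have h3 := hD _ hmem
    have h4 : ‖((‖x‖ + |D| + 1) / ‖w‖) • w‖ = ‖x‖ + |D| + 1 := by
      rw [norm_smul, Real.norm_of_nonneg (by positivity), div_mul_cancel₀ _ hw'.ne']
    have h5 := norm_sub_le (x + ((‖x‖ + |D| + 1) / ‖w‖) • w) x
    rw [add_sub_cancel_left, h4] at h5
    linarith [le_abs_self D]
  by_contra hno
  push Not at hno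
  have hcov : L ⊆ interior S ∪ Sᶜ := by
    rintro _ ⟨t, rfl⟩
    by_contra hmem
    rw [mem_union, not_or, mem_compl_iff, not_not] at hmem
    exact hno t (by rw [hS.isClosed.frontier_eq]; exact ⟨hmem.2, hmem.1⟩)
  have h1 : (L ∩ interior S).Nonempty := by
    refine ⟨x, ⟨0, by simp⟩, ?_⟩
    by_contra hmem
    exact hno 0 (by rw [hS.isClosed.frontier_eq, zero_smul, add_zero]; exact ⟨hx, hmem⟩)
  obtain ⟨y, -, hy1, hy2⟩ :=
    hpre (interior S) Sᶜ isOpen_interior hS.isClosed.isOpen_compl hcov h1 h2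
  exact hy2 (interior_subset hy1)

/-- The plane through `p` spanned by `τ` and `ν`. -/
noncomputable def framePlane (p τ ν : EuclideanSpace ℝ (Fin n)) :
    AffineSubspace ℝ (EuclideanSpace ℝ (Fin n)) :=
  AffineSubspace.mk' p (Submodule.span ℝ {τ, ν})

theorem coe_framePlane : (framePlane p τ ν : Set (EuclideanSpace ℝ (Fin n))) =
    range (chart p τ ν) := by
  ext q
  simp only [framePlane, SetLike.mem_coe, AffineSubspace.mem_mk', vsub_eq_sub,
    Submodule.mem_span_pair, mem_range, Prod.exists, chart]
  refine exists_congr fun a => exists_congr fun b => ?_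
  rw [eq_sub_iff_add_eq', add_assoc]

theorem IsFrame.finrank_span (hf : IsFrame τ ν) :
    Module.finrank ℝ (Submodule.span ℝ ({τ, ν} : Set (EuclideanSpace ℝ (Fin n)))) = 2 := by
  have hli : LinearIndependent ℝ ![τ, ν] := by
    rw [LinearIndependent.pair_iff]
    intro a b hab
    have h1 := hf.inner_left a b
    have h2 := hf.inner_right a b
    rw [hab, inner_zero_right] at h1 h2
    exact ⟨h1.symm, h2.symm⟩
  have := finrank_span_eq_card hli
  have hr : range ![τ, ν] = {τ, ν} := by
    rw [Matrix.range_cons, Matrix.range_cons, Matrix.range_empty, union_empty]; rfl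
  rwa [hr, Fintype.card_fin] at this

/-- In a plane through the centre of a ball contained in `S` the section of the boundary is long,
hence its curvature is bounded. -/
theorem curvature_le_of_ball (hS : IsCompact S) (hκ : sectionCurvature S < ⊤) (hf : IsFrame τ ν)
    {r : ℝ} (hr : 0 < r) (hball : Metric.ball v r ⊆ S) (hv : v ∈ range (chart p τ ν))
    {P : EuclideanSpace ℝ (Fin n)} {k : ℝ}
    (hk : HasCurvatureAt (frontier S ∩ range (chart p τ ν)) P k) :
    k ≤ (sectionCurvature S).toReal / r := by
  have hk0 : 0 ≤ k := by
    obtain ⟨γ, δ, -, -, -, -, -, -, rfl⟩ := hk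
    exact norm_nonneg _
  obtain ⟨z₀, hz₀⟩ := hv
  have hper : ENNReal.ofReal r ≤ perimeter (frontier S ∩ range (chart p τ ν)) := by
    have := ofReal_le_perimeter (p := v) hf.norm_left (a := 0) (b := r)
      (C := frontier S ∩ range (chart p τ ν)) ?_
    · simpa using this
    intro s hs
    have hmem : v + s • τ ∈ S := by
      apply hball
      rw [mem_ball_iff_norm, add_sub_cancel_left, norm_smul, hf.norm_left, mul_one,
        Real.norm_of_nonneg hs.1.le]
      exact hs.2
    have hν : ν ≠ 0 := by
      rw [← norm_pos_iff, hf.norm_right]; exact one_pos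
    obtain ⟨t, ht⟩ := exists_mem_frontier_of_ray hS hmem hν
    refine ⟨_, ⟨ht, (z₀.1 + s, z₀.2 + t), ?_⟩, ?_⟩
    · rw [← hz₀]; simp only [chart]; module
    · have : v + s • τ + t • ν - v = s • τ + t • ν := by abel
      simp only [this, hf.inner_left]
  have h1 : ENNReal.ofReal k ≤ maxCurvature (frontier S ∩ range (chart p τ ν)) :=
    le_iSup_of_le P (le_iSup_of_le k (le_iSup_of_le hk le_rfl))
  have h2 : maxCurvature (frontier S ∩ range (chart p τ ν)) *
      perimeter (frontier S ∩ range (chart p τ ν)) ≤ sectionCurvature S := by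
    unfold sectionCurvature
    refine le_iSup_of_le (framePlane p τ ν) (le_iSup_of_le ?_ ?_)
    · rw [framePlane, AffineSubspace.direction_mk', hf.finrank_span]
    · rw [coe_framePlane]
  have h3 := (mul_le_mul' h1 hper).trans h2
  rw [← ENNReal.ofReal_mul hk0, ← ENNReal.ofReal_toReal hκ.ne,
    ENNReal.ofReal_le_ofReal_iff ENNReal.toReal_nonneg] at h3
  exact (le_div_iff₀ hr).2 h3

/-- Differentiating `φ (p + x τ + h(x) ν) = 0` twice. -/
theorem second_deriv_graph_eq {z₀ : ℝ × ℝ} (hφ : IsDefiningAt S φ (chart p τ ν z₀))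
    (hh0 : h z₀.1 = z₀.2) (hh : ContDiffAt ℝ 2 h z₀.1)
    (hz : ∀ᶠ z in 𝓝 z₀, (φ (chart p τ ν z) = 0 ↔ z.2 = h z.1)) :
    fderiv ℝ (fderiv ℝ φ) (chart p τ ν z₀) (τ + deriv h z₀.1 • ν) (τ + deriv h z₀.1 • ν) +
      fderiv ℝ φ (chart p τ ν z₀) (deriv (deriv h) z₀.1 • ν) = 0 := by
  have e : (z₀.1, h z₀.1) = z₀ := by rw [hh0]
  have hcont : ContinuousAt (fun x : ℝ => (x, h x)) z₀.1 :=
    continuousAt_id.prodMk hh.continuousAt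
  have hcont' : Tendsto (fun x : ℝ => (x, h x)) (𝓝 z₀.1) (𝓝 z₀) := by
    have := hcont.tendsto
    rwa [e] at this
  have hzero : (fun x => fderiv ℝ φ (chart p τ ν (x, h x)) (τ + deriv h x • ν))
      =ᶠ[𝓝 z₀.1] fun _ => 0 := by
    have h1 := hcont'.eventually (continuous_chart.continuousAt.eventually hφ.eventually)
    filter_upwards [h1, hcont'.eventually hz.eventually_nhds, hh.eventually (by simp)]
      with x a b c
    exact deriv_graph_eq (z₀ := (x, h x)) (a.contDiffAt.differentiableAt (by norm_num)) rfl
      (c.differentiableAt (by norm_num)) b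
  have hd1 : HasDerivAt (fun x => (x, h x)) ((1 : ℝ), deriv h z₀.1) z₀.1 :=
    (hasDerivAt_id _).prodMk (hh.differentiableAt (by norm_num)).hasDerivAt
  have hd2 := HasFDerivAt.comp_hasDerivAt (f := fun x => (x, h x)) _
      (hasFDerivAt_chart (p := p) (τ := τ) (ν := ν) (z₀.1, h z₀.1)) hd1
  have hF : HasFDerivAt (fderiv ℝ φ) (fderiv ℝ (fderiv ℝ φ) (chart p τ ν z₀))
      (chart p τ ν (z₀.1, h z₀.1)) := by
    rw [e]
    exact ((hφ.contDiffAt.fderiv_right (m := 1) (by norm_num)).differentiableAt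
      (by norm_num)).hasFDerivAt
  have hd3 := HasFDerivAt.comp_hasDerivAt (f := fun x => chart p τ ν (x, h x)) _ hF hd2
  have hd4 : HasDerivAt (deriv h) (deriv (deriv h) z₀.1) z₀.1 :=
    ((hh.derivWithin (m := 1) (by norm_num)).differentiableAt (by norm_num)).hasDerivAt
  have hd5 : HasDerivAt (fun x => τ + deriv h x • ν) (deriv (deriv h) z₀.1 • ν) z₀.1 :=
    (hd4.smul_const ν).const_add τ
  have hd6 := hd3.clm_apply hd5
  have := hd6.unique ((hasDerivAt_const _ _).congr_of_eventuallyEq hzero)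
  rw [← this]
  simp [e]

/-- The value of a linear form against a unit vector in the direction of its gradient. -/
theorem exists_unit_gradient {ℓ : EuclideanSpace ℝ (Fin n) →L[ℝ] ℝ} (hℓ : ℓ ≠ 0) :
    ∃ ν : EuclideanSpace ℝ (Fin n), ‖ν‖ = 1 ∧ ∀ x, ℓ x = ‖ℓ‖ * inner ℝ ν x := by
  set g := (InnerProductSpace.toDual ℝ (EuclideanSpace ℝ (Fin n))).symm ℓ with hg
  have hgn : ‖g‖ = ‖ℓ‖ := by rw [hg, LinearIsometryEquiv.norm_map]
  have hpos : 0 < ‖ℓ‖ := norm_pos_iff.2 hℓ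
  refine ⟨‖ℓ‖⁻¹ • g, ?_, fun x => ?_⟩
  · rw [norm_smul, hgn, norm_inv, norm_norm, inv_mul_cancel₀ hpos.ne']
  · rw [inner_smul_left, hg, InnerProductSpace.toDual_symm_apply]
    simp
    field_simp

theorem exists_unit_orthogonal_pair (hn : 3 ≤ n) (τ ν : EuclideanSpace ℝ (Fin n)) :
    ∃ w : EuclideanSpace ℝ (Fin n), ‖w‖ = 1 ∧ inner ℝ τ w = 0 ∧ inner ℝ ν w = 0 := by
  set K := Submodule.span ℝ ({τ, ν} : Set (EuclideanSpace ℝ (Fin n))) with hK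
  have h1 : Module.finrank ℝ K ≤ 2 := by
    classical
    have := finrank_span_finset_le_card (R := ℝ) ({τ, ν} : Finset (EuclideanSpace ℝ (Fin n)))
    simp only [Finset.coe_insert, Finset.coe_singleton] at this
    exact this.trans (Finset.card_le_two)
  have h2 := K.finrank_add_finrank_orthogonal
  rw [finrank_euclideanSpace_fin] at h2
  have h3 : 0 < Module.finrank ℝ Kᗮ := by omega
  obtain ⟨x, hx⟩ := Module.finrank_pos_iff_exists_ne_zero.1 h3
  have hx' : (x : EuclideanSpace ℝ (Fin n)) ≠ 0 := by simpa using hx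
  have hpos := norm_pos_iff.2 hx'
  have hort := (Submodule.mem_orthogonal K _).1 x.2
  refine ⟨‖(x : EuclideanSpace ℝ (Fin n))‖⁻¹ • (x : EuclideanSpace ℝ (Fin n)), ?_, ?_, ?_⟩
  · rw [norm_smul, norm_inv, norm_norm, inv_mul_cancel₀ hpos.ne']
  · rw [inner_smul_right, hort τ (Submodule.subset_span (by simp)), mul_zero]
  · rw [inner_smul_right, hort ν (Submodule.subset_span (by simp)), mul_zero]

end PlaneSections

/-! ### In dimension different from two no tangent meets the interior -/

section NoTangent

variable {n : ℕ} {S : Set (EuclideanSpace ℝ (Fin n))} {u v p τ ν w T : EuclideanSpace ℝ (Fin n)}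
  {φ : EuclideanSpace ℝ (Fin n) → ℝ} {h : ℝ → ℝ}

/-- In dimension at least three, if the curvatures of all plane sections through a tangent line are
bounded, then the second fundamental form vanishes in the direction of that line: by Meusnier's
theorem the curvature of the section by a plane containing the line tends to infinity as the plane
approaches the tangent hyperplane, unless the normal curvature is zero. -/
theorem second_deriv_eq_zero_of_tangent (hn : 3 ≤ n) (hS : IsCompact S)
    (hκ : sectionCurvature S < ⊤) (hφ : IsDefiningAt S φ p) (h0 : φ p = 0)
    (hT : fderiv ℝ φ p T = 0) {a r : ℝ} (hr : 0 < r) (hball : Metric.ball (p + a • T) r ⊆ S) :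
    fderiv ℝ (fderiv ℝ φ) p T T = 0 := by
  rcases eq_or_ne T 0 with rfl | hT0
  · simp
  have hTpos : 0 < ‖T‖ := norm_pos_iff.2 hT0
  obtain ⟨ν, hν, hgrad⟩ := exists_unit_gradient hφ.fderiv_ne
  set c := ‖fderiv ℝ φ p‖ with hc
  have hcpos : 0 < c := norm_pos_iff.2 hφ.fderiv_ne
  set τ := ‖T‖⁻¹ • T with hτdef
  have hTτ : T = ‖T‖ • τ := by rw [hτdef, smul_smul, mul_inv_cancel₀ hTpos.ne', one_smul]
  have hτ : ‖τ‖ = 1 := by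
    rw [hτdef, norm_smul, norm_inv, norm_norm, inv_mul_cancel₀ hTpos.ne']
  have hτ0 : fderiv ℝ φ p τ = 0 := by rw [hτdef, map_smul, hT, smul_zero]
  have hντ : inner ℝ ν τ = 0 := by
    have := hgrad τ
    rw [hτ0] at this
    exact (mul_eq_zero.1 this.symm).resolve_left hcpos.ne'
  obtain ⟨w₀, hw₀, hτw, hνw⟩ := exists_unit_orthogonal_pair hn τ ν
  set K := (sectionCurvature S).toReal / r with hK
  have hK0 : 0 ≤ K := by positivity
  -- the plane spanned by `τ` and `w₀ + s ν` makes an angle of order `s` with the tangent hyperplane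
  have key : ∀ s : ℝ, 0 < s → |fderiv ℝ (fderiv ℝ φ) p τ τ| ≤ K * c * s := by
    intro s hs
    have hq : 0 < √(1 + s ^ 2) := Real.sqrt_pos.2 (by positivity)
    have hq1 : 1 ≤ √(1 + s ^ 2) := Real.one_le_sqrt.2 (by nlinarith)
    set w := (√(1 + s ^ 2))⁻¹ • (w₀ + s • ν) with hw
    have hfr : IsFrame w₀ ν := ⟨hw₀, hν, by rw [real_inner_comm]; exact hνw⟩
    have hwn : ‖w‖ = 1 := by
      have h1 := hfr.norm_sq 1 s
      rw [one_smul, one_pow] at h1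
      rw [hw, norm_smul, norm_inv, Real.norm_of_nonneg hq.le, ← Real.sqrt_sq (norm_nonneg (w₀ + _)),
        h1, inv_mul_cancel₀ hq.ne']
    have hτν : inner ℝ τ ν = 0 := by rw [real_inner_comm]; exact hντ
    have hf : IsFrame τ w := by
      refine ⟨hτ, hwn, ?_⟩
      rw [hw, inner_smul_right, inner_add_right, inner_smul_right, hτw, hτν]
      simp
    have hdw : fderiv ℝ φ p w = c * (s / √(1 + s ^ 2)) := by
      rw [hgrad, hw, inner_smul_right, inner_add_right, inner_smul_right, hνw,
        real_inner_self_eq_norm_sq, hν]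
      field_simp
      ring
    have hp0 : chart p τ w (0, 0) = p := by simp [chart]
    obtain ⟨h, hh0, hh, hz⟩ := IsDefiningAt.exists_isHypographAt (p := p) (τ := τ) (ν := w)
      (z₀ := (0, 0)) (by rw [hp0]; exact hφ) (by rw [hp0]; exact h0)
      (by rw [hp0, hdw]; positivity)
    simp only at hh0 hh
    have hd1 := deriv_graph_eq (p := p) (τ := τ) (ν := w) (z₀ := (0, 0)) (h := h)
      (by rw [hp0]; exact hφ.contDiffAt.differentiableAt (by norm_num)) hh0
      (hh.1.differentiableAt (by norm_num)) hz
    have hd2 := second_deriv_graph_eq (p := p) (τ := τ) (ν := w) (z₀ := (0, 0)) (h := h)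
      (by rw [hp0]; exact hφ) hh0 hh.1 hz
    simp only [hp0] at hd1 hd2
    rw [map_add, hτ0, zero_add, map_smul, smul_eq_mul, hdw] at hd1
    have hd3 : deriv h 0 = 0 := (mul_eq_zero.1 hd1).resolve_right (by positivity)
    rw [hd3, zero_smul, add_zero, map_smul (fderiv ℝ φ p), smul_eq_mul, hdw] at hd2
    have hcurv := hasCurvatureAt_graph (C := frontier S ∩ range (chart p τ w)) hf hh.1 (by
      rw [hh0, hp0]
      have h1 : ContinuousAt (coords p τ w) p := continuous_coords.continuousAt
      have h2 : coords p τ w p = (0, 0) := by simp [coords]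
      have h3 := h1.eventually (p := fun z => (φ (chart p τ w z) = 0 ↔ z.2 = h z.1))
        (by rw [h2]; exact hz)
      filter_upwards [h3, hφ.eventually_mem_frontier_iff hS.isClosed] with q hq1 hq2
      rw [mem_inter_iff, hq2]
      constructor
      · rintro ⟨h4, z, rfl⟩
        rw [coords_chart hf] at hq1 ⊢
        rw [← hq1.1 h4]
      · intro hq
        refine ⟨?_, ⟨_, hq.symm⟩⟩
        have h5 : chart p τ w (coords p τ w q) = q := by
          rw [hq, coords_chart hf]
        rw [h5] at hq1
        refine hq1.2 ?_
        conv_lhs => rw [hq]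
        rw [coords_chart hf])
    have hle := curvature_le_of_ball hS hκ hf hr hball
      ⟨(a * ‖T‖, 0), by simp only [chart]; rw [zero_smul, add_zero, mul_smul, ← hTτ]⟩ hcurv
    rw [hd3] at hle
    simp only [ne_eq, OfNat.ofNat_ne_zero, not_false_eq_true, zero_pow, add_zero, Real.sqrt_one,
      one_pow, div_one] at hle
    have h6 : fderiv ℝ (fderiv ℝ φ) p τ τ = -(deriv (deriv h) 0 * (c * (s / √(1 + s ^ 2)))) := by
      linarith
    rw [h6, abs_neg, abs_mul, abs_of_pos (by positivity : 0 < c * (s / √(1 + s ^ 2))), mul_assoc]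
    gcongr
    exact div_le_self hs.le hq1
  have hzero : |fderiv ℝ (fderiv ℝ φ) p τ τ| ≤ 0 := by
    have h1 : Tendsto (fun s : ℝ => K * c * s) (𝓝[>] 0) (𝓝 (K * c * 0)) :=
      (continuous_const.mul continuous_id).continuousAt.tendsto.mono_left nhdsWithin_le_nhds
    rw [mul_zero] at h1
    exact ge_of_tendsto h1 (by filter_upwards [self_mem_nhdsWithin] with s hs using key s hs)
  rw [hTτ]
  simp [abs_nonpos_iff.1 hzero]

/-- In dimension at least three, a line through an interior point which is tangent to the boundary
at `p` is contained in the boundary near `p`. -/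
theorem eventually_mem_frontier_of_tangent (hn : 3 ≤ n) (hS : IsCompact S)
    (hκ : sectionCurvature S < ⊤) (hφ : IsDefiningAt S φ p) (hp : p ∈ frontier S)
    (hw : fderiv ℝ φ p w = 0) {a : ℝ} (hint : p + a • w ∈ interior S) :
    ∀ᶠ s : ℝ in 𝓝 0, p + s • w ∈ frontier S := by
  have h0 : φ p = 0 := (hφ.mem_frontier_iff hS.isClosed).1 hp
  obtain ⟨ν, hν, hgrad⟩ := exists_unit_gradient hφ.fderiv_ne
  have hcpos : 0 < ‖fderiv ℝ φ p‖ := norm_pos_iff.2 hφ.fderiv_ne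
  have hdν : 0 < fderiv ℝ φ p ν := by
    rw [hgrad, real_inner_self_eq_norm_sq, hν]; simpa using hcpos
  have hp0 : chart p w ν (0, 0) = p := by simp [chart]
  obtain ⟨h, hh0, hh, hz⟩ := IsDefiningAt.exists_isHypographAt (p := p) (τ := w) (ν := ν)
    (z₀ := (0, 0)) (by rw [hp0]; exact hφ) (by rw [hp0]; exact h0) (by rw [hp0]; exact hdν)
  simp only at hh0 hh
  have hd1 := deriv_graph_eq (p := p) (τ := w) (ν := ν) (z₀ := (0, 0)) (h := h)
    (by rw [hp0]; exact hφ.contDiffAt.differentiableAt (by norm_num)) hh0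
    (hh.1.differentiableAt (by norm_num)) hz
  simp only [hp0] at hd1
  rw [map_add, hw, zero_add, map_smul, smul_eq_mul] at hd1
  have hd3 : deriv h 0 = 0 := (mul_eq_zero.1 hd1).resolve_right hdν.ne'
  obtain ⟨r, hr, hball⟩ := Metric.isOpen_iff.1 isOpen_interior _ hint
  have hgr : Tendsto (fun x : ℝ => (x, h x)) (𝓝 0) (𝓝 ((0 : ℝ), (0 : ℝ))) := by
    have := (continuousAt_id (x := (0 : ℝ))).prodMk hh.1.continuousAt
    have := this.tendsto
    rwa [id, hh0] at this
  have hh' : ContinuousAt (deriv h) 0 := (hh.1.derivWithin (m := 1) (by norm_num)).continuousAt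
  have hcP : Tendsto (fun x : ℝ => chart p w ν (x, h x)) (𝓝 0) (𝓝 p) := by
    have := (continuous_chart (p := p) (τ := w) (ν := ν)).continuousAt.tendsto.comp hgr
    rwa [hp0] at this
  have hcQ : Tendsto (fun x : ℝ => chart p w ν (x, h x) + a • (w + deriv h x • ν)) (𝓝 0)
      (𝓝 (p + a • w)) := by
    have h1 : Tendsto (fun x : ℝ => a • (w + deriv h x • ν)) (𝓝 0) (𝓝 (a • w)) := by
      have : ContinuousAt (fun x : ℝ => a • (w + deriv h x • ν)) 0 := by fun_prop
      have := this.tendsto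
      rwa [hd3, zero_smul, add_zero] at this
    exact hcP.add h1
  have hposν : ∀ᶠ q in 𝓝 p, 0 < fderiv ℝ φ q ν := by
    have hc := (hφ.contDiffAt.fderiv_right (m := 1) (by norm_num)).continuousAt
    exact (hc.clm_apply continuousAt_const).eventually_const_lt hdν
  -- all nearby tangent lines still meet the interior, so the boundary curve is straight
  have hflat : ∀ᶠ x in 𝓝 (0 : ℝ), ContDiffAt ℝ 2 h x ∧ deriv (deriv h) x = 0 := by
    filter_upwards [hcP.eventually hφ.eventually, hcP.eventually hposν,
      hgr.eventually hz.eventually_nhds, hh.1.eventually (by simp),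
      hcQ.eventually (Metric.ball_mem_nhds _ (half_pos hr))] with x h1 h2 h3 h4 h5
    refine ⟨h4, ?_⟩
    have e1 : φ (chart p w ν (x, h x)) = 0 := h3.self_of_nhds.2 rfl
    have e2 := deriv_graph_eq (z₀ := (x, h x)) (h1.contDiffAt.differentiableAt (by norm_num)) rfl
      (h4.differentiableAt (by norm_num)) h3
    have e3 := second_deriv_graph_eq (z₀ := (x, h x)) h1 rfl h4 h3
    have e4 := second_deriv_eq_zero_of_tangent hn hS hκ h1 e1 e2 (half_pos hr) (a := a) (by
      intro y hy
      refine interior_subset (hball ?_)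
      rw [Metric.mem_ball] at hy ⊢
      simp only at hy
      linarith [dist_triangle y (chart p w ν (x, h x) + a • (w + deriv h x • ν)) (p + a • w)])
    simp only at e3 e4
    rw [e4, zero_add, map_smul, smul_eq_mul] at e3
    exact (mul_eq_zero.1 e3).resolve_right h2.ne'
  obtain ⟨δ, hδ, hball'⟩ := Metric.eventually_nhds_iff_ball.1 hflat
  have hpre : IsPreconnected (Metric.ball (0 : ℝ) δ) := (convex_ball _ _).isPreconnected
  have hd0 : ∀ x ∈ Metric.ball (0 : ℝ) δ, deriv h x = 0 := by
    intro x hx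
    rw [← hd3]
    refine Metric.isOpen_ball.is_const_of_deriv_eq_zero hpre (f := deriv h) (fun y hy => ?_)
      (fun y hy => (hball' y hy).2) hx (Metric.mem_ball_self hδ)
    exact (((hball' y hy).1.derivWithin (m := 1) (by norm_num)).differentiableAt
      (by norm_num)).differentiableWithinAt
  have hh00 : ∀ x ∈ Metric.ball (0 : ℝ) δ, h x = 0 := by
    intro x hx
    rw [← hh0]
    refine Metric.isOpen_ball.is_const_of_deriv_eq_zero hpre (f := h) (fun y hy => ?_)
      (fun y hy => hd0 y hy) hx (Metric.mem_ball_self hδ)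
    exact ((hball' y hy).1.differentiableAt (by norm_num)).differentiableWithinAt
  filter_upwards [Metric.ball_mem_nhds (0 : ℝ) hδ, hgr.eventually hz,
    hcP.eventually (hφ.eventually_mem_frontier_iff hS.isClosed)] with x h1 h2 h3
  have e : chart p w ν (x, h x) = p + x • w := by
    rw [hh00 x h1]; simp [chart]
  rw [e] at h2 h3
  exact h3.2 (h2.2 rfl)

/-- Unless the dimension is two, no line through an interior point is tangent to the boundary of a
set of low curvature. In dimension at least three such a line would be contained in the boundary. -/
theorem fderiv_ne_zero_of_mem_line (hn : n ≠ 2) (hS : IsCompact S) (hbd : HasC2Boundary S)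
    (hκ : sectionCurvature S < ⊤) (hw : w ≠ 0) (hv : v ∈ interior S) {a : ℝ}
    (hφ : IsDefiningAt S φ (v + a • w)) (hp : v + a • w ∈ frontier S) :
    fderiv ℝ φ (v + a • w) w ≠ 0 := by
  intro hdw
  rcases Nat.lt_or_ge n 3 with h3 | h3
  · have h1 : Module.finrank ℝ (EuclideanSpace ℝ (Fin n)) ≤ 1 := by
      rw [finrank_euclideanSpace_fin]; omega
    refine hφ.fderiv_ne (ContinuousLinearMap.ext fun x => ?_)
    obtain ⟨y, hy⟩ := finrank_le_one_iff.1 h1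
    obtain ⟨b, hb⟩ := hy w
    obtain ⟨c, hc⟩ := hy x
    have hb0 : b ≠ 0 := fun h => hw (by rw [← hb, h, zero_smul])
    have h5 : fderiv ℝ φ (v + a • w) w = b • fderiv ℝ φ (v + a • w) y := by rw [← map_smul, hb]
    rw [hdw] at h5
    rw [← hc, map_smul, (smul_eq_zero.1 h5.symm).resolve_left hb0, smul_zero]
    rfl
  set A : Set ℝ := {t | ∀ᶠ s in 𝓝 t, v + s • w ∈ frontier S} with hA
  have hline : ∀ t : ℝ, Continuous fun s : ℝ => v + s • w := fun t => by fun_prop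
  have hstep : ∀ (t : ℝ) (ψ : EuclideanSpace ℝ (Fin n) → ℝ), IsDefiningAt S ψ (v + t • w) →
      v + t • w ∈ frontier S → fderiv ℝ ψ (v + t • w) w = 0 → t ∈ A := by
    intro t ψ hψ ht hd
    have h1 := eventually_mem_frontier_of_tangent h3 hS hκ hψ ht hd (a := -t) (by
      rwa [neg_smul, add_neg_cancel_right])
    have h2 : Tendsto (fun s : ℝ => s - t) (𝓝 t) (𝓝 0) := by
      have : ContinuousAt (fun s : ℝ => s - t) t := by fun_prop
      simpa using this.tendsto
    filter_upwards [h2.eventually h1] with s hs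
    convert hs using 1
    module
  have hopen : IsOpen A := isOpen_setOfPred_eventually_nhds
  have hclosed : IsClosed A := by
    refine isClosed_of_closure_subset fun t ht => ?_
    have htf : v + t • w ∈ frontier S := by
      have h1 : IsClosed {s : ℝ | v + s • w ∈ frontier S} :=
        isClosed_frontier.preimage (by fun_prop)
      exact closure_minimal (fun s hs => hs.self_of_nhds) h1 ht
    obtain ⟨ψ, hψ⟩ := hbd.exists_isDefiningAt htf
    refine hstep t ψ hψ htf ?_
    by_contra hne
    have hc : ContinuousAt (fun s : ℝ => fderiv ℝ ψ (v + s • w) w) t := by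
      have h1 := (hψ.contDiffAt.fderiv_right (m := 1) (by norm_num)).continuousAt
      exact (ContinuousAt.comp (f := fun s : ℝ => v + s • w) h1
        (by fun_prop)).clm_apply continuousAt_const
    have hev := (hc.eventually_ne hne).and
      ((hline t).continuousAt.eventually hψ.eventually)
    obtain ⟨s, hs, hsA⟩ := (mem_closure_iff_frequently.1 ht).and_eventually hev |>.exists
    refine hsA.1 ?_
    refine hsA.2.fderiv_eq_zero_of_line ?_ ?_
    · exact (hsA.2.mem_frontier_iff hS.isClosed).1 hs.self_of_nhds
    · have h2 : Tendsto (fun s' : ℝ => s + s') (𝓝 0) (𝓝 s) := by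
        have : ContinuousAt (fun s' : ℝ => s + s') 0 := by fun_prop
        simpa using this.tendsto
      filter_upwards [h2.eventually hs] with s' hs'
      rw [add_assoc, ← add_smul]
      exact hS.isClosed.frontier_subset hs'
  have huniv := IsClopen.eq_univ ⟨hclosed, hopen⟩ ⟨a, hstep a φ hφ hp hdw⟩
  have h0 : (0 : ℝ) ∈ A := huniv ▸ mem_univ _
  have h1 := h0.self_of_nhds
  rw [zero_smul, add_zero] at h1
  exact h1.2 hv

end NoTangent

/-! ### Hit-and-Run, and the case of dimension different from two -/

section HitAndRun

variable {n : ℕ} {S : Set (EuclideanSpace ℝ (Fin n))} {u v p θ x : EuclideanSpace ℝ (Fin n)}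

theorem isClosed_view (hS : IsClosed S) (v : EuclideanSpace ℝ (Fin n)) : IsClosed (view S v) := by
  have : view S v = S ∩ ⋂ c ∈ Icc (0 : ℝ) 1, {x | v + c • (x - v) ∈ S} := by
    ext x
    simp only [view, segment_eq_image', subset_def, forall_mem_image, mem_inter_iff, mem_iInter]
    rfl
  rw [this]
  exact hS.inter (isClosed_biInter fun c _ => hS.preimage (by fun_prop))

theorem isClosed_chordParams (hS : IsClosed S) (u θ : EuclideanSpace ℝ (Fin n)) :
    IsClosed (chordParams S u θ) := by
  have : chordParams S u θ = ⋂ c ∈ Icc (0 : ℝ) 1, {t | u + c • (t • θ) ∈ S} := by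
    ext t
    simp only [chordParams, segment_eq_image', subset_def, forall_mem_image, mem_iInter,
      add_sub_cancel_left]
    rfl
  rw [this]
  exact isClosed_biInter fun c _ => hS.preimage (by fun_prop)

theorem neg_mem_chordParams_neg {t : ℝ} :
    -t ∈ chordParams S u (-θ) ↔ t ∈ chordParams S u θ := by
  change segment ℝ u (u + -t • -θ) ⊆ S ↔ segment ℝ u (u + t • θ) ⊆ S
  rw [neg_smul_neg]

theorem Icc_subset_chordParams {t : ℝ} (ht : t ∈ chordParams S u θ) :
    Icc 0 t ⊆ chordParams S u θ := by
  intro r hr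
  refine Subset.trans ((convex_segment _ _).segment_subset (left_mem_segment _ _ _) ?_) ht
  rcases hr.1.eq_or_lt with h | h
  · rw [← h, zero_smul, add_zero]; exact left_mem_segment _ _ _
  · have := mem_segment_of_mem_Icc (x := u) (y := u + t • θ) (c := r / t)
      ⟨div_nonneg hr.1 (h.le.trans hr.2), div_le_one_of_le₀ hr.2 (h.le.trans hr.2)⟩
    rwa [add_sub_cancel_left, smul_smul, div_mul_cancel₀ _ (h.trans_le hr.2).ne'] at this

theorem add_smul_mem_of_mem_chordParams {t : ℝ} (ht : t ∈ chordParams S u θ) : u + t • θ ∈ S :=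
  ht (right_mem_segment _ _ _)

theorem uniformOnChord_apply (hS : IsClosed S) (u θ : EuclideanSpace ℝ (Fin n))
    {A : Set (EuclideanSpace ℝ (Fin n))} (hA : MeasurableSet A) :
    uniformOnChord S u θ A = (volume (chordParams S u θ))⁻¹ *
      volume (chordParams S u θ ∩ (fun t : ℝ => u + t • θ) ⁻¹' A) := by
  rw [uniformOnChord, Measure.map_apply (Continuous.measurable (by fun_prop)) hA,
    ProbabilityTheory.cond_apply (isClosed_chordParams hS u θ).measurableSet]

theorem hitAndRun_apply (hS : IsClosed S) (u : EuclideanSpace ℝ (Fin n))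
    {A : Set (EuclideanSpace ℝ (Fin n))} (hA : MeasurableSet A) :
    hitAndRun S u A = ∫⁻ θ, uniformOnChord S u θ A ∂(uniformDirection n) :=
  Measure.bind_apply hA (measurable_uniformOnChord hS u).aemeasurable

theorem uniformDirection_univ_le_one : uniformDirection n univ ≤ 1 := by
  rw [uniformDirection, ProbabilityTheory.cond_apply MeasurableSet.univ, univ_inter]
  exact ENNReal.inv_mul_le_one _

theorem uniformOnChord_le_one (hS : IsClosed S) (u θ : EuclideanSpace ℝ (Fin n))
    {A : Set (EuclideanSpace ℝ (Fin n))} (hA : MeasurableSet A) :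
    uniformOnChord S u θ A ≤ 1 := by
  rw [uniformOnChord_apply hS u θ hA]
  refine le_trans ?_ (ENNReal.inv_mul_le_one (volume (chordParams S u θ)))
  gcongr
  exact inter_subset_left

theorem hitAndRun_le_one (hS : IsClosed S) (u : EuclideanSpace ℝ (Fin n))
    {A : Set (EuclideanSpace ℝ (Fin n))} (hA : MeasurableSet A) : hitAndRun S u A ≤ 1 := by
  rw [hitAndRun_apply hS u hA]
  calc ∫⁻ θ, uniformOnChord S u θ A ∂(uniformDirection n)
      ≤ ∫⁻ _, 1 ∂(uniformDirection n) := lintegral_mono fun θ => uniformOnChord_le_one hS u θ hA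
    _ ≤ 1 := by rw [lintegral_one]; exact uniformDirection_univ_le_one

/-- A ball that does not meet the boundary does not leave the interior. -/
theorem ball_subset_interior_of_mem_innerPart {ε : ℝ} (hS : IsClosed S) (hε : 0 < ε)
    (hu : u ∈ innerPart S ε) : Metric.ball u ε ⊆ interior S := by
  have hdisj : ∀ x ∈ Metric.ball u ε, x ∉ frontier S := fun x hx hxf => by
    have h1 := hu.2.trans (Metric.infDist_le_dist_of_mem hxf)
    rw [Metric.mem_ball'] at hx
    linarith
  have hint : u ∈ interior S := by
    by_contra h
    exact hdisj u (Metric.mem_ball_self hε) (by rw [hS.frontier_eq]; exact ⟨hu.1, h⟩)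
  refine (convex_ball u ε).isPreconnected.subset_left_of_subset_union isOpen_interior
    hS.isOpen_compl ?_ ?_ ⟨u, Metric.mem_ball_self hε, hint⟩
  · exact disjoint_compl_right.mono_left interior_subset
  · intro x hx
    by_contra h
    rw [mem_union, not_or, mem_compl_iff, not_not] at h
    exact hdisj x hx (by rw [hS.frontier_eq]; exact ⟨h.2, h.1⟩)

theorem segment_subset_interior_of_mem_innerPart {ε : ℝ} (hS : IsClosed S) (hε : 0 < ε)
    (hu : u ∈ innerPart S ε) (hv : v ∈ innerPart S ε) (huv : ‖u - v‖ ≤ ε) :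
    segment ℝ v u ⊆ interior S := by
  rw [segment_eq_image', image_subset_iff]
  intro c hc
  rcases hc.1.eq_or_lt with h | h
  · rw [mem_preimage, ← h, zero_smul, add_zero]
    exact ball_subset_interior_of_mem_innerPart hS hε hv (Metric.mem_ball_self hε)
  · refine ball_subset_interior_of_mem_innerPart hS hε hu ?_
    have : v + c • (u - v) - u = (1 - c) • (v - u) := by module
    rw [mem_ball_iff_norm, this, norm_smul, Real.norm_of_nonneg (by linarith [hc.2]), norm_sub_rev]
    nlinarith [hc.2, norm_nonneg (u - v)]

/-- A point of `openSegment v x` on the boundary is a point of tangency if `[v, x] ⊆ S`. -/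
theorem eventually_add_smul_mem_of_mem_openSegment (hvx : segment ℝ v x ⊆ S)
    (hp : p ∈ openSegment ℝ v x) : ∀ᶠ s : ℝ in 𝓝 0, p + s • (x - v) ∈ S := by
  rw [openSegment_eq_image'] at hp
  obtain ⟨c, hc, rfl⟩ := hp
  have h1 : ContinuousAt (fun s : ℝ => c + s) 0 := by fun_prop
  filter_upwards [h1.eventually_mem (s := Icc 0 1) (by simpa using Icc_mem_nhds hc.1 hc.2)] with s hs
  have := hvx (mem_segment_of_mem_Icc hs)
  rwa [add_smul, ← add_assoc] at this

/-- Unless the dimension is two, in a set of low curvature everything that is visible from `u` is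
visible from every `v` close to `u`. -/
theorem segment_subset_of_ne_two (hn : n ≠ 2) (hS : IsCompact S) (hbd : HasC2Boundary S)
    (hκ : sectionCurvature S < ⊤) (huv : segment ℝ v u ⊆ interior S)
    (hx : segment ℝ u x ⊆ S) : segment ℝ v x ⊆ S := by
  by_contra hvx
  have hv : v ∈ interior S := huv (left_mem_segment _ _ _)
  have hu : u ∈ interior S := huv (right_mem_segment _ _ _)
  have hxu : x - u ≠ 0 := by
    intro h
    rw [sub_eq_zero.1 h] at hvx
    exact hvx (huv.trans interior_subset)
  have e : u + (1 : ℝ) • (x - u) = x := by module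
  obtain ⟨t₀, ht₀, hvis, p, hp, hpseg⟩ := exists_first_contact (u := u) (θ := x - u) (t := 1)
    hS.isClosed hbd hv huv zero_le_one (by rwa [e]) (by rwa [e])
    (fun r hr φ hφ hf h0 => absurd h0 (fderiv_ne_zero_of_mem_line hn hS hbd hκ hxu hu hφ hf))
  have hseg := hvis t₀ ⟨ht₀.le, le_rfl⟩
  have htan := eventually_add_smul_mem_of_mem_openSegment hseg hpseg
  obtain ⟨φ, hφ⟩ := hbd.exists_isDefiningAt hp
  have hd := hφ.fderiv_eq_zero_of_line ((hφ.mem_frontier_iff hS.isClosed).1 hp) htan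
  rw [openSegment_eq_image'] at hpseg
  obtain ⟨c, hc, rfl⟩ := hpseg
  refine fderiv_ne_zero_of_mem_line hn hS hbd hκ ?_ hv hφ hp hd
  intro h
  simp only [h, smul_zero, add_zero] at hp
  exact hp.2 hv

theorem hitAndRun_eq_zero_of_forall_segment (hS : IsClosed S)
    (h : ∀ x, segment ℝ u x ⊆ S → segment ℝ v x ⊆ S) :
    hitAndRun S u {x | x ∉ view S v} = 0 := by
  have hA : MeasurableSet {x | x ∉ view S v} := (isClosed_view hS v).measurableSet.compl
  rw [hitAndRun_apply hS u hA]
  refine (lintegral_congr fun θ => ?_).trans lintegral_zero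
  rw [uniformOnChord_apply hS u θ hA]
  have : chordParams S u θ ∩ (fun t : ℝ => u + t • (θ : EuclideanSpace ℝ (Fin n))) ⁻¹'
      {x | x ∉ view S v} = ∅ := by
    rw [Set.eq_empty_iff_forall_notMem]
    rintro t ⟨ht, ht'⟩
    exact ht' ⟨add_smul_mem_of_mem_chordParams ht, h _ ht⟩
  rw [this, measure_empty, mul_zero]

end HitAndRun

/-! ### Long graphs in the boundary of a plane set -/

section PlaneCurves

variable {S : Set (EuclideanSpace ℝ (Fin 2))} {p q τ ν : EuclideanSpace ℝ (Fin 2)}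
  {φ : EuclideanSpace ℝ (Fin 2) → ℝ} {h g : ℝ → ℝ} {k : ℝ}

theorem chart_coords (hf : IsFrame τ ν) (q : EuclideanSpace ℝ (Fin 2)) :
    chart p τ ν (coords p τ ν q) = q := by
  have htop : Submodule.span ℝ ({τ, ν} : Set (EuclideanSpace ℝ (Fin 2))) = ⊤ :=
    Submodule.eq_top_of_finrank_eq (by rw [hf.finrank_span, finrank_euclideanSpace_fin])
  obtain ⟨a, b, hab⟩ := Submodule.mem_span_pair.1
    (htop ▸ Submodule.mem_top : q - p ∈ Submodule.span ℝ {τ, ν})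
  unfold coords chart
  rw [← hab, hf.inner_left, hf.inner_right, add_assoc, hab, add_sub_cancel]

theorem exists_frame_right {ν : EuclideanSpace ℝ (Fin 2)} (hν : ‖ν‖ = 1) :
    ∃ τ, IsFrame τ ν := by
  refine ⟨!₂[-ν 1, ν 0], ?_, hν, ?_⟩
  · rw [EuclideanSpace.norm_eq] at hν ⊢
    rw [← hν]
    simp [Fin.sum_univ_two, add_comm]
  · simp [PiLp.inner_apply, Fin.sum_univ_two]
    ring

theorem IsHypographAt.self_mem {x : ℝ} (hx : IsHypographAt S p τ ν h x) :
    chart p τ ν (x, h x) ∈ S :=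
  hx.2.self_of_nhds.2 le_rfl

theorem IsHypographAt.tendsto {x : ℝ} (hx : IsHypographAt S p τ ν h x) :
    Tendsto (fun y => (y, h y)) (𝓝 x) (𝓝 (x, h x)) :=
  (continuousAt_id.prodMk hx.1.continuousAt).tendsto

theorem IsHypographAt.eventually {x : ℝ} (hx : IsHypographAt S p τ ν h x) :
    ∀ᶠ y in 𝓝 x, IsHypographAt S p τ ν h y := by
  filter_upwards [hx.1.eventually (by simp), hx.tendsto.eventually hx.2.eventually_nhds]
    with y h1 h2
  exact ⟨h1, h2⟩

theorem IsHypographAt.congr {x : ℝ} (hx : IsHypographAt S p τ ν h x) (hgh : g =ᶠ[𝓝 x] h) :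
    IsHypographAt S p τ ν g x := by
  refine ⟨hx.1.congr_of_eventuallyEq hgh, ?_⟩
  rw [hgh.self_of_nhds]
  filter_upwards [hx.2, Filter.Eventually.prod_inl_nhds hgh (h x)]
    with z h1 h2
  rw [h1, h2]

theorem IsHypographAt.eventuallyEq {x : ℝ} (hx : IsHypographAt S p τ ν h x)
    (hx' : IsHypographAt S p τ ν g x) (he : h x = g x) : h =ᶠ[𝓝 x] g := by
  have h1 := hx.tendsto.eventually hx.2
  have h2 := hx'.tendsto.eventually hx'.2
  have h3 := hx.tendsto.eventually (he ▸ hx'.2)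
  have h4 := hx'.tendsto.eventually (he ▸ hx.2)
  filter_upwards [h1, h2, h3, h4] with y a b c d
  exact le_antisymm (c.1 (a.2 le_rfl)) (d.1 (b.2 le_rfl))

/-- The boundary is locally the graph. -/
theorem IsHypographAt.eventually_mem_frontier_iff {x : ℝ} (hf : IsFrame τ ν) (hS : IsClosed S)
    (hx : IsHypographAt S p τ ν h x) :
    ∀ᶠ z in 𝓝 (x, h x), (chart p τ ν z ∈ frontier S ↔ z.2 = h z.1) := by
  have hcont : ∀ᶠ z in 𝓝 (x, h x), ContinuousAt h z.1 :=
    ((hx.1.eventually (by simp)).mono fun y hy => hy.continuousAt).prod_inl_nhds (h x)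
  filter_upwards [hx.2.eventually_nhds, hcont] with z hz hzc
  rw [hS.frontier_eq, Set.mem_sdiff, hz.self_of_nhds]
  have hvert : Tendsto (fun s : ℝ => (z.1, z.2 + s)) (𝓝[>] 0) (𝓝 z) := by
    have : ContinuousAt (fun s : ℝ => (z.1, z.2 + s)) 0 := by fun_prop
    have := this.tendsto.mono_left (nhdsWithin_le_nhds (s := Ioi 0))
    simpa using this
  constructor
  · rintro ⟨h1, h2⟩
    refine h1.eq_of_not_lt fun h3 => h2 ?_
    rw [mem_interior_iff_mem_nhds]
    have h4 : ∀ᶠ z' in 𝓝 z, z'.2 < h z'.1 :=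
      continuousAt_snd.eventually_lt (hzc.comp (f := Prod.fst) continuousAt_fst) h3
    have h5 : ContinuousAt (coords p τ ν) (chart p τ ν z) := continuous_coords.continuousAt
    have h6 := h5.eventually (p := fun z' => chart p τ ν z' ∈ S)
      (by rw [coords_chart hf]; filter_upwards [hz, h4] with z' h7 h8 using h7.2 h8.le)
    filter_upwards [h6] with q hq
    rwa [chart_coords hf] at hq
  · intro h1
    refine ⟨h1.le, fun h2 => ?_⟩
    have h3 : ∀ᶠ z' in 𝓝 z, chart p τ ν z' ∈ S :=
      continuous_chart.continuousAt.eventually_mem (mem_interior_iff_mem_nhds.1 h2)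
    obtain ⟨s, ⟨h4, h5⟩, hs⟩ := ((hvert.eventually (h3.and hz)).and self_mem_nhdsWithin).exists
    have h6 := h5.1 h4
    simp only at h6
    have : 0 < s := hs
    linarith

theorem IsHypographAt.mem_frontier {x : ℝ} (hf : IsFrame τ ν) (hS : IsClosed S)
    (hx : IsHypographAt S p τ ν h x) : chart p τ ν (x, h x) ∈ frontier S :=
  (hx.eventually_mem_frontier_iff hf hS).self_of_nhds.2 rfl

/-- The bound `k` on the curvature of the boundary, in terms of the graph. -/
theorem IsHypographAt.abs_second_deriv_le {x : ℝ} (hf : IsFrame τ ν) (hS : IsClosed S)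
    (hk : ∀ P c, HasCurvatureAt (frontier S) P c → c ≤ k) (hx : IsHypographAt S p τ ν h x) :
    |deriv (deriv h) x| ≤ k * √(1 + deriv h x ^ 2) ^ 3 := by
  have h1 := hasCurvatureAt_graph (C := frontier S) hf hx.1 (by
    have h1 : ContinuousAt (coords p τ ν) (chart p τ ν (x, h x)) := continuous_coords.continuousAt
    have h2 := h1.eventually (p := fun z => (chart p τ ν z ∈ frontier S ↔ z.2 = h z.1))
      (by rw [coords_chart hf]; exact hx.eventually_mem_frontier_iff hf hS)
    filter_upwards [h2] with q hq
    rw [chart_coords hf] at hq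
    rw [hq]
    constructor
    · intro h3
      conv_lhs => rw [← chart_coords (p := p) hf q]
      rw [← h3]
    · intro h3
      conv_lhs => rw [h3]
      rw [coords_chart hf])
  have h2 : 0 < √(1 + deriv h x ^ 2) := Real.sqrt_pos.2 (by positivity)
  exact (div_le_iff₀ (by positivity)).1 (hk _ _ h1)

/-- The sine of the angle between the graph and the axis grows at most at rate `k`. -/
theorem abs_deriv_div_sqrt_le (hf : IsFrame τ ν) (hS : IsClosed S)
    (hk : ∀ P c, HasCurvatureAt (frontier S) P c → c ≤ k) {ℓ : ℝ}
    (hh : ∀ x ∈ Icc (-ℓ) ℓ, IsHypographAt S p τ ν h x) (h0 : deriv h 0 = 0) {x : ℝ}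
    (hx : x ∈ Icc (-ℓ) ℓ) : |deriv h x / √(1 + deriv h x ^ 2)| ≤ k * |x| := by
  have hℓ : (0 : ℝ) ∈ Icc (-ℓ) ℓ := ⟨by linarith [hx.1, hx.2], by linarith [hx.1, hx.2]⟩
  have hd : ∀ y ∈ Icc (-ℓ) ℓ, HasDerivAt (fun y => deriv h y / √(1 + deriv h y ^ 2))
      (deriv (deriv h) y / √(1 + deriv h y ^ 2) ^ 3) y := by
    intro y hy
    have h1 : HasDerivAt (deriv h) (deriv (deriv h) y) y :=
      (((hh y hy).1.derivWithin (m := 1) (by norm_num)).differentiableAt (by norm_num)).hasDerivAt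
    have hpos : 0 < √(1 + deriv h y ^ 2) := Real.sqrt_pos.2 (by positivity)
    have hsq : √(1 + deriv h y ^ 2) ^ 2 = 1 + deriv h y ^ 2 := Real.sq_sqrt (by positivity)
    have h2 : HasDerivAt (fun y => 1 + deriv h y ^ 2) (2 * deriv h y * deriv (deriv h) y) y := by
      simpa using (h1.pow 2).const_add 1
    have h3 := h1.div (h2.sqrt (by positivity)) hpos.ne'
    refine h3.congr_deriv ?_
    generalize √(1 + deriv h y ^ 2) = m at hpos hsq
    field_simp
    rw [hsq]; ring
  have h1 := (convex_Icc (-ℓ) ℓ).norm_image_sub_le_of_norm_hasDerivWithin_le (C := k)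
    (fun y hy => (hd y hy).hasDerivWithinAt) (fun y hy => ?_) hℓ hx
  · simpa [h0, Real.norm_eq_abs, abs_div] using h1
  · have hpos : 0 < √(1 + deriv h y ^ 2) := Real.sqrt_pos.2 (by positivity)
    rw [Real.norm_eq_abs, abs_div, abs_of_pos (pow_pos hpos 3)]
    exact (div_le_iff₀ (by positivity)).2 ((hh y hy).abs_second_deriv_le hf hS hk)

theorem abs_le_of_div_sqrt_le {m a : ℝ} (ha : a < 1) (hm : |m / √(1 + m ^ 2)| ≤ a) :
    |m| ≤ a / √(1 - a ^ 2) := by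
  have ha0 : 0 ≤ a := (abs_nonneg _).trans hm
  have h1 : 0 < √(1 + m ^ 2) := Real.sqrt_pos.2 (by positivity)
  have h2 : 0 < 1 - a ^ 2 := by nlinarith
  have h3 : 0 < √(1 - a ^ 2) := Real.sqrt_pos.2 h2
  rw [le_div_iff₀ h3]
  rw [abs_div, abs_of_pos h1, div_le_iff₀ h1] at hm
  refine abs_le_of_sq_le_sq' ?_ ha0 |>.2
  have h4 : |m| ^ 2 ≤ (a * √(1 + m ^ 2)) ^ 2 := pow_le_pow_left₀ (abs_nonneg _) hm 2
  rw [mul_pow, Real.sq_sqrt (by positivity), sq_abs] at h4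
  rw [mul_pow, Real.sq_sqrt h2.le, sq_abs]
  linarith

/-- Local graphs of bounded slope extend by a uniform length, by compactness of the boundary. -/
theorem exists_uniform_extension (hf : IsFrame τ ν) (hS : IsCompact S) (hbd : HasC2Boundary S)
    (p : EuclideanSpace ℝ (Fin 2)) (M : ℝ) :
    ∃ δ > 0, ∀ (h : ℝ → ℝ) (x : ℝ), IsHypographAt S p τ ν h x → |deriv h x| ≤ M →
      ∃ g : ℝ → ℝ, g x = h x ∧ ∀ y, |y - x| < δ → IsHypographAt S p τ ν g y := by
  set Z : Set (ℝ × ℝ) := coords p τ ν '' frontier S with hZ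
  have hZc : IsCompact Z :=
    (hS.of_isClosed_subset isClosed_frontier hS.isClosed.frontier_subset).image continuous_coords
  suffices H : ∃ δ > 0, ∀ z ∈ Z, ∀ (h : ℝ → ℝ), h z.1 = z.2 → IsHypographAt S p τ ν h z.1 →
      |deriv h z.1| ≤ M →
      ∃ g : ℝ → ℝ, g z.1 = h z.1 ∧ ∀ y, |y - z.1| < δ → IsHypographAt S p τ ν g y by
    obtain ⟨δ, hδ, H⟩ := H
    refine ⟨δ, hδ, fun h x hx hM => H (x, h x) ?_ h rfl hx hM⟩
    exact ⟨_, hx.mem_frontier hf hS.isClosed, coords_chart hf _⟩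
  refine hZc.induction_on (p := fun s => ∃ δ > 0, ∀ z ∈ s, ∀ (h : ℝ → ℝ), h z.1 = z.2 →
      IsHypographAt S p τ ν h z.1 → |deriv h z.1| ≤ M →
      ∃ g : ℝ → ℝ, g z.1 = h z.1 ∧ ∀ y, |y - z.1| < δ → IsHypographAt S p τ ν g y) ?_ ?_ ?_ ?_
  · exact ⟨1, one_pos, fun z hz => absurd hz (notMem_empty z)⟩
  · rintro s t hst ⟨δ, hδ, H⟩
    exact ⟨δ, hδ, fun z hz => H z (hst hz)⟩
  · rintro s t ⟨δ, hδ, H⟩ ⟨δ', hδ', H'⟩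
    refine ⟨min δ δ', lt_min hδ hδ', fun z hz h h1 h2 h3 => ?_⟩
    rcases hz with hz | hz
    · obtain ⟨g, hg, hg'⟩ := H z hz h h1 h2 h3
      exact ⟨g, hg, fun y hy => hg' y (hy.trans_le (min_le_left _ _))⟩
    · obtain ⟨g, hg, hg'⟩ := H' z hz h h1 h2 h3
      exact ⟨g, hg, fun y hy => hg' y (hy.trans_le (min_le_right _ _))⟩
  rintro z₀ ⟨q, hq, rfl⟩
  set z₀ := coords p τ ν q with hz₀
  have hqz : chart p τ ν z₀ = q := chart_coords hf q
  obtain ⟨φ, hφ⟩ := hbd.exists_isDefiningAt hq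
  rw [← hqz] at hφ hq
  have hφ0 := (hφ.mem_frontier_iff hS.isClosed).1 hq
  have hfr : ∀ᶠ z in 𝓝 z₀, (chart p τ ν z ∈ frontier S ↔ φ (chart p τ ν z) = 0) :=
    continuous_chart.continuousAt.eventually (hφ.eventually_mem_frontier_iff hS.isClosed)
  rcases lt_or_ge 0 (fderiv ℝ φ (chart p τ ν z₀) ν) with hB | hB
  · obtain ⟨g, hg0, hg, hgz⟩ := hφ.exists_isHypographAt hφ0 hB
    obtain ⟨r, hr, hball⟩ := Metric.eventually_nhds_iff_ball.1 hg.eventually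
    refine ⟨{z | (chart p τ ν z ∈ frontier S ↔ z.2 = g z.1) ∧ |z.1 - z₀.1| < r / 2},
      mem_nhdsWithin_of_mem_nhds ?_, r / 2, half_pos hr, ?_⟩
    · have h1 : ∀ᶠ z in 𝓝 z₀, |z.1 - z₀.1| < r / 2 := by
        have : ContinuousAt (fun z : ℝ × ℝ => |z.1 - z₀.1|) z₀ := by fun_prop
        exact this.eventually_lt_const (by simpa using half_pos hr)
      filter_upwards [hfr, hgz, h1] with z a b c
      exact ⟨a.trans b, c⟩
    · rintro z ⟨hz1, hz2⟩ h hhz hh -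
      have h1 := hh.mem_frontier hf hS.isClosed
      rw [hhz] at h1
      refine ⟨g, by rw [hhz, ← hz1.1 h1], fun y hy => hball y ?_⟩
      rw [Metric.mem_ball, Real.dist_eq]
      calc |y - z₀.1| = |(y - z.1) + (z.1 - z₀.1)| := by ring_nf
        _ ≤ |y - z.1| + |z.1 - z₀.1| := abs_add_le _ _
        _ < r := by linarith
  · -- the boundary is vertical at `z₀`, so that nearby there are no graphs of slope at most `M`
    have hcont : ∀ w : EuclideanSpace ℝ (Fin 2),
        ContinuousAt (fun z => fderiv ℝ φ (chart p τ ν z) w) z₀ := by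
      intro w
      have h1 := (hφ.contDiffAt.fderiv_right (m := 1) (by norm_num)).continuousAt
      exact (ContinuousAt.comp (f := chart p τ ν) h1
        continuous_chart.continuousAt).clm_apply continuousAt_const
    have hev : ∀ᶠ z in 𝓝 z₀, fderiv ℝ φ (chart p τ ν z) ν < 0 ∨
        M * fderiv ℝ φ (chart p τ ν z) ν < |fderiv ℝ φ (chart p τ ν z) τ| := by
      rcases hB.lt_or_eq with hB | hB
      · exact ((hcont ν).eventually_lt_const hB).mono fun z hz => Or.inl hz
      · have hA : 0 < |fderiv ℝ φ (chart p τ ν z₀) τ| := by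
          rw [abs_pos]
          intro hA
          refine hφ.fderiv_ne (ContinuousLinearMap.ext fun w => ?_)
          have h1 : (w : EuclideanSpace ℝ (Fin 2)) =
              (coords 0 τ ν w).1 • τ + (coords 0 τ ν w).2 • ν := by
            conv_lhs => rw [← chart_coords (p := 0) hf w]
            simp [chart]
          rw [h1, map_add, map_smul, map_smul, hA, hB]
          simp
        have h2 : ContinuousAt (fun z => M * fderiv ℝ φ (chart p τ ν z) ν) z₀ :=
          continuousAt_const.mul (hcont ν)
        exact (h2.eventually_lt (hcont τ).abs (by rw [hB, mul_zero]; exact hA)).mono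
          fun z hz => Or.inr hz
    refine ⟨{z | IsDefiningAt S φ (chart p τ ν z) ∧ (fderiv ℝ φ (chart p τ ν z) ν < 0 ∨
        M * fderiv ℝ φ (chart p τ ν z) ν < |fderiv ℝ φ (chart p τ ν z) τ|)},
      mem_nhdsWithin_of_mem_nhds
        ((continuous_chart.continuousAt.eventually hφ.eventually).and hev), 1, one_pos, ?_⟩
    rintro z ⟨hz1, hz2⟩ h hhz hh hM
    exfalso
    have e : (z.1, h z.1) = z := by rw [hhz]
    have h1 := hh.eventually_mem_frontier_iff hf hS.isClosed
    rw [e] at h1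
    have h2 : ∀ᶠ z' in 𝓝 z, (φ (chart p τ ν z') = 0 ↔ z'.2 = h z'.1) := by
      filter_upwards [h1, continuous_chart.continuousAt.eventually
        (hz1.eventually_mem_frontier_iff hS.isClosed)] with z' a b
      rw [← b, a]
    have h3 := deriv_graph_eq (hz1.contDiffAt.differentiableAt (by norm_num)) hhz
      (hh.1.differentiableAt (by norm_num)) h2
    rw [map_add, map_smul, smul_eq_mul] at h3
    have h4 : fderiv ℝ φ (chart p τ ν z) (-ν) ≤ 0 := by
      refine hz1.fderiv_nonpos_of_ray (h2.self_of_nhds.2 hhz.symm) ?_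
      have h5 : Tendsto (fun s : ℝ => (z.1, z.2 - s)) (𝓝[>] 0) (𝓝 z) := by
        have : ContinuousAt (fun s : ℝ => (z.1, z.2 - s)) 0 := by fun_prop
        have := this.tendsto.mono_left (nhdsWithin_le_nhds (s := Ioi 0))
        simpa using this
      have h6 := hh.2
      rw [e] at h6
      filter_upwards [h5.eventually h6, self_mem_nhdsWithin] with s h7 h8
      have h8' : 0 < s := h8
      have := h7.2 (by linarith)
      convert this using 1
      simp only [chart]; module
    rw [map_neg] at h4
    rcases hz2 with h5 | h5
    · linarith
    · have h6 : |fderiv ℝ φ (chart p τ ν z) τ| = |deriv h z.1| * fderiv ℝ φ (chart p τ ν z) ν := by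
        rw [eq_neg_of_add_eq_zero_left h3, abs_neg, abs_mul, abs_of_nonneg (by linarith :
          0 ≤ fderiv ℝ φ (chart p τ ν z) ν)]
      rw [h6] at h5
      nlinarith

theorem IsHypographAt.glue {g₁ g₂ : ℝ → ℝ} {a b c : ℝ}
    (h₁ : ∀ x ∈ Icc a b, IsHypographAt S p τ ν g₁ x)
    (h₂ : ∀ x ∈ Icc b c, IsHypographAt S p τ ν g₂ x) (hab : a ≤ b) (hbc : b ≤ c)
    (he : g₁ b = g₂ b) :
    ∃ g : ℝ → ℝ, (∀ x ≤ b, g x = g₁ x) ∧ (∀ x, b ≤ x → g x = g₂ x) ∧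
      ∀ x ∈ Icc a c, IsHypographAt S p τ ν g x := by
  classical
  set g : ℝ → ℝ := fun x => if x ≤ b then g₁ x else g₂ x with hg
  have hl : ∀ x ≤ b, g x = g₁ x := fun x hx => if_pos hx
  have hr : ∀ x, b ≤ x → g x = g₂ x := by
    intro x hx
    rcases hx.eq_or_lt with h | h
    · rw [← h, hl b le_rfl, he]
    · exact if_neg h.not_ge
  refine ⟨g, hl, hr, fun x hx => ?_⟩
  rcases lt_trichotomy x b with h | h | h
  · refine (h₁ x ⟨hx.1, h.le⟩).congr ?_
    filter_upwards [Iio_mem_nhds h] with y hy using hl y (le_of_lt hy)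
  · subst h
    have h3 := h₁ x ⟨hx.1, le_rfl⟩
    refine h3.congr ?_
    filter_upwards [h3.eventuallyEq (h₂ x ⟨le_rfl, hx.2⟩) he] with y hy
    rcases le_total y x with h | h
    · exact hl y h
    · rw [hr y h, hy]
  · refine (h₂ x ⟨h.le, hx.2⟩).congr ?_
    filter_upwards [Ioi_mem_nhds h] with y hy using hr y (le_of_lt hy)

/-- In the frame given by the tangent and the outer normal, the set is locally a hypograph. -/
theorem exists_tangent_frame (hS : IsCompact S) (hbd : HasC2Boundary S) (hp : p ∈ frontier S) :
    ∃ (τ ν : EuclideanSpace ℝ (Fin 2)) (g : ℝ → ℝ), IsFrame τ ν ∧ g 0 = 0 ∧ deriv g 0 = 0 ∧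
      IsHypographAt S p τ ν g 0 := by
  obtain ⟨φ, hφ⟩ := hbd.exists_isDefiningAt hp
  obtain ⟨ν, hν, hgrad⟩ := exists_unit_gradient hφ.fderiv_ne
  have hcpos : 0 < ‖fderiv ℝ φ p‖ := norm_pos_iff.2 hφ.fderiv_ne
  obtain ⟨τ, hf⟩ := exists_frame_right hν
  have hp0 : chart p τ ν (0, 0) = p := by simp [chart]
  have hdν : 0 < fderiv ℝ φ p ν := by
    rw [hgrad, real_inner_self_eq_norm_sq, hν]; simpa using hcpos
  have h0 : φ p = 0 := (hφ.mem_frontier_iff hS.isClosed).1 hp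
  obtain ⟨g, hg0, hg, hgz⟩ := IsDefiningAt.exists_isHypographAt (p := p) (τ := τ) (ν := ν)
    (z₀ := (0, 0)) (by rw [hp0]; exact hφ) (by rw [hp0]; exact h0) (by rw [hp0]; exact hdν)
  simp only at hg0 hg
  refine ⟨τ, ν, g, hf, hg0, ?_, hg⟩
  have hd1 := deriv_graph_eq (p := p) (τ := τ) (ν := ν) (z₀ := (0, 0)) (h := g)
    (by rw [hp0]; exact hφ.contDiffAt.differentiableAt (by norm_num)) hg0
    (hg.1.differentiableAt (by norm_num)) hgz
  simp only [hp0] at hd1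
  rw [map_add, map_smul, smul_eq_mul, hgrad τ, hf.symm.inner_eq, mul_zero, zero_add] at hd1
  exact (mul_eq_zero.1 hd1).resolve_right hdν.ne'

/-- Around every boundary point, and over an interval of every length `L < 1 / k`, the boundary
contains the graph of a function in the coordinates given by the tangent and the normal. -/
theorem exists_long_graph (hS : IsCompact S) (hbd : HasC2Boundary S)
    (hk : ∀ P c, HasCurvatureAt (frontier S) P c → c ≤ k) {L : ℝ} (hL : 0 ≤ L) (hkL : k * L < 1)
    (hp : p ∈ frontier S) :
    ∃ (τ ν : EuclideanSpace ℝ (Fin 2)) (h : ℝ → ℝ), IsFrame τ ν ∧ h 0 = 0 ∧ deriv h 0 = 0 ∧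
      ∀ x ∈ Icc (-L) L, IsHypographAt S p τ ν h x := by
  obtain ⟨τ, ν, g, hf, hg0, hg', hg⟩ := exists_tangent_frame hS hbd hp
  have hder : ∀ h : ℝ → ℝ, h 0 = 0 → IsHypographAt S p τ ν h 0 → deriv h 0 = 0 := by
    intro h h1 h2
    rw [(h2.eventuallyEq hg (by rw [h1, hg0])).deriv_eq, hg']
  refine ⟨τ, ν, ?_⟩
  set M := k * L / √(1 - (k * L) ^ 2) with hM
  obtain ⟨δ, hδ, hext⟩ := exists_uniform_extension hf hS hbd p M
  have hk0 : 0 ≤ k := by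
    have h1 := hg.abs_second_deriv_le hf hS.isClosed hk
    rw [hg'] at h1
    have := (abs_nonneg _).trans h1
    simpa using this
  have main : ∀ m : ℕ, ∃ h : ℝ → ℝ, h 0 = 0 ∧
      ∀ x ∈ Icc (-(min (m * (δ / 2)) L)) (min (m * (δ / 2)) L), IsHypographAt S p τ ν h x := by
    intro m
    induction m with
    | zero =>
      refine ⟨g, hg0, fun x hx => ?_⟩
      simp only [Nat.cast_zero, zero_mul, min_eq_left hL, neg_zero, Icc_self,
        mem_singleton_iff] at hx
      rw [hx]; exact hg
    | succ m ih =>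
      obtain ⟨h, hh0, hh⟩ := ih
      set ℓ := min (m * (δ / 2)) L with hℓ
      have hℓ0 : 0 ≤ ℓ := le_min (by positivity) hL
      have hℓL : ℓ ≤ L := min_le_right _ _
      have hd0 : deriv h 0 = 0 := hder h hh0 (hh 0 ⟨by linarith, hℓ0⟩)
      have hslope : ∀ x ∈ Icc (-ℓ) ℓ, |deriv h x| ≤ M := by
        intro x hx
        refine abs_le_of_div_sqrt_le hkL ((abs_deriv_div_sqrt_le hf hS.isClosed hk hh hd0 hx).trans ?_)
        have : |x| ≤ L := (abs_le.2 hx).trans hℓL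
        gcongr
      have hR : ℓ ∈ Icc (-ℓ) ℓ := ⟨by linarith, le_rfl⟩
      have hLm : -ℓ ∈ Icc (-ℓ) ℓ := ⟨le_rfl, by linarith⟩
      obtain ⟨gR, hgR0, hgR⟩ := hext h ℓ (hh ℓ hR) (hslope ℓ hR)
      obtain ⟨gL, hgL0, hgL⟩ := hext h (-ℓ) (hh _ hLm) (hslope _ hLm)
      obtain ⟨g₁, hg₁l, hg₁r, hg₁⟩ := IsHypographAt.glue (c := ℓ + δ / 2) hh
        (fun x hx => hgR x (by rw [abs_of_nonneg (by linarith [hx.1])]; linarith [hx.2]))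
        (by linarith) (by linarith) hgR0.symm
      obtain ⟨g₂, hg₂l, hg₂r, hg₂⟩ := IsHypographAt.glue (a := -ℓ - δ / 2)
        (fun x hx => hgL x (by rw [abs_of_nonpos (by linarith [hx.2])]; linarith [hx.1])) hg₁
        (by linarith) (by linarith) (by rw [hgL0, hg₁l _ (by linarith)])
      refine ⟨g₂, by rw [hg₂r 0 (by linarith), hg₁l 0 hℓ0, hh0], fun x hx => hg₂ x ?_⟩
      have h1 : min ((m + 1 : ℕ) * (δ / 2)) L ≤ ℓ + δ / 2 := by
        rw [hℓ, ← min_add_add_right]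
        refine min_le_min ?_ (by linarith)
        push_cast; linarith
      exact ⟨by linarith [hx.1], by linarith [hx.2]⟩
  obtain ⟨m, hm⟩ := exists_nat_gt (L / (δ / 2))
  obtain ⟨h, hh0, hh⟩ := main m
  rw [min_eq_right ((div_lt_iff₀ (by positivity)).1 hm).le] at hh
  exact ⟨h, hf, hh0, hder h hh0 (hh 0 ⟨by linarith, hL⟩), hh⟩

end PlaneCurves

/-! ### Covering the boundary of a plane set by flat graphs -/

section Arcs

variable {S : Set (EuclideanSpace ℝ (Fin 2))} {p q τ ν : EuclideanSpace ℝ (Fin 2)}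
  {h : ℝ → ℝ} {k : ℝ}

theorem ofReal_le_perimeter_graph (hf : IsFrame τ ν) {a b : ℝ} :
    ENNReal.ofReal (b - a) ≤ perimeter ((fun x => chart p τ ν (x, h x)) '' Icc a b) := by
  refine ofReal_le_perimeter (p := p) hf.norm_left fun x hx => ?_
  refine ⟨_, ⟨x, Ioo_subset_Icc_self hx, rfl⟩, ?_⟩
  exact congrArg Prod.fst (coords_chart (p := p) hf (x, h x))

theorem graph_subset_frontier (hf : IsFrame τ ν) (hS : IsClosed S) {s : Set ℝ}
    (hh : ∀ x ∈ s, IsHypographAt S p τ ν h x) :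
    (fun x => chart p τ ν (x, h x)) '' s ⊆ frontier S := by
  rintro _ ⟨x, hx, rfl⟩
  exact (hh x hx).mem_frontier hf hS

theorem continuousOn_graph {s : Set ℝ} (hh : ∀ x ∈ s, IsHypographAt S p τ ν h x) :
    ContinuousOn (fun x => chart p τ ν (x, h x)) s := fun x hx =>
  (continuous_chart.continuousAt.comp (f := fun x => (x, h x))
    (hh x hx).tendsto).continuousWithinAt

/-- In the plane, if the boundary is nonempty, then low curvature makes both the curvature and the
length `R` of the boundary finite. The boundary contains graphs over intervals of length almost
`2 / k`, hence `k R ≥ 2`. -/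
theorem exists_curvature_bound (hS : IsCompact S) (hbd : HasC2Boundary S)
    (hκ : sectionCurvature S < ⊤) (hne : (frontier S).Nonempty) :
    ∃ k R : ℝ, 0 < k ∧ perimeter (frontier S) = ENNReal.ofReal R ∧
      (∀ P c, HasCurvatureAt (frontier S) P c → c ≤ k) ∧
      k * R ≤ (sectionCurvature S).toReal ∧ 2 ≤ k * R := by
  obtain ⟨p, hp⟩ := hne
  have hle : maxCurvature (frontier S) * perimeter (frontier S) ≤ sectionCurvature S := by
    unfold sectionCurvature
    refine le_iSup_of_le ⊤ (le_iSup_of_le ?_ ?_)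
    · rw [AffineSubspace.direction_top, finrank_top, finrank_euclideanSpace_fin]
    · rw [AffineSubspace.top_coe, inter_univ]
  have hper0 : perimeter (frontier S) ≠ 0 := by
    obtain ⟨τ, ν, g, hf, -, -, hg⟩ := exists_tangent_frame hS hbd hp
    obtain ⟨r, hr, hball⟩ := Metric.eventually_nhds_iff_ball.1 hg.eventually
    have h1 := ofReal_le_perimeter_graph (p := p) (h := g) hf (a := 0) (b := r / 2)
    have h2 : perimeter ((fun x => chart p τ ν (x, g x)) '' Icc 0 (r / 2)) ≤
        perimeter (frontier S) := measure_mono (graph_subset_frontier hf hS.isClosed fun x hx => by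
          refine hball x ?_
          rw [Metric.mem_ball, Real.dist_eq, sub_zero, abs_of_nonneg hx.1]
          linarith [hx.2])
    have h3 : 0 < ENNReal.ofReal (r / 2 - 0) := by
      rw [ENNReal.ofReal_pos]; linarith
    exact (h3.trans_le (h1.trans h2)).ne'
  have hcurv : maxCurvature (frontier S) ≠ ⊤ := by
    intro h
    rw [h, ENNReal.top_mul hper0] at hle
    exact hκ.ne (top_le_iff.1 hle)
  set k := (maxCurvature (frontier S)).toReal with hkdef
  have hk : ∀ P c, HasCurvatureAt (frontier S) P c → c ≤ k := by
    intro P c hc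
    refine (ENNReal.ofReal_le_iff_le_toReal hcurv).1 ?_
    exact le_iSup_of_le P (le_iSup_of_le c (le_iSup_of_le hc le_rfl))
  have hkpos : 0 < k := by
    refine lt_of_le_of_ne ENNReal.toReal_nonneg fun h0 => ?_
    obtain ⟨D, hD⟩ := hS.isBounded.exists_norm_le
    have hD0 : 0 ≤ D := (norm_nonneg _).trans (hD p (hS.isClosed.frontier_subset hp))
    obtain ⟨τ, ν, h, hf, -, -, hh⟩ := exists_long_graph hS hbd hk (L := 2 * D + 1)
      (by positivity) (by rw [← h0, zero_mul]; exact one_pos) hp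
    have hx : 2 * D + 1 ∈ Icc (-(2 * D + 1)) (2 * D + 1) := ⟨by linarith, le_rfl⟩
    have h1 := hD _ (hh _ hx).self_mem
    have h2 := hD p (hS.isClosed.frontier_subset hp)
    have h3 := congrArg Prod.fst (coords_chart (p := p) hf (2 * D + 1, h (2 * D + 1)))
    simp only [coords] at h3
    have h4 := abs_real_inner_le_norm τ (chart p τ ν (2 * D + 1, h (2 * D + 1)) - p)
    rw [h3, hf.norm_left, one_mul, abs_of_nonneg (by positivity)] at h4
    linarith [norm_sub_le (chart p τ ν (2 * D + 1, h (2 * D + 1))) p]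
  have hcurv0 : maxCurvature (frontier S) ≠ 0 := by
    intro h
    rw [hkdef, h, ENNReal.toReal_zero] at hkpos
    exact lt_irrefl _ hkpos
  have hper : perimeter (frontier S) ≠ ⊤ := by
    intro h
    rw [h, ENNReal.mul_top hcurv0] at hle
    exact hκ.ne (top_le_iff.1 hle)
  refine ⟨k, (perimeter (frontier S)).toReal, hkpos, (ENNReal.ofReal_toReal hper).symm, hk, ?_, ?_⟩
  · rw [hkdef, ← ENNReal.toReal_mul]
    exact ENNReal.toReal_mono hκ.ne hle
  · by_contra hlt
    push Not at hlt
    set R := (perimeter (frontier S)).toReal with hR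
    have hR0 : 0 ≤ R := ENNReal.toReal_nonneg
    obtain ⟨τ, ν, h, hf, -, -, hh⟩ := exists_long_graph hS hbd hk (L := (R / 2 + 1 / k) / 2)
      (by positivity) (by field_simp; linarith) hp
    have h1 := (ofReal_le_perimeter_graph (p := p) (h := h) hf).trans
      (measure_mono (graph_subset_frontier hf hS.isClosed hh) :
        perimeter _ ≤ perimeter (frontier S))
    replace h1 := (ENNReal.ofReal_le_iff_le_toReal hper).1 h1
    rw [← hR] at h1
    have h2 : R < 2 / k := by rw [lt_div_iff₀ hkpos]; linarith
    have h3 : 2 / k = 2 * (1 / k) := by ring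
    linarith

/-- Inside the strip over which it is defined, a graph in the boundary is relatively open and closed
in the boundary, so it contains every connected subset that it meets. -/
theorem mem_graph_of_isPreconnected (hf : IsFrame τ ν) (hS : IsClosed S) {L : ℝ}
    (hh : ∀ x ∈ Icc (-L) L, IsHypographAt S p τ ν h x) {Q : Set (EuclideanSpace ℝ (Fin 2))}
    (hQ : IsPreconnected Q) (hQS : Q ⊆ frontier S) (hQL : ∀ q ∈ Q, |(coords p τ ν q).1| < L)
    {q₀ : EuclideanSpace ℝ (Fin 2)} (hq₀ : q₀ ∈ Q)
    (hg : (coords p τ ν q₀).2 = h (coords p τ ν q₀).1) (hq : q ∈ Q) :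
    (coords p τ ν q).2 = h (coords p τ ν q).1 := by
  by_contra hq'
  have hcov : ∀ x ∈ Q, if (coords p τ ν x).2 = h (coords p τ ν x).1
      then ∀ᶠ y in 𝓝 x, y ∈ Q → (coords p τ ν y).2 = h (coords p τ ν y).1
      else ∀ᶠ y in 𝓝 x, y ∈ Q → (coords p τ ν y).2 ≠ h (coords p τ ν y).1 := by
    intro x hx
    have hc : ContinuousAt (coords p τ ν) x := continuous_coords.continuousAt
    have hx' := hh _ (abs_le.1 (hQL x hx).le)
    split_ifs with hgx
    · have h1 := hx'.eventually_mem_frontier_iff hf hS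
      rw [← hgx] at h1
      filter_upwards [hc.eventually h1] with y h2 h3
      rw [chart_coords hf] at h2
      exact h2.1 (hQS h3)
    · have h1 : ContinuousAt (fun y => h (coords p τ ν y).1) x :=
        hx'.1.continuousAt.comp (f := fun y => (coords p τ ν y).1)
          (continuous_fst.comp continuous_coords).continuousAt
      have h2 : ContinuousAt (fun y => (coords p τ ν y).2) x :=
        (continuous_snd.comp continuous_coords).continuousAt
      have h3 := (h2.sub h1).eventually_ne (sub_ne_zero.2 hgx)
      filter_upwards [h3] with y h4 _ using sub_ne_zero.1 h4
  set U := {x | ∀ᶠ y in 𝓝 x, y ∈ Q → (coords p τ ν y).2 = h (coords p τ ν y).1}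
  set V := {x | ∀ᶠ y in 𝓝 x, y ∈ Q → (coords p τ ν y).2 ≠ h (coords p τ ν y).1}
  have hUV : Q ⊆ U ∪ V := by
    intro x hx
    have := hcov x hx
    split_ifs at this
    · exact Or.inl this
    · exact Or.inr this
  have h1 : q₀ ∈ U := by
    have := hcov q₀ hq₀; rwa [if_pos hg] at this
  have h2 : q ∈ V := by
    have := hcov q hq; rwa [if_neg hq'] at this
  obtain ⟨x, hx, hxU, hxV⟩ := hQ U V isOpen_setOfPred_eventually_nhds
    isOpen_setOfPred_eventually_nhds hUV ⟨q₀, hq₀, h1⟩ ⟨q, hq, h2⟩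
  exact hxV.self_of_nhds hx (hxU.self_of_nhds hx)

/-- A family of pairwise disjoint graphs over intervals of half-length `7 / (25 k)` has at most
`25 k R / 14` members. If the family is maximal, then the graphs over the longer intervals of
half-length `3 / (5 k)` cover the boundary. -/
theorem exists_arc_cover (hS : IsCompact S) (hbd : HasC2Boundary S) (hkpos : 0 < k)
    (hk : ∀ P c, HasCurvatureAt (frontier S) P c → c ≤ k) {R : ℝ}
    (hR : perimeter (frontier S) = ENNReal.ofReal R) (hR0 : 0 ≤ R) :
    ∃ (F : Finset (EuclideanSpace ℝ (Fin 2)))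
      (τ ν : EuclideanSpace ℝ (Fin 2) → EuclideanSpace ℝ (Fin 2))
      (h : EuclideanSpace ℝ (Fin 2) → ℝ → ℝ) (L : ℝ),
      (∀ p ∈ F, IsFrame (τ p) (ν p) ∧
        ∀ x ∈ Icc (-L) L, IsHypographAt S p (τ p) (ν p) (h p) x ∧ |deriv (h p) x| ≤ 3 / 4) ∧
      F.card * (14 / 25) ≤ k * R ∧
      ∀ q ∈ frontier S, ∃ p ∈ F, ∃ x ∈ Ioo (-L) L, q = chart p (τ p) (ν p) (x, h p x) := by
  set L := 3 / (5 * k) with hL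
  set ℓ := 7 / (25 * k) with hℓ
  have hℓ0 : 0 < ℓ := by positivity
  have hkL : k * L = 3 / 5 := by rw [hL]; field_simp
  have hkℓ : k * ℓ = 7 / 25 := by rw [hℓ]; field_simp
  have hℓL : ℓ ≤ L := by
    have : k * ℓ ≤ k * L := by rw [hkL, hkℓ]; norm_num
    exact le_of_mul_le_mul_left this hkpos
  have hL0 : 0 < L := hℓ0.trans_le hℓL
  have hgraph : ∀ p : EuclideanSpace ℝ (Fin 2), ∃ (τ ν : EuclideanSpace ℝ (Fin 2)) (h : ℝ → ℝ),
      p ∈ frontier S → IsFrame τ ν ∧ h 0 = 0 ∧ deriv h 0 = 0 ∧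
      ∀ x ∈ Icc (-L) L, IsHypographAt S p τ ν h x := by
    intro p
    by_cases hp : p ∈ frontier S
    · obtain ⟨τ, ν, h, H⟩ := exists_long_graph hS hbd hk hL0.le (by rw [hkL]; norm_num) hp
      exact ⟨τ, ν, h, fun _ => H⟩
    · exact ⟨0, 0, 0, fun H => absurd H hp⟩
  choose τ ν h hg using hgraph
  set Γ : EuclideanSpace ℝ (Fin 2) → Set (EuclideanSpace ℝ (Fin 2)) := fun p =>
    (fun x => chart p (τ p) (ν p) (x, h p x)) '' Icc (-ℓ) ℓ with hΓ
  have hsub : Icc (-ℓ) ℓ ⊆ Icc (-L) L := Icc_subset_Icc (by linarith) hℓL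
  have hslopeL : ∀ p ∈ frontier S, ∀ x ∈ Icc (-L) L, |deriv (h p) x| ≤ 3 / 4 := by
    intro p hp x hx
    obtain ⟨hf, -, hd, hh⟩ := hg p hp
    have h1 := (abs_deriv_div_sqrt_le hf hS.isClosed hk hh hd hx).trans
      (mul_le_mul_of_nonneg_left (abs_le.2 hx) hkpos.le)
    rw [hkL] at h1
    refine (abs_le_of_div_sqrt_le (by norm_num) h1).trans_eq ?_
    rw [show (1 : ℝ) - (3 / 5) ^ 2 = (4 / 5) ^ 2 by norm_num, Real.sqrt_sq (by norm_num)]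
    norm_num
  have hslopeℓ : ∀ p ∈ frontier S, ∀ x ∈ Icc (-ℓ) ℓ, |deriv (h p) x| ≤ 7 / 24 := by
    intro p hp x hx
    obtain ⟨hf, -, hd, hh⟩ := hg p hp
    have h1 := (abs_deriv_div_sqrt_le hf hS.isClosed hk hh hd (hsub hx)).trans
      (mul_le_mul_of_nonneg_left (abs_le.2 hx) hkpos.le)
    rw [hkℓ] at h1
    refine (abs_le_of_div_sqrt_le (by norm_num) h1).trans_eq ?_
    rw [show (1 : ℝ) - (7 / 25) ^ 2 = (24 / 25) ^ 2 by norm_num, Real.sqrt_sq (by norm_num)]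
    norm_num
  have hcard : ∀ F : Finset (EuclideanSpace ℝ (Fin 2)), (∀ p ∈ F, p ∈ frontier S) →
      (F : Set (EuclideanSpace ℝ (Fin 2))).PairwiseDisjoint Γ → F.card * (14 / 25) ≤ k * R := by
    intro F hF hdisj
    have h1 : ∑ p ∈ F, perimeter (Γ p) ≤ perimeter (frontier S) := by
      unfold perimeter
      rw [← measure_biUnion_finset hdisj]
      · refine measure_mono (iUnion₂_subset fun p hp => ?_)
        exact graph_subset_frontier (hg p (hF p hp)).1 hS.isClosed
          fun x hx => (hg p (hF p hp)).2.2.2 x (hsub hx)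
      · intro p hp
        exact (isCompact_Icc.image_of_continuousOn (continuousOn_graph
          fun x hx => (hg p (hF p hp)).2.2.2 x (hsub hx))).measurableSet
    have h2 : ∑ p ∈ F, ENNReal.ofReal (ℓ - -ℓ) ≤ ∑ p ∈ F, perimeter (Γ p) :=
      Finset.sum_le_sum fun p hp => ofReal_le_perimeter_graph (hg p (hF p hp)).1
    have h3 := h2.trans h1
    rw [Finset.sum_const, nsmul_eq_mul, hR, ← ENNReal.ofReal_natCast,
      ← ENNReal.ofReal_mul (by positivity), ENNReal.ofReal_le_ofReal_iff hR0] at h3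
    calc (F.card : ℝ) * (14 / 25) = k * (F.card * (ℓ - -ℓ)) := by
          linear_combination (-2 * (F.card : ℝ)) * hkℓ
      _ ≤ k * R := by gcongr
  -- a boundary point whose short graph meets the short graph of `p` is on the long graph of `p`
  have hcover : ∀ p ∈ frontier S, ∀ q ∈ frontier S, ¬ Disjoint (Γ p) (Γ q) →
      ∃ x ∈ Ioo (-L) L, q = chart p (τ p) (ν p) (x, h p x) := by
    intro p hp q hq hnd
    obtain ⟨z, ⟨x₁, hx₁, hz₁⟩, ⟨x₂, hx₂, hz₂⟩⟩ := Set.not_disjoint_iff.1 hnd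
    obtain ⟨hf, -, -, hh⟩ := hg p hp
    obtain ⟨hf', hq0, -, hh'⟩ := hg q hq
    have h0 : (0 : ℝ) ∈ Icc (-ℓ) ℓ := ⟨by linarith, hℓ0.le⟩
    have hu : uIcc 0 x₂ ⊆ Icc (-ℓ) ℓ := ordConnected_Icc.uIcc_subset h0 hx₂
    set Q := (fun x => chart q (τ q) (ν q) (x, h q x)) '' uIcc 0 x₂ with hQ
    have hqQ : q ∈ Q := ⟨0, left_mem_uIcc, by simp [chart, hq0]⟩
    have hzQ : z ∈ Q := ⟨x₂, right_mem_uIcc, hz₂⟩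
    have hQc : IsPreconnected Q := isPreconnected_uIcc.image _
      (continuousOn_graph fun x hx => hh' x (hsub (hu hx)))
    have hQS : Q ⊆ frontier S :=
      graph_subset_frontier hf' hS.isClosed fun x hx => hh' x (hsub (hu hx))
    have hcz : coords p (τ p) (ν p) z = (x₁, h p x₁) := by
      rw [← hz₁]; exact coords_chart hf _
    have hQL : ∀ y ∈ Q, |(coords p (τ p) (ν p) y).1| < L := by
      rintro y ⟨x, hx, rfl⟩
      have hnorm : ‖chart q (τ q) (ν q) (x, h q x) - z‖ ≤ 25 / 24 * ℓ := by
        rw [← hz₂]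
        simp only
        rw [chart_sub_chart]
        have hdx : |x - x₂| ≤ ℓ := by
          have h3 := abs_sub_right_of_mem_uIcc hx
          rw [sub_zero, abs_sub_comm] at h3
          exact h3.trans (abs_le.2 hx₂)
        have hdh : |h q x - h q x₂| ≤ 7 / 24 * |x - x₂| := by
          have := (convex_Icc (-ℓ) ℓ).norm_image_sub_le_of_norm_deriv_le (f := h q)
            (fun y hy => (hh' y (hsub hy)).1.differentiableAt (by norm_num))
            (hslopeℓ q hq) hx₂ (hu hx)
          exact this
        refine abs_le_of_sq_le_sq' ?_ (by positivity) |>.2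
        rw [hf'.norm_sq]
        have e1 := pow_le_pow_left₀ (abs_nonneg _) hdx 2
        have e2 := pow_le_pow_left₀ (abs_nonneg _) hdh 2
        rw [sq_abs] at e1 e2
        rw [mul_pow, sq_abs] at e2
        simp only
        linarith
      have hlip := (lipschitzWith_inner_left hf.norm_left p).dist_le_mul
        (chart q (τ q) (ν q) (x, h q x)) z
      rw [NNReal.coe_one, one_mul, Real.dist_eq, dist_eq_norm] at hlip
      have hz1 : (inner ℝ (τ p) (z - p) : ℝ) = x₁ := congrArg Prod.fst hcz
      rw [hz1] at hlip
      have hx₁' := abs_le.2 hx₁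
      have hlast : ℓ + 25 / 24 * ℓ < L := by
        refine lt_of_mul_lt_mul_left ?_ hkpos.le
        rw [hkL, show k * (ℓ + 25 / 24 * ℓ) = (k * ℓ) * (49 / 24) by ring, hkℓ]
        norm_num
      have htri := abs_add_le (inner ℝ (τ p) (chart q (τ q) (ν q) (x, h q x) - p) - x₁ : ℝ) x₁
      rw [sub_add_cancel] at htri
      change |(inner ℝ (τ p) (chart q (τ q) (ν q) (x, h q x) - p) : ℝ)| < L
      linarith
    have key := mem_graph_of_isPreconnected hf hS.isClosed hh hQc hQS hQL hzQ (by rw [hcz]) hqQ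
    refine ⟨_, abs_lt.1 (hQL q hqQ), ?_⟩
    rw [← key]
    exact (chart_coords hf q).symm
  suffices H : ∃ F : Finset (EuclideanSpace ℝ (Fin 2)), (∀ p ∈ F, p ∈ frontier S) ∧
      (F : Set (EuclideanSpace ℝ (Fin 2))).PairwiseDisjoint Γ ∧
      ∀ q ∈ frontier S, ∃ p ∈ F, ¬ Disjoint (Γ p) (Γ q) by
    obtain ⟨F, hF, hdisj, hmax⟩ := H
    refine ⟨F, τ, ν, h, L, fun p hp => ⟨(hg p (hF p hp)).1, fun x hx =>
      ⟨(hg p (hF p hp)).2.2.2 x hx, hslopeL p (hF p hp) x hx⟩⟩, hcard F hF hdisj, fun q hq => ?_⟩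
    obtain ⟨p, hp, hpq⟩ := hmax q hq
    exact ⟨p, hp, hcover p (hF p hp) q hq hpq⟩
  by_contra hno
  push Not at hno
  have hbuild : ∀ m : ℕ, ∃ F : Finset (EuclideanSpace ℝ (Fin 2)), (∀ p ∈ F, p ∈ frontier S) ∧
      (F : Set (EuclideanSpace ℝ (Fin 2))).PairwiseDisjoint Γ ∧ F.card = m := by
    classical
    intro m
    induction m with
    | zero => exact ⟨∅, by simp, by simp, rfl⟩
    | succ m ih =>
      obtain ⟨F, hF, hdisj, hm⟩ := ih
      obtain ⟨q, hq, hqd⟩ := hno F hF hdisj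
      have hqF : q ∉ F := by
        intro hqF
        have h0 : (0 : ℝ) ∈ Icc (-ℓ) ℓ := ⟨by linarith, hℓ0.le⟩
        have hmem : chart q (τ q) (ν q) (0, h q 0) ∈ Γ q := ⟨0, h0, rfl⟩
        exact Set.disjoint_left.1 (hqd q hqF) hmem hmem
      refine ⟨insert q F, ?_, ?_, by rw [Finset.card_insert_of_notMem hqF, hm]⟩
      · intro p hp
        rcases Finset.mem_insert.1 hp with rfl | hp
        · exact hq
        · exact hF p hp
      · rw [Finset.coe_insert]
        exact hdisj.insert fun p hp _ => (hqd p hp).symm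
  obtain ⟨m, hm⟩ := exists_nat_gt (k * R / (14 / 25))
  obtain ⟨F, hF, hdisj, hFm⟩ := hbuild m
  have := hcard F hF hdisj
  rw [div_lt_iff₀ (by norm_num), ← hFm] at hm
  linarith

end Arcs

/-! ### The uniform direction, and a telescoping estimate -/

section Directions

theorem IsFrame.measurePreserving_inner {τ ν : EuclideanSpace ℝ (Fin 2)} (hf : IsFrame τ ν) :
    MeasurePreserving (fun x : EuclideanSpace ℝ (Fin 2) => ((inner ℝ τ x : ℝ), (inner ℝ ν x : ℝ)))
      volume volume := by
  have hon : Orthonormal ℝ ![τ, ν] := by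
    constructor
    · intro i; fin_cases i
      · exact hf.norm_left
      · exact hf.norm_right
    · intro i j hij
      fin_cases i <;> fin_cases j
      · exact absurd rfl hij
      · exact hf.inner_eq
      · exact hf.symm.inner_eq
      · exact absurd rfl hij
  have hspan : ⊤ ≤ Submodule.span ℝ (range ![τ, ν]) := by
    have hr : range ![τ, ν] = {τ, ν} := by
      rw [Matrix.range_cons, Matrix.range_cons, Matrix.range_empty, union_empty]; rfl
    rw [hr]
    exact (Submodule.eq_top_of_finrank_eq (by
      rw [hf.finrank_span, finrank_euclideanSpace_fin])).ge
  have h1 := (OrthonormalBasis.mk hon hspan).measurePreserving_repr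
  have h2 := (PiLp.volume_preserving_ofLp (Fin 2)).comp h1
  have h3 := (volume_preserving_finTwoArrow ℝ).comp h2
  convert h3 using 1
  funext x
  simp [MeasurableEquiv.finTwoArrow, OrthonormalBasis.repr_apply_apply]

open scoped Pointwise in
/-- The uniform measure of the directions whose slope, in a given frame, is in a given interval. -/
theorem uniformDirection_cone_le {τ ν : EuclideanSpace ℝ (Fin 2)} (hf : IsFrame τ ν) {a b : ℝ}
    (hab : a ≤ b) :
    uniformDirection 2 {θ | 0 < (inner ℝ τ (θ : EuclideanSpace ℝ (Fin 2)) : ℝ) ∧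
      (inner ℝ ν (θ : EuclideanSpace ℝ (Fin 2)) : ℝ) ∈
        Icc (a * inner ℝ τ (θ : EuclideanSpace ℝ (Fin 2)))
          (b * inner ℝ τ (θ : EuclideanSpace ℝ (Fin 2)))} ≤
      ENNReal.ofReal ((b - a) / (2 * Real.pi)) := by
  set A : Set (Metric.sphere (0 : EuclideanSpace ℝ (Fin 2)) 1) :=
    {θ | 0 < (inner ℝ τ (θ : EuclideanSpace ℝ (Fin 2)) : ℝ) ∧
      (inner ℝ ν (θ : EuclideanSpace ℝ (Fin 2)) : ℝ) ∈
        Icc (a * inner ℝ τ (θ : EuclideanSpace ℝ (Fin 2)))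
          (b * inner ℝ τ (θ : EuclideanSpace ℝ (Fin 2)))} with hA
  have hAm : MeasurableSet A := by
    have h1 : Continuous fun θ : Metric.sphere (0 : EuclideanSpace ℝ (Fin 2)) 1 =>
      (inner ℝ τ (θ : EuclideanSpace ℝ (Fin 2)) : ℝ) := by fun_prop
    have h2 : Continuous fun θ : Metric.sphere (0 : EuclideanSpace ℝ (Fin 2)) 1 =>
      (inner ℝ ν (θ : EuclideanSpace ℝ (Fin 2)) : ℝ) := by fun_prop
    exact (measurableSet_lt measurable_const h1.measurable).inter
      ((measurableSet_le (h1.measurable.const_mul a) h2.measurable).inter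
        (measurableSet_le h2.measurable (h1.measurable.const_mul b)))
  set W : Set (ℝ × ℝ) := {z | z.1 ∈ Ioo (0 : ℝ) 1 ∧ z.2 ∈ Icc (a * z.1) (b * z.1)} with hW
  have hWm : MeasurableSet W := by
    have h1 : Measurable fun z : ℝ × ℝ => z.1 := measurable_fst
    exact (h1 measurableSet_Ioo).inter
      ((measurableSet_le (h1.const_mul a) measurable_snd).inter
        (measurableSet_le measurable_snd (h1.const_mul b)))
  have hWvol : volume W = ENNReal.ofReal ((b - a) / 2) := by
    have h1 : volume W = ∫⁻ x in Ioo (0 : ℝ) 1, ENNReal.ofReal ((b - a) * x) := by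
      rw [Measure.volume_eq_prod, Measure.prod_apply hWm, ← lintegral_indicator measurableSet_Ioo]
      refine lintegral_congr fun x => ?_
      by_cases hx : x ∈ Ioo (0 : ℝ) 1
      · rw [indicator_of_mem hx]
        have : Prod.mk x ⁻¹' W = Icc (a * x) (b * x) := by
          ext y
          exact and_iff_right hx
        rw [this, Real.volume_Icc, sub_mul]
      · rw [indicator_of_notMem hx]
        have : Prod.mk x ⁻¹' W = ∅ := by
          ext y
          exact iff_of_false (fun h => hx h.1) (notMem_empty _)
        rw [this, measure_empty]
    rw [h1, ← ofReal_integral_eq_lintegral_ofReal]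
    · congr 1
      rw [← integral_Ioc_eq_integral_Ioo, ← intervalIntegral.integral_of_le zero_le_one,
        intervalIntegral.integral_const_mul, integral_id]
      ring
    · have : Continuous fun x : ℝ => (b - a) * x := by fun_prop
      exact (this.integrableOn_Icc).mono_set Ioo_subset_Icc_self
    · refine (ae_restrict_iff' measurableSet_Ioo).2 (Eventually.of_forall fun x hx => ?_)
      exact mul_nonneg (sub_nonneg.2 hab) hx.1.le
  have hsub : Ioo (0 : ℝ) 1 • ((↑) '' A : Set (EuclideanSpace ℝ (Fin 2))) ⊆
      (fun x : EuclideanSpace ℝ (Fin 2) => ((inner ℝ τ x : ℝ), (inner ℝ ν x : ℝ))) ⁻¹' W := by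
    rintro _ ⟨r, hr, _, ⟨θ, ⟨h1, h2, h3⟩, rfl⟩, rfl⟩
    have h4 : (inner ℝ τ (θ : EuclideanSpace ℝ (Fin 2)) : ℝ) ≤ 1 := by
      have := real_inner_le_norm τ (θ : EuclideanSpace ℝ (Fin 2))
      rwa [hf.norm_left, norm_eq_of_mem_sphere, one_mul] at this
    simp only [mem_preimage, hW, mem_ofPred_eq, inner_smul_right, mem_Ioo, mem_Icc]
    have hr0 := hr.1
    have hr1 := hr.2
    refine ⟨⟨by positivity, by nlinarith⟩, ?_, ?_⟩ <;> nlinarith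
  have hvol : volume (Ioo (0 : ℝ) 1 • ((↑) '' A : Set (EuclideanSpace ℝ (Fin 2)))) ≤
      ENNReal.ofReal ((b - a) / 2) := by
    rw [← hWvol, ← hf.measurePreserving_inner.measure_preimage hWm.nullMeasurableSet]
    exact measure_mono hsub
  have hdim : Module.finrank ℝ (EuclideanSpace ℝ (Fin 2)) = 2 := finrank_euclideanSpace_fin
  rw [uniformDirection, ProbabilityTheory.cond_apply MeasurableSet.univ, univ_inter,
    Measure.toSphere_apply' _ hAm, Measure.toSphere_apply_univ, hdim,
    EuclideanSpace.volume_ball_fin_two]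
  have hpi := Real.pi_pos
  calc _ ≤ ((2 : ℕ) * (ENNReal.ofReal 1 ^ 2 * ENNReal.ofReal Real.pi))⁻¹ *
        ((2 : ℕ) * ENNReal.ofReal ((b - a) / 2)) := by gcongr
    _ = ENNReal.ofReal ((b - a) / (2 * Real.pi)) := by
      have e1 : ((2 : ℕ) * (ENNReal.ofReal 1 ^ 2 * ENNReal.ofReal Real.pi) : ℝ≥0∞) =
          ENNReal.ofReal (2 * Real.pi) := by
        rw [ENNReal.ofReal_mul (by norm_num), ENNReal.ofReal_one, one_pow, one_mul]
        simp
      have e2 : ((2 : ℕ) * ENNReal.ofReal ((b - a) / 2) : ℝ≥0∞) = ENNReal.ofReal (b - a) := by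
        have : ((2 : ℕ) : ℝ≥0∞) = ENNReal.ofReal 2 := by simp
        rw [this, ← ENNReal.ofReal_mul (by norm_num)]
        congr 1; ring
      rw [e1, e2, ← ENNReal.ofReal_inv_of_pos (by positivity), ← ENNReal.ofReal_mul (by positivity)]
      congr 1
      field_simp

/-- A telescoping estimate. Suppose that the interval `[d θ, b θ)` is attached to each `θ ∈ Θ`, and
that a subset of `Θ` whose intervals pairwise overlap has measure at most `c` divided by the
supremum of `d`. Then the integral of `1 - d / b` over `Θ` is at most `c / d₀`, where `d₀` is a
lower bound of `d`: indeed `1 - d / b` is the integral of `d / r²` over `[d, b)`, and for fixed `r`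
the integral of `d` over the set of `θ` with `r ∈ [d, b)` is at most `c`. To avoid measurability
questions the integral over `r` is replaced by a Riemann sum, whence the error `η`. -/
theorem exists_telescoping_majorant {X : Type*} [MeasurableSpace X] (σ : Measure X)
    [IsFiniteMeasure σ] {Θ : Set X} {d b : X → ℝ} {d₀ B c : ℝ} (hd₀ : 0 < d₀) (hc : 0 ≤ c)
    (hd : ∀ θ ∈ Θ, d₀ ≤ d θ) (hdb : ∀ θ ∈ Θ, d θ < b θ) (hB : ∀ θ ∈ Θ, b θ ≤ B)
    (hσ : ∀ A ⊆ Θ, A.Nonempty → (∀ θ ∈ A, ∀ θ' ∈ A, d θ ≤ d θ' → d θ' < b θ) →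
      BddAbove (d '' A) → σ A ≤ ENNReal.ofReal (c / sSup (d '' A))) {η : ℝ} (hη : 0 < η) :
    ∃ G : X → ℝ≥0∞, Measurable G ∧ (∀ θ ∈ Θ, ENNReal.ofReal (1 - d θ / b θ) ≤ G θ) ∧
      ∫⁻ θ, G θ ∂σ ≤ ENNReal.ofReal (c / d₀ + η) := by
  obtain ⟨s, hs, hsη⟩ : ∃ s : ℝ, 0 < s ∧ s / d₀ * σ.real univ ≤ η := by
    refine ⟨η * d₀ / (σ.real univ + 1), by positivity, ?_⟩
    have h1 : 0 ≤ σ.real univ := measureReal_nonneg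
    rw [div_right_comm, mul_div_cancel_right₀ _ hd₀.ne', div_mul_eq_mul_div,
      div_le_iff₀ (by positivity)]
    nlinarith
  set r : ℕ → ℝ := fun j => d₀ + j * s with hr
  have hrpos : ∀ j, 0 < r j := fun j => by positivity
  have hr0 : r 0 = d₀ := by simp [hr]
  have hrs : ∀ j, r (j + 1) = r j + s := fun j => by simp only [hr]; push_cast; ring
  set δ : ℕ → ℝ := fun j => 1 / r j - 1 / r (j + 1) with hδ
  have hδ0 : ∀ j, 0 ≤ δ j := fun j => by
    refine sub_nonneg.2 (one_div_le_one_div_of_le (hrpos j) ?_)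
    rw [hrs]; linarith
  set A : ℕ → Set X := fun j => {θ | θ ∈ Θ ∧ d θ ≤ r j ∧ r j < b θ} with hA
  have hbdd : ∀ j, BddAbove (d '' A j) := fun j => ⟨r j, by
    rintro _ ⟨θ, hθ, rfl⟩; exact hθ.2.1⟩
  set D : ℕ → ℝ := fun j => sSup (d '' A j) with hD
  have hD0 : ∀ j, 0 ≤ D j := fun j => Real.sSup_nonneg (by
    rintro _ ⟨θ, hθ, rfl⟩; exact hd₀.le.trans (hd θ hθ.1))
  set J := ⌈(B - d₀) / s⌉₊ with hJ
  set G : X → ℝ≥0∞ := fun θ => ENNReal.ofReal (s / d₀) + ∑ j ∈ Finset.range J,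
    (toMeasurable σ (A j)).indicator (fun _ => ENNReal.ofReal (D j * δ j)) θ with hG
  have hmeas : ∀ j, Measurable
      ((toMeasurable σ (A j)).indicator fun _ => ENNReal.ofReal (D j * δ j)) := fun j =>
    measurable_const.indicator (measurableSet_toMeasurable σ (A j))
  refine ⟨G, measurable_const.add (Finset.measurable_fun_sum _ fun j _ => hmeas j), ?_, ?_⟩
  · intro θ hθ
    set i := ⌈(d θ - d₀) / s⌉₊ with hi
    set m := ⌈(b θ - d₀) / s⌉₊ with hm
    have hdpos : 0 < d θ := hd₀.trans_le (hd θ hθ)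
    have hbpos : 0 < b θ := hdpos.trans (hdb θ hθ)
    have him : i ≤ m := Nat.ceil_mono (by gcongr; exact (hdb θ hθ).le)
    have hmJ : m ≤ J := Nat.ceil_mono (by gcongr; exact hB θ hθ)
    have hri : d θ ≤ r i := by
      have := (div_le_iff₀ hs).1 (Nat.le_ceil ((d θ - d₀) / s))
      simp only [hr]; linarith
    have hri' : r i ≤ d θ + s := by
      have h1 := Nat.ceil_lt_add_one (div_nonneg (sub_nonneg.2 (hd θ hθ)) hs.le)
      have h2 : (i : ℝ) * s ≤ ((d θ - d₀) / s + 1) * s := mul_le_mul_of_nonneg_right h1.le hs.le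
      rw [add_mul, div_mul_cancel₀ _ hs.ne'] at h2
      simp only [hr]; linarith
    have hrm : b θ ≤ r m := by
      have := (div_le_iff₀ hs).1 (Nat.le_ceil ((b θ - d₀) / s))
      simp only [hr]; linarith
    have hmem : ∀ j ∈ Finset.Ico i m, θ ∈ A j := by
      intro j hj
      rw [Finset.mem_Ico] at hj
      refine ⟨hθ, hri.trans ?_, ?_⟩
      · have : (i : ℝ) ≤ j := by exact_mod_cast hj.1
        simp only [hr]; nlinarith
      · have := (lt_div_iff₀ hs).1 (Nat.lt_ceil.1 hj.2)
        simp only [hr]; linarith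
    have htel : ∑ j ∈ Finset.Ico i m, δ j = 1 / r i - 1 / r m := by
      have := Finset.sum_Ico_sub (fun j => -(1 / r j)) him
      rw [show 1 / r i - 1 / r m = -(1 / r m) - -(1 / r i) by ring, ← this]
      exact Finset.sum_congr rfl fun j _ => by simp only [hδ]; ring
    calc ENNReal.ofReal (1 - d θ / b θ)
        ≤ ENNReal.ofReal (s / d₀ + ∑ j ∈ Finset.Ico i m, D j * δ j) := by
          refine ENNReal.ofReal_le_ofReal ?_
          have h1 : d θ * (1 / r i - 1 / r m) ≤ ∑ j ∈ Finset.Ico i m, D j * δ j := by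
            rw [← htel, Finset.mul_sum]
            refine Finset.sum_le_sum fun j hj => mul_le_mul_of_nonneg_right ?_ (hδ0 j)
            exact le_csSup (hbdd j) ⟨θ, hmem j hj, rfl⟩
          have h2 : 1 / (d θ + s) ≤ 1 / r i := one_div_le_one_div_of_le (hrpos i) hri'
          have h3 : 1 / r m ≤ 1 / b θ := one_div_le_one_div_of_le hbpos hrm
          have h4 : d θ * (1 / (d θ + s) - 1 / b θ) ≤ d θ * (1 / r i - 1 / r m) :=
            mul_le_mul_of_nonneg_left (by linarith) hdpos.le
          have h5 : 1 - s / d₀ ≤ d θ * (1 / (d θ + s)) := by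
            have h6 : s / (d θ + s) ≤ s / d₀ := by
              gcongr; linarith [hd θ hθ]
            have h7 : d θ * (1 / (d θ + s)) = 1 - s / (d θ + s) := by field_simp; ring
            linarith
          have h8 : d θ / b θ = d θ * (1 / b θ) := by ring
          linarith
      _ = ENNReal.ofReal (s / d₀) + ∑ j ∈ Finset.Ico i m, ENNReal.ofReal (D j * δ j) := by
          rw [ENNReal.ofReal_add (by positivity)
            (Finset.sum_nonneg fun j _ => mul_nonneg (hD0 j) (hδ0 j)),
            ENNReal.ofReal_sum_of_nonneg fun j _ => mul_nonneg (hD0 j) (hδ0 j)]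
      _ = ENNReal.ofReal (s / d₀) + ∑ j ∈ Finset.Ico i m,
          (toMeasurable σ (A j)).indicator (fun _ => ENNReal.ofReal (D j * δ j)) θ := by
          congr 1
          refine Finset.sum_congr rfl fun j hj => ?_
          rw [indicator_of_mem (subset_toMeasurable σ _ (hmem j hj))]
      _ ≤ G θ := by
          simp only [hG]
          gcongr
          intro j hj
          rw [Finset.mem_Ico] at hj
          exact Finset.mem_range.2 (hj.2.trans_le hmJ)
  · have hterm : ∀ j, ∫⁻ θ, (toMeasurable σ (A j)).indicator
        (fun _ => ENNReal.ofReal (D j * δ j)) θ ∂σ ≤ ENNReal.ofReal (c * δ j) := by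
      intro j
      rw [lintegral_indicator_const (measurableSet_toMeasurable σ (A j)), measure_toMeasurable]
      rcases (A j).eq_empty_or_nonempty with h | h
      · rw [h, measure_empty, mul_zero]; exact zero_le
      · have h1 := hσ (A j) (fun θ hθ => hθ.1) h
          (fun θ hθ θ' hθ' _ => hθ'.2.1.trans_lt hθ.2.2) (hbdd j)
        have hDpos : 0 < D j := by
          obtain ⟨θ, hθ⟩ := h
          exact hd₀.trans_le ((hd θ hθ.1).trans (le_csSup (hbdd j) ⟨θ, hθ, rfl⟩))
        calc ENNReal.ofReal (D j * δ j) * σ (A j)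
            ≤ ENNReal.ofReal (D j * δ j) * ENNReal.ofReal (c / D j) := by gcongr
          _ = ENNReal.ofReal (c * δ j) := by
            rw [← ENNReal.ofReal_mul (mul_nonneg (hD0 j) (hδ0 j))]
            congr 1; field_simp
    simp only [hG]
    rw [lintegral_add_left measurable_const, lintegral_const,
      lintegral_finsetSum _ fun j _ => hmeas j]
    have hsum : ∑ j ∈ Finset.range J, δ j ≤ 1 / d₀ := by
      have h1 : ∑ j ∈ Finset.range J, δ j = 1 / r 0 - 1 / r J :=
        Finset.sum_range_sub' (fun j => 1 / r j) J
      rw [h1, hr0]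
      have := one_div_pos.2 (hrpos J)
      linarith
    calc ENNReal.ofReal (s / d₀) * σ univ + ∑ j ∈ Finset.range J, ∫⁻ θ,
          (toMeasurable σ (A j)).indicator (fun _ => ENNReal.ofReal (D j * δ j)) θ ∂σ
        ≤ ENNReal.ofReal η + ∑ j ∈ Finset.range J, ENNReal.ofReal (c * δ j) := by
          refine add_le_add ?_ (Finset.sum_le_sum fun j _ => hterm j)
          rw [← ofReal_measureReal (μ := σ) (s := univ), ← ENNReal.ofReal_mul (by positivity)]
          exact ENNReal.ofReal_le_ofReal hsη
      _ = ENNReal.ofReal (η + c * ∑ j ∈ Finset.range J, δ j) := by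
          rw [ENNReal.ofReal_add hη.le (mul_nonneg hc (Finset.sum_nonneg fun j _ => hδ0 j)),
            Finset.mul_sum,
            ENNReal.ofReal_sum_of_nonneg fun j _ => mul_nonneg hc (hδ0 j)]
      _ ≤ ENNReal.ofReal (c / d₀ + η) := by
          refine ENNReal.ofReal_le_ofReal ?_
          have := mul_le_mul_of_nonneg_left hsum hc
          rw [mul_one_div] at this
          linarith

end Directions

/-! ### Lines of sight that touch a flat graph -/

/-- Over `[-L, L]`, in the coordinates of `chart p τ ν`, the boundary of `S` contains the graph of
`h`, below which `S` lies locally, and the slope of the graph is at most `3 / 4`. -/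
structure IsFlatGraph {n : ℕ} (S : Set (EuclideanSpace ℝ (Fin n)))
    (p τ ν : EuclideanSpace ℝ (Fin n)) (h : ℝ → ℝ) (L : ℝ) : Prop where
  isFrame : IsFrame τ ν
  isHypographAt : ∀ x ∈ Icc (-L) L, IsHypographAt S p τ ν h x
  abs_deriv_le : ∀ x ∈ Icc (-L) L, |deriv h x| ≤ 3 / 4

/-- As far as the parameter `t`, the ray from `u` in direction `ω` is visible from `v`, but the line
of sight from `v` to `u + t ω` touches the graph of `h`, to the right of `v`, at the point of
abscissa `ξ`. -/
structure IsContact {n : ℕ} (S : Set (EuclideanSpace ℝ (Fin n)))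
    (p τ ν : EuclideanSpace ℝ (Fin n)) (h : ℝ → ℝ) (L : ℝ) (u v ω : EuclideanSpace ℝ (Fin n))
    (t ξ : ℝ) : Prop where
  pos : 0 < t
  segment_subset : ∀ r ∈ Icc 0 t, segment ℝ v (u + r • ω) ⊆ S
  mem_Ioo : ξ ∈ Ioo (-L) L
  mem_openSegment : chart p τ ν (ξ, h ξ) ∈ openSegment ℝ v (u + t • ω)
  lt_abscissa : (coords p τ ν v).1 < ξ

section Contact

variable {S : Set (EuclideanSpace ℝ (Fin 2))} {p τ ν u v ω : EuclideanSpace ℝ (Fin 2)}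
  {h : ℝ → ℝ} {L t ξ : ℝ}

theorem IsHypographAt.neg_left (hx : IsHypographAt S p τ ν h ξ) :
    IsHypographAt S p (-τ) ν (fun y => h (-y)) (-ξ) := by
  have h1 : ContDiffAt ℝ 2 h (- -ξ) := by rw [neg_neg]; exact hx.1
  refine ⟨ContDiffAt.comp (-ξ) h1 contDiff_neg.contDiffAt, ?_⟩
  have h2 : ContinuousAt (fun z : ℝ × ℝ => (-z.1, z.2)) (-ξ, h (- -ξ)) := by fun_prop
  have h3 := h2.eventually (p := fun z => (chart p τ ν z ∈ S ↔ z.2 ≤ h z.1))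
    (by simpa using hx.2)
  refine h3.mono fun z hz => ?_
  rw [← hz]
  simp [chart]

theorem IsFlatGraph.neg_left (hG : IsFlatGraph S p τ ν h L) :
    IsFlatGraph S p (-τ) ν (fun y => h (-y)) L := by
  have hm : ∀ x ∈ Icc (-L) L, -x ∈ Icc (-L) L := fun x hx =>
    ⟨by linarith [hx.2], by linarith [hx.1]⟩
  refine ⟨hG.isFrame.neg_left, fun x hx => ?_, fun x hx => ?_⟩
  · have := (hG.isHypographAt (-x) (hm x hx)).neg_left
    rwa [neg_neg] at this
  · rw [deriv_comp_neg, abs_neg]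
    exact hG.abs_deriv_le _ (hm x hx)

theorem coords_add_smul (s : ℝ) : coords p τ ν (u + s • ω) =
    ((coords p τ ν u).1 + s * inner ℝ τ ω, (coords p τ ν u).2 + s * inner ℝ ν ω) := by
  simp only [coords]
  rw [show u + s • ω - p = (u - p) + s • ω by abel, inner_add_right, inner_add_right,
    inner_smul_right, inner_smul_right]

theorem chart_add_smul (hf : IsFrame τ ν) (z : ℝ × ℝ) (s : ℝ) :
    chart p τ ν (z.1 + s * inner ℝ τ ω, z.2 + s * inner ℝ ν ω) = chart p τ ν z + s • ω := by
  rw [← chart_coords (p := p) hf (chart p τ ν z + s • ω), coords_add_smul, coords_chart hf]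

/-- A ray that starts on the graph and runs in `S` is not above the tangent. -/
theorem IsHypographAt.le_deriv_mul {α β : ℝ} (hx : IsHypographAt S p τ ν h ξ)
    (hr : ∀ᶠ s : ℝ in 𝓝[>] 0, chart p τ ν (ξ + s * α, h ξ + s * β) ∈ S) :
    β ≤ deriv h ξ * α := by
  have h1 : HasDerivAt (fun s : ℝ => ξ + s * α) α 0 := by
    simpa using ((hasDerivAt_id (0 : ℝ)).mul_const α).const_add ξ
  have h2 : HasDerivAt h (deriv h ξ) (ξ + 0 * α) := by
    rw [zero_mul, add_zero]; exact (hx.1.differentiableAt (by norm_num)).hasDerivAt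
  have h3 : HasDerivAt (fun s : ℝ => h (ξ + s * α)) (deriv h ξ * α) 0 := h2.comp 0 h1
  have h4 := h3.tendsto_slope_zero_right
  refine ge_of_tendsto h4 ?_
  have h5 : ContinuousAt (fun s : ℝ => (ξ + s * α, h ξ + s * β)) 0 := by fun_prop
  have h6 := (h5.eventually (p := fun z => (chart p τ ν z ∈ S ↔ z.2 ≤ h z.1))
    (by simpa using hx.2)).filter_mono (nhdsWithin_le_nhds (s := Ioi 0))
  filter_upwards [h6, hr, self_mem_nhdsWithin] with s h7 h8 h9
  have h10 : 0 < s := h9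
  have := h7.1 h8
  rw [zero_add, zero_mul, add_zero, smul_eq_mul, inv_mul_eq_div, le_div_iff₀ h10]
  linarith

/-- A curve in `S` that starts below the graph stays below it. -/
theorem IsHypographAt.le_of_isPreconnected {s : Set ℝ} (hs : IsPreconnected s)
    (hh : ∀ x ∈ s, IsHypographAt S p τ ν h x) {g : ℝ → ℝ} (hg : Continuous g)
    (hgS : ∀ x ∈ s, chart p τ ν (x, g x) ∈ S) {x₀ x₁ : ℝ} (hx₀ : x₀ ∈ s) (h0 : g x₀ ≤ h x₀)
    (hx₁ : x₁ ∈ s) : g x₁ ≤ h x₁ := by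
  by_contra h1
  rw [not_le] at h1
  have hle : ∀ x ∈ s, g x ≤ h x → ∀ᶠ y in 𝓝 x, y ∈ s → g y ≤ h y := by
    intro x hx hgx
    rcases hgx.eq_or_lt with he | hlt
    · have h2 : Tendsto (fun y => (y, g y)) (𝓝 x) (𝓝 (x, h x)) := by
        rw [← he]; exact (continuous_id.prodMk hg).tendsto x
      filter_upwards [h2.eventually (hh x hx).2] with y hy hys
      exact hy.1 (hgS y hys)
    · filter_upwards [hg.continuousAt.eventually_lt (hh x hx).1.continuousAt hlt] with y hy _
        using hy.le
  have hlt : ∀ x ∈ s, h x < g x → ∀ᶠ y in 𝓝 x, y ∈ s → h y < g y := by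
    intro x hx hgx
    filter_upwards [(hh x hx).1.continuousAt.eventually_lt hg.continuousAt hgx] with y hy _
      using hy
  obtain ⟨x, hx, hxU, hxV⟩ := hs {x | ∀ᶠ y in 𝓝 x, y ∈ s → g y ≤ h y}
    {x | ∀ᶠ y in 𝓝 x, y ∈ s → h y < g y} isOpen_setOfPred_eventually_nhds
    isOpen_setOfPred_eventually_nhds
    (fun x hx => (le_or_gt (g x) (h x)).imp (hle x hx) (hlt x hx))
    ⟨x₀, hx₀, hle x₀ hx₀ h0⟩ ⟨x₁, hx₁, hlt x₁ hx₁ h1⟩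
  exact (hxV.self_of_nhds hx).not_ge (hxU.self_of_nhds hx)

/-- A segment in `S` that contains a point of the graph in its interior is tangent to the graph. -/
theorem IsHypographAt.sub_eq_of_mem_openSegment {x : EuclideanSpace ℝ (Fin 2)}
    (hf : IsFrame τ ν) (hξ : IsHypographAt S p τ ν h ξ) (hvx : segment ℝ v x ⊆ S)
    (hmem : chart p τ ν (ξ, h ξ) ∈ openSegment ℝ v x) :
    h ξ - (coords p τ ν v).2 = deriv h ξ * (ξ - (coords p τ ν v).1) := by
  have h3 := eventually_add_smul_mem_of_mem_openSegment hvx hmem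
  have h4 : Tendsto (fun s : ℝ => -s) (𝓝 0) (𝓝 0) := by
    simpa using (continuous_neg (G := ℝ)).tendsto 0
  have h5 := hξ.le_deriv_mul (α := inner ℝ τ (x - v)) (β := inner ℝ ν (x - v))
    ((h3.filter_mono nhdsWithin_le_nhds).mono fun s hs => by
      rw [← chart_add_smul hf] at hs; exact hs)
  have h6 := hξ.le_deriv_mul (α := -inner ℝ τ (x - v)) (β := -inner ℝ ν (x - v))
    (((h4.eventually h3).filter_mono nhdsWithin_le_nhds).mono fun s hs => by
      rw [← chart_add_smul hf] at hs
      simpa using hs)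
  have h7 : inner ℝ ν (x - v) = deriv h ξ * inner ℝ τ (x - v) := by linarith
  rw [openSegment_eq_image'] at hmem
  obtain ⟨c, -, he⟩ := hmem
  have h8 := congrArg (coords p τ ν) he
  rw [coords_chart hf] at h8
  simp only [coords_add_smul] at h8
  have h1 := congrArg Prod.fst h8
  have h2 := congrArg Prod.snd h8
  simp only at h1 h2
  rw [h7] at h2
  linear_combination deriv h ξ * h1 - h2

theorem IsFlatGraph.isHypographAt_of_contact (hG : IsFlatGraph S p τ ν h L)
    (hc : IsContact S p τ ν h L u v ω t ξ) : IsHypographAt S p τ ν h ξ :=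
  hG.isHypographAt ξ (Ioo_subset_Icc_self hc.mem_Ioo)

theorem IsContact.exists_ratio (hG : IsFlatGraph S p τ ν h L)
    (hc : IsContact S p τ ν h L u v ω t ξ) :
    ∃ c ∈ Ioo (0 : ℝ) 1, chart p τ ν (ξ, h ξ) = v + c • (u + t • ω - v) ∧
      ξ = (coords p τ ν v).1 + c * inner ℝ τ (u + t • ω - v) ∧
      h ξ = (coords p τ ν v).2 + c * inner ℝ ν (u + t • ω - v) := by
  have h1 := hc.mem_openSegment
  rw [openSegment_eq_image'] at h1
  obtain ⟨c, hc01, he⟩ := h1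
  have h2 := congrArg (coords p τ ν) he
  rw [coords_chart hG.isFrame] at h2
  simp only [coords_add_smul] at h2
  exact ⟨c, hc01, he.symm, (congrArg Prod.fst h2).symm, (congrArg Prod.snd h2).symm⟩

theorem IsContact.tangent (hG : IsFlatGraph S p τ ν h L)
    (hc : IsContact S p τ ν h L u v ω t ξ) :
    h ξ - (coords p τ ν v).2 = deriv h ξ * (ξ - (coords p τ ν v).1) :=
  (hG.isHypographAt_of_contact hc).sub_eq_of_mem_openSegment hG.isFrame
    (hc.segment_subset t ⟨hc.pos.le, le_rfl⟩) hc.mem_openSegment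

/-- The chord is at least as steep as the line of sight: the lines of sight to the points of the chord
just before the contact are in `S`, so they pass the point of contact from below. -/
theorem IsContact.deriv_mul_le (hG : IsFlatGraph S p τ ν h L)
    (hc : IsContact S p τ ν h L u v ω t ξ) : deriv h ξ * inner ℝ τ ω ≤ inner ℝ ν ω := by
  obtain ⟨c, hc01, he, -, -⟩ := hc.exists_ratio hG
  have hx := hG.isHypographAt_of_contact hc
  have h1 := hx.le_deriv_mul (α := -inner ℝ τ ω) (β := -inner ℝ ν ω) ?_
  · linarith
  have h2 : ∀ᶠ s : ℝ in 𝓝[>] 0, s < c * t :=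
    (eventually_lt_nhds (mul_pos hc01.1 hc.pos)).filter_mono nhdsWithin_le_nhds
  filter_upwards [h2, self_mem_nhdsWithin] with s hs hs0
  have hs0' : 0 < s := hs0
  have h3 : chart p τ ν (ξ, h ξ) + (-s) • ω = v + c • (u + (t - s / c) • ω - v) := by
    have e : s = c * (s / c) := by field_simp [hc01.1.ne']
    rw [he]
    conv_lhs => rw [e]
    module
  have h4 := chart_add_smul (p := p) (ω := ω) hG.isFrame (ξ, h ξ) (-s)
  have h5 : s / c ≤ t := by rw [div_le_iff₀ hc01.1]; linarith
  have h6 : 0 < s / c := div_pos hs0' hc01.1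
  rw [mul_neg, mul_neg, ← neg_mul, ← neg_mul]
  rw [h4, h3]
  exact hc.segment_subset (t - s / c) ⟨by linarith, by linarith⟩
    (mem_segment_of_mem_Icc (Ioo_subset_Icc_self hc01))

/-- The point of contact is strictly between `v` and the chord. -/
theorem IsContact.sub_lt_mul (hG : IsFlatGraph S p τ ν h L)
    (hc : IsContact S p τ ν h L u v ω t ξ) :
    ξ - (coords p τ ν u).1 < t * inner ℝ τ ω := by
  obtain ⟨c, hc01, -, h1, -⟩ := hc.exists_ratio hG
  have h2 : inner ℝ τ (u + t • ω - v) =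
      (coords p τ ν u).1 - (coords p τ ν v).1 + t * inner ℝ τ ω := by
    simp only [coords]
    rw [← inner_sub_right, ← inner_smul_right, ← inner_add_right]
    congr 1; abel
  have h3 := hc.lt_abscissa
  have h4 : 0 < c * inner ℝ τ (u + t • ω - v) := by linarith
  have h5 : 0 < inner ℝ τ (u + t • ω - v) := pos_of_mul_pos_right h4 hc01.1.le
  have h6 : c * inner ℝ τ (u + t • ω - v) < inner ℝ τ (u + t • ω - v) := by
    nlinarith [hc01.2]
  linarith

theorem IsContact.inner_pos (hG : IsFlatGraph S p τ ν h L)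
    (hc : IsContact S p τ ν h L u v ω t ξ) (hu : (coords p τ ν u).1 < ξ) :
    0 < inner ℝ τ ω :=
  pos_of_mul_pos_right ((sub_pos.2 hu).trans (hc.sub_lt_mul hG)) hc.pos.le

/-- The ray from `u` passes below the point of contact. -/
theorem IsContact.mul_le (hG : IsFlatGraph S p τ ν h L)
    (hc : IsContact S p τ ν h L u v ω t ξ) :
    inner ℝ ν ω * (ξ - (coords p τ ν u).1) ≤ (h ξ - (coords p τ ν u).2) * inner ℝ τ ω := by
  obtain ⟨c, hc01, -, h1, h2⟩ := hc.exists_ratio hG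
  have h3 := hc.tangent hG
  have h4 := hc.deriv_mul_le hG
  have h5 := hc.sub_lt_mul hG
  have hτ : inner ℝ τ (u + t • ω - v) =
      (coords p τ ν u).1 - (coords p τ ν v).1 + t * inner ℝ τ ω := by
    simp only [coords]
    rw [← inner_sub_right, ← inner_smul_right, ← inner_add_right]
    congr 1; abel
  have hν : inner ℝ ν (u + t • ω - v) =
      (coords p τ ν u).2 - (coords p τ ν v).2 + t * inner ℝ ν ω := by
    simp only [coords]
    rw [← inner_sub_right, ← inner_smul_right, ← inner_add_right]
    congr 1; abel
  rw [hτ] at h1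
  rw [hν] at h2
  generalize (coords p τ ν u).1 = u₁ at *
  generalize (coords p τ ν u).2 = u₂ at *
  generalize (coords p τ ν v).1 = v₁ at *
  generalize (coords p τ ν v).2 = v₂ at *
  generalize (inner ℝ τ ω : ℝ) = α at *
  generalize (inner ℝ ν ω : ℝ) = β at *
  generalize deriv h ξ = m at *
  have ht := hc.pos
  -- `u + t ω` is on the tangent
  have h6 : c * (u₂ - v₂ + t * β - m * (u₁ - v₁ + t * α)) = 0 := by
    linear_combination h3 - h2 + m * h1
  have h7 : u₂ - v₂ + t * β - m * (u₁ - v₁ + t * α) = 0 :=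
    (mul_eq_zero.1 h6).resolve_left hc01.1.ne'
  have h8 : h ξ - u₂ - m * (ξ - u₁) = t * (β - m * α) := by
    linear_combination h3 - h7
  have h9 : 0 ≤ (β - m * α) * (t * α - (ξ - u₁)) :=
    mul_nonneg (by linarith) (by linarith)
  linear_combination h9 - α * h8

/-- As the slopes are at most `3 / 4`, a contact at distance `ε` from `v` is to the right of `v` by at
least `ε / √(1 + (3 / 4)²)`. -/
theorem IsContact.le_abscissa_sub (hG : IsFlatGraph S p τ ν h L) (hS : IsClosed S)
    (hc : IsContact S p τ ν h L u v ω t ξ) {ε : ℝ} (hv : Metric.ball v ε ⊆ interior S) :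
    4 / 5 * ε ≤ ξ - (coords p τ ν v).1 := by
  have h1 := (hG.isHypographAt_of_contact hc).mem_frontier hG.isFrame hS
  have h2 : ε ≤ ‖chart p τ ν (ξ, h ξ) - v‖ := by
    by_contra hlt
    rw [not_le, ← mem_ball_iff_norm] at hlt
    exact h1.2 (hv hlt)
  have h3 : ‖chart p τ ν (ξ, h ξ) - v‖ ≤ 5 / 4 * (ξ - (coords p τ ν v).1) := by
    have h4 := hc.lt_abscissa
    refine abs_le_of_sq_le_sq' ?_ (by linarith) |>.2
    rw [← chart_coords (p := p) hG.isFrame v, chart_sub_chart, hG.isFrame.norm_sq,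
      chart_coords hG.isFrame]
    simp only
    rw [hc.tangent hG]
    have h5 := hG.abs_deriv_le ξ (Ioo_subset_Icc_self hc.mem_Ioo)
    have h6 := pow_le_pow_left₀ (abs_nonneg _) h5 2
    rw [sq_abs] at h6
    nlinarith [sq_nonneg (ξ - (coords p τ ν v).1)]
  linarith

/-- The slope of the ray from `u` is at least the slope of the line of sight of every other contact
further to the right that the chord of `u` reaches. -/
theorem IsContact.deriv_mul_le_of_le (hG : IsFlatGraph S p τ ν h L)
    (hc : IsContact S p τ ν h L u v ω t ξ) (hu : (coords p τ ν u).1 < ξ)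
    {ω' : EuclideanSpace ℝ (Fin 2)} {t' ξ' : ℝ}
    (hc' : IsContact S p τ ν h L u v ω' t' ξ') (hξ : ξ ≤ ξ') :
    deriv h ξ' * inner ℝ τ ω ≤ inner ℝ ν ω := by
  have hτ := hc.inner_pos hG hu
  have h0 := hc.lt_abscissa
  have h0' := hc'.lt_abscissa
  have ht := hc.tangent hG
  have ht' := hc'.tangent hG
  set g : ℝ → ℝ := fun x => (coords p τ ν v).2 + deriv h ξ' * (x - (coords p τ ν v).1) with hg
  have hIcc : Icc ξ ξ' ⊆ Icc (-L) L := Icc_subset_Icc hc.mem_Ioo.1.le hc'.mem_Ioo.2.le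
  have h1 : g ξ ≤ h ξ := by
    refine IsHypographAt.le_of_isPreconnected isPreconnected_Icc
      (fun x hx => hG.isHypographAt x (hIcc hx)) (g := g) (by fun_prop) (fun x hx => ?_)
      (right_mem_Icc.2 hξ) (by simp only [hg]; linarith) (left_mem_Icc.2 hξ)
    have h2 : chart p τ ν (x, g x) ∈ segment ℝ v (chart p τ ν (ξ', h ξ')) := by
      have hpos : 0 < ξ' - (coords p τ ν v).1 := by linarith
      have h3 := mem_segment_of_mem_Icc (x := v) (y := chart p τ ν (ξ', h ξ'))
        (c := (x - (coords p τ ν v).1) / (ξ' - (coords p τ ν v).1))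
        ⟨div_nonneg (by linarith [hx.1]) hpos.le,
          div_le_one_of_le₀ (by linarith [hx.2]) hpos.le⟩
      convert h3 using 1
      rw [← chart_coords (p := p) hG.isFrame v, chart_sub_chart, ← chart_add_smul hG.isFrame,
        hG.isFrame.inner_left, hG.isFrame.inner_right, chart_coords hG.isFrame]
      congr 2
      · field_simp
        ring
      · simp only [hg]
        rw [ht']
        field_simp
    exact hc'.segment_subset t' ⟨hc'.pos.le, le_rfl⟩
      ((convex_segment _ _).segment_subset (left_mem_segment _ _ _)
        (openSegment_subset_segment _ _ _ hc'.mem_openSegment) h2)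
  have h2 : deriv h ξ' ≤ deriv h ξ := by
    refine le_of_mul_le_mul_right ?_ (sub_pos.2 h0)
    simp only [hg] at h1
    linarith
  exact (mul_le_mul_of_nonneg_right h2 hτ.le).trans (hc.deriv_mul_le hG)

/-- The ray from `u` passes below the points of contact further to the right that the chord
reaches. -/
theorem IsContact.mul_le_of_le (hG : IsFlatGraph S p τ ν h L)
    (hc : IsContact S p τ ν h L u v ω t ξ) (hu : (coords p τ ν u).1 < ξ) {ℓ ξ' : ℝ}
    (hℓ : segment ℝ u (u + ℓ • ω) ⊆ S) (hL : ξ' ≤ L) (hξ : ξ ≤ ξ')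
    (hξℓ : ξ' - (coords p τ ν u).1 < ℓ * inner ℝ τ ω) :
    inner ℝ ν ω * (ξ' - (coords p τ ν u).1) ≤ (h ξ' - (coords p τ ν u).2) * inner ℝ τ ω := by
  have hτ := hc.inner_pos hG hu
  set g : ℝ → ℝ := fun x =>
    (coords p τ ν u).2 + (x - (coords p τ ν u).1) / inner ℝ τ ω * inner ℝ ν ω with hg
  have hIcc : Icc ξ ξ' ⊆ Icc (-L) L := Icc_subset_Icc hc.mem_Ioo.1.le hL
  have h0 := hc.mul_le hG
  have h1 : g ξ' ≤ h ξ' := by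
    refine IsHypographAt.le_of_isPreconnected isPreconnected_Icc
      (fun x hx => hG.isHypographAt x (hIcc hx)) (g := g) (by fun_prop) (fun x hx => ?_)
      (left_mem_Icc.2 hξ) ?_ (right_mem_Icc.2 hξ)
    · have h3 : chart p τ ν (x, g x) = u + ((x - (coords p τ ν u).1) / inner ℝ τ ω) • ω := by
        have h4 := chart_add_smul (p := p) (ω := ω) hG.isFrame (coords p τ ν u)
          ((x - (coords p τ ν u).1) / inner ℝ τ ω)
        rwa [chart_coords hG.isFrame, div_mul_cancel₀ _ hτ.ne', add_sub_cancel] at h4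
      rw [h3]
      refine add_smul_mem_of_mem_chordParams (Icc_subset_chordParams hℓ ⟨?_, ?_⟩)
      · exact div_nonneg (by linarith [hx.1]) hτ.le
      · rw [div_le_iff₀ hτ]; linarith [hx.2]
    · simp only [hg]
      rw [← le_sub_iff_add_le', div_mul_eq_mul_div, div_le_iff₀ hτ]
      linarith
  simp only [hg] at h1
  rw [← le_sub_iff_add_le', div_mul_eq_mul_div, div_le_iff₀ hτ] at h1
  linarith

end Contact

/-! ### The part of the chord hidden by one graph -/

section Majorant

variable {S : Set (EuclideanSpace ℝ (Fin 2))} {p τ ν u v ω : EuclideanSpace ℝ (Fin 2)}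
  {h : ℝ → ℝ} {L t ξ : ℝ}

theorem IsFrame.smul {s : ℝ} (hf : IsFrame τ ν) (hs : |s| = 1) : IsFrame (s • τ) (s • ν) := by
  refine ⟨?_, ?_, ?_⟩
  · rw [norm_smul, hf.norm_left, Real.norm_eq_abs, hs, one_mul]
  · rw [norm_smul, hf.norm_right, Real.norm_eq_abs, hs, one_mul]
  · rw [real_inner_smul_left, real_inner_smul_right, hf.inner_eq, mul_zero, mul_zero]

/-- The slope of the ray from `u` lies between the slopes of the two lines that join `v` and `u` to
any contact further to the right that the chord of `u` reaches. -/
theorem IsContact.slope_mem_Icc (hG : IsFlatGraph S p τ ν h L)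
    (hc : IsContact S p τ ν h L u v ω t ξ) (hu : (coords p τ ν u).1 < ξ)
    {ω' : EuclideanSpace ℝ (Fin 2)} {t' ξ' ℓ : ℝ}
    (hc' : IsContact S p τ ν h L u v ω' t' ξ') (hξ : ξ ≤ ξ')
    (hℓ : segment ℝ u (u + ℓ • ω) ⊆ S)
    (hξℓ : ξ' - (coords p τ ν u).1 < ℓ * inner ℝ τ ω) :
    (inner ℝ ν ω / inner ℝ τ ω : ℝ) ∈ Icc (deriv h ξ')
      (deriv h ξ' + 5 / 4 * ‖u - v‖ / (ξ' - (coords p τ ν u).1)) := by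
  have hτ := hc.inner_pos hG hu
  have hd : 0 < ξ' - (coords p τ ν u).1 := by linarith
  refine ⟨(le_div_iff₀ hτ).2 (hc.deriv_mul_le_of_le hG hu hc' hξ), ?_⟩
  have h1 := hc.mul_le_of_le hG hu hℓ hc'.mem_Ioo.2.le hξ hξℓ
  have h2 := hc'.tangent hG
  have h3 : ‖u - v‖ ^ 2 = ((coords p τ ν u).1 - (coords p τ ν v).1) ^ 2 +
      ((coords p τ ν u).2 - (coords p τ ν v).2) ^ 2 := by
    conv_lhs => rw [← chart_coords (p := p) hG.isFrame u, ← chart_coords (p := p) hG.isFrame v]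
    rw [chart_sub_chart, hG.isFrame.norm_sq]
  have h4 : (h ξ' - (coords p τ ν u).2) - deriv h ξ' * (ξ' - (coords p τ ν u).1) ≤
      5 / 4 * ‖u - v‖ := by
    have h5 := hG.abs_deriv_le ξ' (Ioo_subset_Icc_self hc'.mem_Ioo)
    have h6 := pow_le_pow_left₀ (abs_nonneg _) h5 2
    rw [sq_abs] at h6
    refine abs_le_of_sq_le_sq' ?_ (by positivity) |>.2
    rw [mul_pow, h3]
    generalize (coords p τ ν u).1 = u₁ at *
    generalize (coords p τ ν u).2 = u₂ at *
    generalize (coords p τ ν v).1 = v₁ at *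
    generalize (coords p τ ν v).2 = v₂ at *
    generalize deriv h ξ' = m at *
    have e : h ξ' - u₂ - m * (ξ' - u₁) = m * (u₁ - v₁) - (u₂ - v₂) := by
      linear_combination h2
    rw [e]
    have h7 : 0 ≤ (25 / 16 - (1 + m ^ 2)) * ((u₁ - v₁) ^ 2 + (u₂ - v₂) ^ 2) :=
      mul_nonneg (by linarith) (by positivity)
    nlinarith [sq_nonneg (u₁ - v₁ + m * (u₂ - v₂))]
  rw [div_le_iff₀ hτ]
  have h5 : inner ℝ ν ω ≤ (h ξ' - (coords p τ ν u).2) * inner ℝ τ ω / (ξ' - (coords p τ ν u).1) :=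
    (le_div_iff₀ hd).2 h1
  refine h5.trans ?_
  rw [div_le_iff₀ hd, mul_right_comm, add_mul, div_mul_cancel₀ _ hd.ne']
  exact mul_le_mul_of_nonneg_right (by linarith) hτ.le

/-- The contribution of one graph: the fraction of the chord that is hidden from `v` by the graph is
bounded by a function `G` of the direction, of small integral. -/
theorem exists_hidden_majorant (hG : IsFlatGraph S p τ ν h L) (hS : IsCompact S) (huS : u ∈ S)
    {ε ε' : ℝ} (hv : Metric.ball v ε ⊆ interior S) (huv : ‖u - v‖ ≤ ε') (hε : ε' < 4 / 5 * ε)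
    {s : ℝ} (hs : |s| = 1) {ℓ : Metric.sphere (0 : EuclideanSpace ℝ (Fin 2)) 1 → ℝ}
    (hℓ : ∀ θ : Metric.sphere (0 : EuclideanSpace ℝ (Fin 2)) 1,
      segment ℝ u (u + ℓ θ • s • (θ : EuclideanSpace ℝ (Fin 2))) ⊆ S) {η : ℝ} (hη : 0 < η) :
    ∃ G : Metric.sphere (0 : EuclideanSpace ℝ (Fin 2)) 1 → ℝ≥0∞, Measurable G ∧
      (∀ θ : Metric.sphere (0 : EuclideanSpace ℝ (Fin 2)) 1, (∃ t ξ, t ≤ ℓ θ ∧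
        IsContact S p τ ν h L u v (s • (θ : EuclideanSpace ℝ (Fin 2))) t ξ) →
        volume {r : ℝ | r ∈ Icc 0 (ℓ θ) ∧
          ¬ segment ℝ v (u + r • s • (θ : EuclideanSpace ℝ (Fin 2))) ⊆ S} ≤
            ENNReal.ofReal (ℓ θ) * G θ) ∧
      ∫⁻ θ, G θ ∂(uniformDirection 2) ≤
        ENNReal.ofReal (5 / 4 * ε' / (2 * Real.pi) / (4 / 5 * ε - ε') + η) := by
  have hfin : IsFiniteMeasure (uniformDirection 2) :=
    ⟨uniformDirection_univ_le_one.trans_lt ENNReal.one_lt_top⟩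
  have hpi := Real.pi_pos
  have hε0 : 0 ≤ ε' := (norm_nonneg _).trans huv
  set u₁ := (coords p τ ν u).1 with hu₁
  set α : Metric.sphere (0 : EuclideanSpace ℝ (Fin 2)) 1 → ℝ := fun θ =>
    inner ℝ τ (s • (θ : EuclideanSpace ℝ (Fin 2))) with hα
  set β : Metric.sphere (0 : EuclideanSpace ℝ (Fin 2)) 1 → ℝ := fun θ =>
    inner ℝ ν (s • (θ : EuclideanSpace ℝ (Fin 2))) with hβ
  set Θ : Set (Metric.sphere (0 : EuclideanSpace ℝ (Fin 2)) 1) := {θ | ∃ t ξ, t ≤ ℓ θ ∧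
    IsContact S p τ ν h L u v (s • (θ : EuclideanSpace ℝ (Fin 2))) t ξ} with hΘ
  have hex : ∀ θ, ∃ t ξ, θ ∈ Θ → t ≤ ℓ θ ∧
      IsContact S p τ ν h L u v (s • (θ : EuclideanSpace ℝ (Fin 2))) t ξ := by
    intro θ
    by_cases hθ : θ ∈ Θ
    · obtain ⟨t, ξ, H⟩ := hθ
      exact ⟨t, ξ, fun _ => H⟩
    · exact ⟨0, 0, fun H => absurd H hθ⟩
  choose t ξ hc using hex
  obtain ⟨D₀, hD₀⟩ := hS.isBounded.exists_norm_le
  have hd : ∀ θ ∈ Θ, 4 / 5 * ε - ε' ≤ ξ θ - u₁ := by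
    intro θ hθ
    have h1 := (hc θ hθ).2.le_abscissa_sub hG hS.isClosed hv
    have h2 := (lipschitzWith_inner_left hG.isFrame.norm_left p).dist_le_mul u v
    rw [NNReal.coe_one, one_mul, Real.dist_eq, dist_eq_norm] at h2
    have h3 : u₁ - (coords p τ ν v).1 ≤ ‖u - v‖ := (le_abs_self _).trans h2
    linarith
  have hupos : ∀ θ ∈ Θ, u₁ < ξ θ := fun θ hθ => by linarith [hd θ hθ]
  have hαpos : ∀ θ ∈ Θ, 0 < α θ := fun θ hθ => (hc θ hθ).2.inner_pos hG (hupos θ hθ)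
  have hdt : ∀ θ ∈ Θ, ξ θ - u₁ < t θ * α θ := fun θ hθ => (hc θ hθ).2.sub_lt_mul hG
  have hdb : ∀ θ ∈ Θ, ξ θ - u₁ < ℓ θ * α θ := fun θ hθ =>
    (hdt θ hθ).trans_le (mul_le_mul_of_nonneg_right (hc θ hθ).1 (hαpos θ hθ).le)
  have hB : ∀ θ ∈ Θ, ℓ θ * α θ ≤ 2 * D₀ := by
    intro θ hθ
    have h1 := hD₀ _ (add_smul_mem_of_mem_chordParams (hℓ θ))
    have h2 := hD₀ u huS
    have h3 := real_inner_le_norm τ (ℓ θ • s • (θ : EuclideanSpace ℝ (Fin 2)))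
    rw [hG.isFrame.norm_left, one_mul, real_inner_smul_right] at h3
    have h4 := norm_sub_le (u + ℓ θ • s • (θ : EuclideanSpace ℝ (Fin 2))) u
    rw [add_sub_cancel_left] at h4
    simp only [hα]
    linarith
  have hslope : ∀ θ ∈ Θ, ∀ θ' ∈ Θ, ξ θ - u₁ ≤ ξ θ' - u₁ → ξ θ' - u₁ < ℓ θ * α θ →
      β θ / α θ ∈ Icc (deriv h (ξ θ')) (deriv h (ξ θ') + 5 / 4 * ε' / (ξ θ' - u₁)) := by
    intro θ hθ θ' hθ' hle hlt
    have h1 := (hc θ hθ).2.slope_mem_Icc hG (hupos θ hθ) (hc θ' hθ').2 (by linarith) (hℓ θ) hlt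
    refine ⟨h1.1, h1.2.trans ?_⟩
    have := sub_pos.2 (hupos θ' hθ')
    gcongr
  have hσ : ∀ A ⊆ Θ, A.Nonempty →
      (∀ θ ∈ A, ∀ θ' ∈ A, ξ θ - u₁ ≤ ξ θ' - u₁ → ξ θ' - u₁ < ℓ θ * α θ) →
      BddAbove ((fun θ => ξ θ - u₁) '' A) → uniformDirection 2 A ≤
        ENNReal.ofReal (5 / 4 * ε' / (2 * Real.pi) / sSup ((fun θ => ξ θ - u₁) '' A)) := by
    intro A hA hne hpair hbdd
    set D := sSup ((fun θ => ξ θ - u₁) '' A) with hD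
    have hdpos : ∀ θ ∈ A, 0 < ξ θ - u₁ := fun θ hθ => sub_pos.2 (hupos θ (hA hθ))
    obtain ⟨θ₀, hθ₀⟩ := hne
    have hDpos : 0 < D := (hdpos θ₀ hθ₀).trans_le (le_csSup hbdd ⟨θ₀, hθ₀, rfl⟩)
    have hmax : ∀ θ₁ ∈ A, ∀ θ₂ ∈ A, ∀ θ' ∈ A, ξ θ₁ - u₁ ≤ ξ θ' - u₁ → ξ θ₂ - u₁ ≤ ξ θ' - u₁ →
        β θ₁ / α θ₁ - β θ₂ / α θ₂ ≤ 5 / 4 * ε' / (ξ θ' - u₁) := by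
      intro θ₁ h₁ θ₂ h₂ θ' h' hle₁ hle₂
      have e₁ := (hslope θ₁ (hA h₁) θ' (hA h') hle₁ (hpair θ₁ h₁ θ' h' hle₁)).2
      have e₂ := (hslope θ₂ (hA h₂) θ' (hA h') hle₂ (hpair θ₂ h₂ θ' h' hle₂)).1
      linarith
    have hdiff : ∀ θ₁ ∈ A, ∀ θ₂ ∈ A, β θ₁ / α θ₁ - β θ₂ / α θ₂ ≤ 5 / 4 * ε' / D := by
      intro θ₁ h₁ θ₂ h₂
      by_contra hlt
      rw [not_le] at hlt
      have hspos : 0 < β θ₁ / α θ₁ - β θ₂ / α θ₂ := lt_of_le_of_lt (by positivity) hlt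
      have h3 : 5 / 4 * ε' / (β θ₁ / α θ₁ - β θ₂ / α θ₂) < D := by
        rw [div_lt_iff₀ hspos]
        linarith [(div_lt_iff₀ hDpos).1 hlt]
      obtain ⟨_, ⟨θ₃, h₃, rfl⟩, hθ₃⟩ := exists_lt_of_lt_csSup ⟨_, mem_image_of_mem _ hθ₀⟩ h3
      -- the rightmost of the three contacts bounds the difference of the slopes
      obtain ⟨θ', h', l₁, l₂, l₃⟩ : ∃ θ' ∈ A, ξ θ₁ - u₁ ≤ ξ θ' - u₁ ∧ ξ θ₂ - u₁ ≤ ξ θ' - u₁ ∧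
          ξ θ₃ - u₁ ≤ ξ θ' - u₁ := by
        rcases le_total (ξ θ₁) (ξ θ₂) with h12 | h12
        · rcases le_total (ξ θ₂) (ξ θ₃) with h23 | h23
          · exact ⟨θ₃, h₃, by linarith, by linarith, le_rfl⟩
          · exact ⟨θ₂, h₂, by linarith, le_rfl, by linarith⟩
        · rcases le_total (ξ θ₁) (ξ θ₃) with h13 | h13
          · exact ⟨θ₃, h₃, by linarith, by linarith, le_rfl⟩
          · exact ⟨θ₁, h₁, le_rfl, by linarith, by linarith⟩
      have h4 := hmax θ₁ h₁ θ₂ h₂ θ' h' l₁ l₂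
      rw [le_div_iff₀ (hdpos θ' h')] at h4
      rw [div_lt_iff₀ hspos] at hθ₃
      nlinarith
    have hbelow : BddBelow ((fun θ => β θ / α θ) '' A) := ⟨β θ₀ / α θ₀ - 5 / 4 * ε' / D, by
      rintro _ ⟨θ, hθ, rfl⟩
      have := hdiff θ₀ hθ₀ θ hθ
      simp only
      linarith⟩
    set a := sInf ((fun θ => β θ / α θ) '' A) with ha
    have hcone := uniformDirection_cone_le (hG.isFrame.smul hs) (a := a)
      (b := a + 5 / 4 * ε' / D) (by have : 0 ≤ 5 / 4 * ε' / D := by positivity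
                                    linarith)
    refine (measure_mono ?_).trans (hcone.trans_eq ?_)
    · intro θ hθ
      have h1 : a ≤ β θ / α θ := csInf_le hbelow ⟨θ, hθ, rfl⟩
      have h2 : β θ / α θ - 5 / 4 * ε' / D ≤ a := le_csInf ⟨_, θ₀, hθ₀, rfl⟩ (by
        rintro _ ⟨θ', hθ', rfl⟩
        have := hdiff θ hθ θ' hθ'
        simp only
        linarith)
      have e1 : inner ℝ (s • τ) (θ : EuclideanSpace ℝ (Fin 2)) = α θ := by
        simp only [hα]; rw [real_inner_smul_left, real_inner_smul_right]
      have e2 : inner ℝ (s • ν) (θ : EuclideanSpace ℝ (Fin 2)) = β θ := by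
        simp only [hβ]; rw [real_inner_smul_left, real_inner_smul_right]
      have h3 := hαpos θ (hA hθ)
      rw [mem_ofPred_eq, e1, e2]
      exact ⟨h3, (le_div_iff₀ h3).1 h1, (div_le_iff₀ h3).1 (by linarith)⟩
    · congr 1
      rw [add_sub_cancel_left, div_right_comm]
  obtain ⟨G, hGm, hGd, hGi⟩ := exists_telescoping_majorant (uniformDirection 2) (Θ := Θ)
    (d := fun θ => ξ θ - u₁) (b := fun θ => ℓ θ * α θ) (c := 5 / 4 * ε' / (2 * Real.pi))
    (sub_pos.2 hε) (by positivity) hd hdb hB hσ hη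
  refine ⟨G, hGm, fun θ hθ => ?_, hGi⟩
  have hct := hc θ hθ
  have hℓpos : 0 < ℓ θ := hct.2.pos.trans_le hct.1
  have h1 : {r : ℝ | r ∈ Icc 0 (ℓ θ) ∧
      ¬ segment ℝ v (u + r • s • (θ : EuclideanSpace ℝ (Fin 2))) ⊆ S} ⊆ Ioc (t θ) (ℓ θ) := by
    rintro r ⟨hr, hr'⟩
    refine ⟨?_, hr.2⟩
    by_contra hle
    exact hr' (hct.2.segment_subset r ⟨hr.1, not_lt.1 hle⟩)
  calc _ ≤ volume (Ioc (t θ) (ℓ θ)) := measure_mono h1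
    _ = ENNReal.ofReal (ℓ θ - t θ) := Real.volume_Ioc
    _ ≤ ENNReal.ofReal (ℓ θ * (1 - (ξ θ - u₁) / (ℓ θ * α θ))) := by
      refine ENNReal.ofReal_le_ofReal ?_
      have h2 : (ξ θ - u₁) / α θ ≤ t θ := (div_le_iff₀ (hαpos θ hθ)).2 (hdt θ hθ).le
      have h3 : ℓ θ * ((ξ θ - u₁) / (ℓ θ * α θ)) = (ξ θ - u₁) / α θ := by
        have := (hαpos θ hθ).ne'
        field_simp
      rw [mul_sub, mul_one, h3]
      linarith
    _ = ENNReal.ofReal (ℓ θ) * ENNReal.ofReal (1 - (ξ θ - u₁) / (ℓ θ * α θ)) :=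
      ENNReal.ofReal_mul hℓpos.le
    _ ≤ ENNReal.ofReal (ℓ θ) * G θ := by gcongr; exact hGd θ hθ

end Majorant

/-! ### The case of dimension two -/

section Plane

variable {S : Set (EuclideanSpace ℝ (Fin 2))} {p τ ν u v ω : EuclideanSpace ℝ (Fin 2)}
  {h : ℝ → ℝ} {L : ℝ}

theorem segment_add_smul_subset_union (u ω : EuclideanSpace ℝ (Fin 2)) (c t : ℝ) :
    segment ℝ (u + c • ω) (u + t • ω) ⊆ segment ℝ (u + c • ω) u ∪ segment ℝ u (u + t • ω) := by
  have himage : ∀ a b : ℝ, segment ℝ (u + a • ω) (u + b • ω) = (fun r => u + r • ω) '' uIcc a b := by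
    intro a b
    rw [← segment_eq_uIcc, segment_eq_image', segment_eq_image', image_image]
    refine image_congr fun r _ => ?_
    simp only [smul_eq_mul]
    module
  have h0 := himage c 0
  have h1 := himage 0 t
  rw [zero_smul, add_zero] at h0 h1
  rw [himage, h0, h1, ← image_union]
  exact image_mono uIcc_subset_uIcc_union_uIcc

/-- In the plane, a chord through `u` that leaves the view of `v` has a first line of sight that
touches the boundary. -/
theorem exists_first_contact_plane (hS : IsClosed S) (hbd : HasC2Boundary S) (hω : ‖ω‖ = 1)
    (huv : segment ℝ v u ⊆ interior S) {t : ℝ} (ht : 0 ≤ t)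
    (hut : segment ℝ u (u + t • ω) ⊆ S) (hvt : ¬ segment ℝ v (u + t • ω) ⊆ S) :
    ∃ t₀ : ℝ, 0 < t₀ ∧ t₀ < t ∧ (∀ r ∈ Icc 0 t₀, segment ℝ v (u + r • ω) ⊆ S) ∧
      ∃ q ∈ frontier S, q ∈ openSegment ℝ v (u + t₀ • ω) := by
  have hind : ∀ r ∈ Ioo 0 t, ∀ φ, IsDefiningAt S φ (u + r • ω) → u + r • ω ∈ frontier S →
      fderiv ℝ φ (u + r • ω) ω = 0 → fderiv ℝ φ (u + r • ω) (v - (u + r • ω)) ≠ 0 := by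
    intro r _ φ hφ _ hdω hdv
    obtain ⟨τ, hf⟩ := exists_frame_right hω
    obtain ⟨a, b, hab⟩ : ∃ a b : ℝ, v = u + a • τ + b • ω :=
      ⟨_, _, (chart_coords (p := u) hf v).symm⟩
    have h1 : fderiv ℝ φ (u + r • ω) (a • τ) = 0 := by
      have h2 : a • τ = (v - (u + r • ω)) + (r - b) • ω := by
        rw [hab]
        module
      rw [h2, map_add, map_smul, hdv, hdω, smul_zero, add_zero]
    rw [map_smul, smul_eq_mul, mul_eq_zero] at h1
    rcases h1 with h1 | h1
    -- if `v` is on the line of the chord, then that line is visible from `v` as far as from `u`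
    · rw [h1, zero_smul, add_zero] at hab
      refine hvt ?_
      have h2 := segment_add_smul_subset_union u ω b t
      rw [← hab] at h2
      exact h2.trans (union_subset (huv.trans interior_subset) hut)
    · refine hφ.fderiv_ne (ContinuousLinearMap.ext fun x => ?_)
      have hx := chart_coords (p := 0) hf x
      unfold chart at hx
      rw [← hx, zero_add, map_add, map_smul, map_smul, h1, hdω]
      simp
  obtain ⟨t₀, ht₀, hvis, hq⟩ := exists_first_contact hS hbd (huv (left_mem_segment _ _ _)) huv ht
    hut hvt hind
  refine ⟨t₀, ht₀, ?_, hvis, hq⟩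
  by_contra hle
  exact hvt (hvis t ⟨ht, not_lt.1 hle⟩)

/-- A line of sight that touches the graph does so to the right or to the left of `v`. -/
theorem exists_isContact_or (hG : IsFlatGraph S p τ ν h L) (hS : IsClosed S)
    (hv : v ∈ interior S) {t x : ℝ} (ht : 0 < t)
    (hvis : ∀ r ∈ Icc 0 t, segment ℝ v (u + r • ω) ⊆ S) (hx : x ∈ Ioo (-L) L)
    (hmem : chart p τ ν (x, h x) ∈ openSegment ℝ v (u + t • ω)) :
    IsContact S p τ ν h L u v ω t x ∨
      IsContact S p (-τ) ν (fun y => h (-y)) L u v ω t (-x) := by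
  have hX := hG.isHypographAt x (Ioo_subset_Icc_self hx)
  rcases lt_trichotomy (coords p τ ν v).1 x with hlt | heq | hgt
  · exact Or.inl ⟨ht, hvis, hx, hmem, hlt⟩
  · have h1 := hX.sub_eq_of_mem_openSegment hG.isFrame (hvis t ⟨ht.le, le_rfl⟩) hmem
    rw [← heq, sub_self, mul_zero, sub_eq_zero] at h1
    have h2 := hX.mem_frontier hG.isFrame hS
    rw [← heq, h1, chart_coords hG.isFrame] at h2
    exact absurd hv h2.2
  · refine Or.inr ⟨ht, hvis, ⟨by linarith [hx.2], by linarith [hx.1]⟩, ?_, ?_⟩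
    · convert hmem using 1
      simp [chart]
    · simp only [coords, inner_neg_left]
      exact neg_lt_neg hgt

/-- The contribution of one side: for the part of the chord in direction `s θ`, where `s = ±1`, the
fraction hidden from `v` is bounded by a function of `θ` of small integral. -/
theorem exists_hidden_majorant_of_cover (hS : IsCompact S) (hbd : HasC2Boundary S) (huS : u ∈ S)
    {ε ε' : ℝ} (hε0 : 0 < ε) (hv : Metric.ball v ε ⊆ interior S)
    (huvS : segment ℝ v u ⊆ interior S) (huv : ‖u - v‖ ≤ ε') (hε : ε' < 4 / 5 * ε)
    {F : Finset (EuclideanSpace ℝ (Fin 2))}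
    {τ ν : EuclideanSpace ℝ (Fin 2) → EuclideanSpace ℝ (Fin 2)}
    {h : EuclideanSpace ℝ (Fin 2) → ℝ → ℝ} {L : ℝ}
    (hF : ∀ p ∈ F, IsFlatGraph S p (τ p) (ν p) (h p) L)
    (hcov : ∀ q ∈ frontier S, ∃ p ∈ F, ∃ x ∈ Ioo (-L) L, q = chart p (τ p) (ν p) (x, h p x))
    {s : ℝ} (hs : |s| = 1) {ℓ : Metric.sphere (0 : EuclideanSpace ℝ (Fin 2)) 1 → ℝ}
    (hℓ : ∀ θ : Metric.sphere (0 : EuclideanSpace ℝ (Fin 2)) 1,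
      segment ℝ u (u + ℓ θ • s • (θ : EuclideanSpace ℝ (Fin 2))) ⊆ S) {η : ℝ} (hη : 0 < η) :
    ∃ G : Metric.sphere (0 : EuclideanSpace ℝ (Fin 2)) 1 → ℝ≥0∞, Measurable G ∧
      (∀ θ : Metric.sphere (0 : EuclideanSpace ℝ (Fin 2)) 1,
        volume {r : ℝ | r ∈ Icc 0 (ℓ θ) ∧
          ¬ segment ℝ v (u + r • s • (θ : EuclideanSpace ℝ (Fin 2))) ⊆ S} ≤
            ENNReal.ofReal (ℓ θ) * G θ) ∧
      ∫⁻ θ, G θ ∂(uniformDirection 2) ≤ F.card *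
        (2 * ENNReal.ofReal (5 / 4 * ε' / (2 * Real.pi) / (4 / 5 * ε - ε') + η)) := by
  have hex : ∀ p ∈ F, ∃ G : Metric.sphere (0 : EuclideanSpace ℝ (Fin 2)) 1 → ℝ≥0∞, Measurable G ∧
      (∀ θ : Metric.sphere (0 : EuclideanSpace ℝ (Fin 2)) 1,
        (∃ t, 0 < t ∧ t ≤ ℓ θ ∧
          (∀ r ∈ Icc 0 t, segment ℝ v (u + r • s • (θ : EuclideanSpace ℝ (Fin 2))) ⊆ S) ∧
          ∃ x ∈ Ioo (-L) L, chart p (τ p) (ν p) (x, h p x) ∈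
            openSegment ℝ v (u + t • s • (θ : EuclideanSpace ℝ (Fin 2)))) →
        volume {r : ℝ | r ∈ Icc 0 (ℓ θ) ∧
          ¬ segment ℝ v (u + r • s • (θ : EuclideanSpace ℝ (Fin 2))) ⊆ S} ≤
            ENNReal.ofReal (ℓ θ) * G θ) ∧
      ∫⁻ θ, G θ ∂(uniformDirection 2) ≤
        2 * ENNReal.ofReal (5 / 4 * ε' / (2 * Real.pi) / (4 / 5 * ε - ε') + η) := by
    intro p hp
    obtain ⟨G₁, hm₁, hb₁, hi₁⟩ := exists_hidden_majorant (hF p hp) hS huS hv huv hε hs hℓ hη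
    obtain ⟨G₂, hm₂, hb₂, hi₂⟩ :=
      exists_hidden_majorant (hF p hp).neg_left hS huS hv huv hε hs hℓ hη
    refine ⟨fun θ => G₁ θ + G₂ θ, hm₁.add hm₂, ?_, ?_⟩
    · rintro θ ⟨t, ht, htℓ, hvis, x, hx, hmem⟩
      rcases exists_isContact_or (hF p hp) hS.isClosed (hv (Metric.mem_ball_self hε0)) ht hvis hx
        hmem with hc | hc
      · refine (hb₁ θ ⟨t, x, htℓ, hc⟩).trans ?_
        gcongr
        exact le_self_add
      · refine (hb₂ θ ⟨t, -x, htℓ, hc⟩).trans ?_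
        gcongr
        exact le_add_self
    · rw [lintegral_add_left hm₁, two_mul]
      exact add_le_add hi₁ hi₂
  choose! G hGm hGb hGi using hex
  refine ⟨fun θ => ∑ p ∈ F, G p θ, Finset.measurable_fun_sum _ hGm, fun θ => ?_, ?_⟩
  · rcases {r : ℝ | r ∈ Icc 0 (ℓ θ) ∧
      ¬ segment ℝ v (u + r • s • (θ : EuclideanSpace ℝ (Fin 2))) ⊆ S}.eq_empty_or_nonempty
      with he | ⟨r, hr, hr'⟩
    · rw [he, measure_empty]; exact zero_le
    · have hω : ‖s • (θ : EuclideanSpace ℝ (Fin 2))‖ = 1 := by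
        rw [norm_smul, Real.norm_eq_abs, hs, norm_eq_of_mem_sphere, mul_one]
      obtain ⟨t, ht, htr, hvis, q, hq, hqv⟩ := exists_first_contact_plane hS.isClosed hbd hω huvS
        hr.1 (Icc_subset_chordParams (hℓ θ) hr) hr'
      obtain ⟨p, hp, x, hx, rfl⟩ := hcov q hq
      refine (hGb p hp θ ⟨t, ht, htr.le.trans hr.2, hvis, x, hx, hqv⟩).trans ?_
      gcongr
      exact Finset.single_le_sum (f := fun p => G p θ) (fun _ _ => zero_le) hp
  · rw [lintegral_finsetSum' _ fun p hp => (hGm p hp).aemeasurable, ← nsmul_eq_mul]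
    exact Finset.sum_le_card_nsmul _ _ _ hGi

theorem sSup_mem_chordParams (hS : IsCompact S) (huS : u ∈ S) (hω : ‖ω‖ = 1) :
    BddAbove (chordParams S u ω) ∧ sSup (chordParams S u ω) ∈ chordParams S u ω ∧
      0 ≤ sSup (chordParams S u ω) := by
  obtain ⟨D, hD⟩ := hS.isBounded.exists_norm_le
  have hb : BddAbove (chordParams S u ω) := by
    refine ⟨2 * D, fun t ht => ?_⟩
    have h1 := hD _ (add_smul_mem_of_mem_chordParams ht)
    have h2 := hD u huS
    have h3 := norm_sub_le (u + t • ω) u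
    rw [add_sub_cancel_left, norm_smul, hω, mul_one, Real.norm_eq_abs] at h3
    linarith [le_abs_self t]
  have h0 : (0 : ℝ) ∈ chordParams S u ω := by
    change segment ℝ u (u + (0 : ℝ) • ω) ⊆ S
    rw [zero_smul, add_zero, segment_same, singleton_subset_iff]
    exact huS
  exact ⟨hb, (isClosed_chordParams hS.isClosed u ω).csSup_mem ⟨0, h0⟩ hb, le_csSup hb h0⟩

/-- The two halves of the chord together. -/
theorem uniformOnChord_le_add (hS : IsCompact S) (huS : u ∈ S) (hω : ‖ω‖ = 1) {G₁ G₂ : ℝ≥0∞}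
    (h₁ : volume {r : ℝ | r ∈ Icc 0 (sSup (chordParams S u ω)) ∧
      ¬ segment ℝ v (u + r • ω) ⊆ S} ≤ ENNReal.ofReal (sSup (chordParams S u ω)) * G₁)
    (h₂ : volume {r : ℝ | r ∈ Icc 0 (sSup (chordParams S u (-ω))) ∧
      ¬ segment ℝ v (u + r • -ω) ⊆ S} ≤ ENNReal.ofReal (sSup (chordParams S u (-ω))) * G₂) :
    uniformOnChord S u ω {x | x ∉ view S v} ≤ G₁ + G₂ := by
  have hA : MeasurableSet {x | x ∉ view S v} :=
    (isClosed_view hS.isClosed v).measurableSet.compl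
  obtain ⟨hb₁, hm₁, h0₁⟩ := sSup_mem_chordParams hS huS hω
  obtain ⟨hb₂, hm₂, h0₂⟩ := sSup_mem_chordParams hS huS (ω := -ω) (by rw [norm_neg, hω])
  set T := chordParams S u ω with hT
  set a := sSup T
  set b := sSup (chordParams S u (-ω))
  have hneg : ∀ t, t ∈ chordParams S u (-ω) ↔ -t ∈ T := fun t => by
    rw [← neg_mem_chordParams_neg, neg_neg]
  rw [uniformOnChord_apply hS.isClosed u ω hA]
  have hvol : ENNReal.ofReal (a + b) ≤ volume T := by
    have : Icc (-b) a ⊆ T := by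
      intro t ht
      rcases le_total 0 t with h | h
      · exact Icc_subset_chordParams hm₁ ⟨h, ht.2⟩
      · have := (hneg (-t)).1 (Icc_subset_chordParams hm₂ ⟨by linarith, by linarith [ht.1]⟩)
        rwa [neg_neg] at this
    have h3 := measure_mono this (μ := volume)
    rwa [Real.volume_Icc, sub_neg_eq_add] at h3
  have hhid : volume (T ∩ (fun t : ℝ => u + t • ω) ⁻¹' {x | x ∉ view S v}) ≤
      ENNReal.ofReal a * G₁ + ENNReal.ofReal b * G₂ := by
    refine le_trans ?_ (add_le_add h₁ h₂)
    rw [← Measure.measure_neg volume {r : ℝ | r ∈ Icc 0 b ∧ ¬ segment ℝ v (u + r • -ω) ⊆ S}]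
    refine (measure_mono ?_).trans (measure_union_le _ _)
    rintro t ⟨ht, ht'⟩
    have hns : ¬ segment ℝ v (u + t • ω) ⊆ S := fun hseg =>
      ht' ⟨add_smul_mem_of_mem_chordParams ht, hseg⟩
    rcases le_total 0 t with h | h
    · exact Or.inl ⟨⟨h, le_csSup hb₁ ht⟩, hns⟩
    · refine Or.inr ⟨⟨by linarith, le_csSup hb₂ ?_⟩, ?_⟩
      · rw [hneg, neg_neg]; exact ht
      · rwa [neg_smul_neg]
  calc _ ≤ (volume T)⁻¹ * (volume T * (G₁ + G₂)) := by
        gcongr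
        refine hhid.trans ?_
        rw [mul_add]
        refine add_le_add ?_ ?_
        · exact mul_le_mul_left ((ENNReal.ofReal_le_ofReal (by linarith)).trans hvol) _
        · exact mul_le_mul_left ((ENNReal.ofReal_le_ofReal (by linarith)).trans hvol) _
    _ ≤ 1 * (G₁ + G₂) := by
        rw [← mul_assoc]
        exact mul_le_mul_left (ENNReal.inv_mul_le_one _) _
    _ = G₁ + G₂ := one_mul _

theorem sin_pi_div_eight_le : Real.sin (Real.pi / 8) ≤ 39 / 100 := by
  rw [Real.sin_pi_div_eight]
  have h1 : (1.414 : ℝ) ≤ √2 := Real.le_sqrt_of_sq_le (by norm_num)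
  have h2 : √(2 - √2) ≤ 78 / 100 := by
    rw [Real.sqrt_le_left (by norm_num)]
    linarith
  linarith

theorem hitAndRun_le_of_plane (hS : IsCompact S) (hbd : HasC2Boundary S)
    (hκ : sectionCurvature S < ⊤) {ε ε' : ℝ} (hε : 0 < ε) (hu : u ∈ innerPart S ε)
    (hv : v ∈ innerPart S ε) (huv : ‖u - v‖ ≤ ε') (hε' : ε' ≤ ε) :
    hitAndRun S u {x | x ∉ view S v} ≤ ENNReal.ofReal
      ((sectionCurvature S).toReal / Real.sin (Real.pi / 8) * (ε' / ε)) := by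
  have hA : MeasurableSet {x | x ∉ view S v} :=
    (isClosed_view hS.isClosed v).measurableSet.compl
  have hpi := Real.pi_gt_d2
  have hsin : 0 < Real.sin (Real.pi / 8) :=
    Real.sin_pos_of_pos_of_lt_pi (by positivity) (by linarith)
  have hsin' := sin_pi_div_eight_le
  have hε0 : 0 ≤ ε' := (norm_nonneg _).trans huv
  set κ := (sectionCurvature S).toReal
  rcases le_or_gt 1 (κ / Real.sin (Real.pi / 8) * (ε' / ε)) with hbig | hsmall
  · exact (hitAndRun_le_one hS.isClosed u hA).trans (by rwa [ENNReal.one_le_ofReal])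
  have hne : (frontier S).Nonempty := by
    rw [nonempty_iff_ne_empty]
    intro he
    have := hu.2
    rw [he, Metric.infDist_empty] at this
    linarith
  obtain ⟨k, R, hk0, hR, hk, hkR, h2⟩ := exists_curvature_bound hS hbd hκ hne
  obtain ⟨F, τ, ν, h, L, hF, hcard, hcov⟩ := exists_arc_cover hS hbd hk0 hk hR
    (pos_of_mul_pos_right (zero_lt_two.trans_le h2) hk0.le).le
  have hε2 : ε' ≤ Real.sin (Real.pi / 8) / 2 * ε := by
    rw [div_mul_div_comm, div_lt_one (by positivity)] at hsmall
    nlinarith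
  have hε3 : ε' < 4 / 5 * ε := by nlinarith
  set c := 5 / 4 * ε' / (2 * Real.pi) / (4 / 5 * ε - ε') with hc
  have hc0 : 0 ≤ c := div_nonneg (by positivity) (by linarith)
  have hfin : hitAndRun S u {x | x ∉ view S v} ≠ ⊤ :=
    ((hitAndRun_le_one hS.isClosed u hA).trans_lt ENNReal.one_lt_top).ne
  have hmain : ∀ η : ℝ, 0 < η →
      (hitAndRun S u {x | x ∉ view S v}).toReal ≤ 4 * F.card * (c + η) := by
    intro η hη
    have hball := ball_subset_interior_of_mem_innerPart hS.isClosed hε hv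
    have hseg := segment_subset_interior_of_mem_innerPart hS.isClosed hε hu hv (huv.trans hε')
    have hG : ∀ p ∈ F, IsFlatGraph S p (τ p) (ν p) (h p) L := fun p hp =>
      ⟨(hF p hp).1, fun x hx => ((hF p hp).2 x hx).1, fun x hx => ((hF p hp).2 x hx).2⟩
    obtain ⟨G₁, hm₁, hb₁, hi₁⟩ := exists_hidden_majorant_of_cover hS hbd hu.1 hε hball hseg huv
      hε3 hG hcov (s := 1) abs_one (ℓ := fun θ => sSup (chordParams S u θ))
      (fun θ => by
        rw [one_smul]; exact (sSup_mem_chordParams hS hu.1 (norm_eq_of_mem_sphere θ)).2.1) hη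
    obtain ⟨G₂, hm₂, hb₂, hi₂⟩ := exists_hidden_majorant_of_cover hS hbd hu.1 hε hball hseg huv
      hε3 hG hcov (s := -1) (by simp) (ℓ := fun θ => sSup (chordParams S u (-θ)))
      (fun θ => by
        rw [neg_one_smul]
        exact (sSup_mem_chordParams hS hu.1 (by rw [norm_neg, norm_eq_of_mem_sphere θ])).2.1) hη
    refine ENNReal.toReal_le_of_le_ofReal (by positivity) ?_
    rw [hitAndRun_apply hS.isClosed u hA]
    calc _ ≤ ∫⁻ θ, (G₁ θ + G₂ θ) ∂(uniformDirection 2) := lintegral_mono fun θ =>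
          uniformOnChord_le_add hS hu.1 (norm_eq_of_mem_sphere θ) (by simpa using hb₁ θ)
            (by simpa using hb₂ θ)
      _ ≤ F.card * (2 * ENNReal.ofReal (c + η)) + F.card * (2 * ENNReal.ofReal (c + η)) := by
        rw [lintegral_add_left hm₁]
        exact add_le_add hi₁ hi₂
      _ = ENNReal.ofReal (4 * F.card * (c + η)) := by
        rw [ENNReal.ofReal_mul (by positivity), ENNReal.ofReal_mul (by norm_num),
          ENNReal.ofReal_natCast, ENNReal.ofReal_ofNat]
        ring
  refine (ENNReal.le_ofReal_iff_toReal_le hfin (by positivity)).2 ?_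
  have hlim : (hitAndRun S u {x | x ∉ view S v}).toReal ≤ 4 * F.card * c := by
    refine le_of_forall_pos_le_add fun δ hδ => ?_
    have h3 := hmain (δ / (4 * F.card + 1)) (by positivity)
    have h4 : 4 * F.card * (δ / (4 * F.card + 1)) ≤ δ := by
      rw [← mul_div_assoc, div_le_iff₀ (by positivity)]
      nlinarith
    linarith
  refine hlim.trans ?_
  -- with at most `25 κ / 14` graphs the constant is about `2.34 κ`, while `1 / sin (π / 8) > 2.6`
  have hcard' : (F.card : ℝ) ≤ 25 / 14 * κ := by linarith
  have hd0 : 0 < 4 / 5 * ε - ε' := by linarith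
  have hc' : 50 / 7 * c ≤ 1 / Real.sin (Real.pi / 8) * (ε' / ε) := by
    have h5 : 125 * Real.sin (Real.pi / 8) * ε ≤ 28 * Real.pi * (4 / 5 * ε - ε') := by
      have h6 : 121 / 200 * ε ≤ 4 / 5 * ε - ε' := by nlinarith
      have h7 : 28 * (3.14 : ℝ) * (121 / 200 * ε) ≤ 28 * Real.pi * (4 / 5 * ε - ε') := by gcongr
      nlinarith
    have h8 : 50 / 7 * c =
        125 * Real.sin (Real.pi / 8) * ε * ε' /
          (28 * Real.pi * (4 / 5 * ε - ε') * (Real.sin (Real.pi / 8) * ε)) := by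
      rw [hc]
      field_simp
      ring
    have h9 : 1 / Real.sin (Real.pi / 8) * (ε' / ε) =
        28 * Real.pi * (4 / 5 * ε - ε') * ε' /
          (28 * Real.pi * (4 / 5 * ε - ε') * (Real.sin (Real.pi / 8) * ε)) := by
      rw [div_mul_div_comm, one_mul, mul_div_mul_left _ _ (by positivity)]
    rw [h8, h9]
    gcongr
  have hκ0 : 0 ≤ κ := ENNReal.toReal_nonneg
  calc 4 * F.card * c ≤ 4 * (25 / 14 * κ) * c := by gcongr
    _ = κ * (50 / 7 * c) := by ring
    _ ≤ κ * (1 / Real.sin (Real.pi / 8) * (ε' / ε)) := by gcongr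
    _ = κ / Real.sin (Real.pi / 8) * (ε' / ε) := by ring

end Plane

theorem mainTheorem4 (n : ℕ) (hn : 1 ≤ n) (S : Set (EuclideanSpace ℝ (Fin n)))
    (hS : IsCompact S) (hbd : HasC2Boundary S) (hκ : sectionCurvature S < ⊤)
    (u v : EuclideanSpace ℝ (Fin n)) (ε ε' : ℝ) (hε : 0 < ε)
    (hu : u ∈ innerPart S ε) (hv : v ∈ innerPart S ε)
    (huv : ‖u - v‖ ≤ ε') (hε' : ε' ≤ ε) :
    hitAndRun S u {x | x ∉ view S v} ≤
      ENNReal.ofReal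
        (max (4 / Real.pi) ((sectionCurvature S).toReal / Real.sin (Real.pi / 8)) * (ε' / ε)) := by
  have hε0 : 0 ≤ ε' := (norm_nonneg _).trans huv
  by_cases h2 : n = 2
  · subst h2
    refine (hitAndRun_le_of_plane hS hbd hκ hε hu hv huv hε').trans
      (ENNReal.ofReal_le_ofReal ?_)
    gcongr
    exact le_max_right _ _
  · have hseg := segment_subset_interior_of_mem_innerPart hS.isClosed hε hu hv (huv.trans hε')
    rw [hitAndRun_eq_zero_of_forall_segment hS.isClosed fun x hx =>
      segment_subset_of_ne_two h2 hS hbd hκ hseg hx]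
    exact zero_le
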